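/- Let $(\mathfrak n,g)$ be a $7$-dimensional real Lie algebra with an inner product $g$, and assume that $\mathfrak n$ is $2$-step nilpotent, i.e. not abelian and with derived algebra $\mathfrak n'=[\mathfrak n,\mathfrak n]$ contained in the center. Let $\mathfrak r$ be the $g$-orthogonal complement of $\mathfrak n'$, so that $\mathfrak n=\mathfrak r\oplus\mathfrak n'$ and $\mathfrak n^*=\mathfrak r^*\oplus(\mathfrak n')^*$, where for a subspace $W\subset\mathfrak n$ we regard $W^*$ as a subspace of $\mathfrak n^*$ through the orthogonal projection to $W$. For $z\in\mathfrak n'$ let $j(z)\in\mathfrak{so}(\mathfrak r)$ be defined by $g(j(z)x,y)=g(z,[x,y])$ for $x,y\in\mathfrak r$. Let $\mathrm d$ be the Chevalley–Eilenberg differential on $\Lambda^\bullet\mathfrak n^*$, so that $\mathrm d\zeta(x,y)=-\zeta([x,y])$ for $\zeta\in\mathfrak n^*$. A $\mathrm G_2$-structure on $\mathfrak n$ is a form $\varphi\in\Lambda^3\mathfrak n^*$ with $(v\lrcorner\varphi)\wedge(v\lrcorner\varphi)\wedge\varphi\neq0$ for all $v\neq0$. It induces the inner product $g_\varphi$ and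 the orientation with volume form $\mathrm{vol}_\varphi$ (the volume form of $g_\varphi$) that are determined by $g_\varphi(v,w)\,\mathrm{vol}_\varphi=\frac16\,(v\lrcorner\varphi)\wedge(w\lrcorner\varphi)\wedge\varphi$; let $*_\varphi$ be the corresponding Hodge operator. It is purely coclosed if $\mathrm d{*_\varphi}\varphi=0$ and $\mathrm d\varphi\wedge\varphi=0$. On an oriented $4$-dimensional subspace $W\subset\mathfrak n$ with the induced inner product, $\alpha^+=\frac12(\alpha+*\alpha)$ denotes the self-dual component of $\alpha\in\Lambda^2W^*$. (i) If $\dim\mathfrak n'=1$, there exists a purely coclosed $\mathrm G_2$-structure $\varphi$ on $\mathfrak n$ with $g_\varphi=g$ if and only if $\bigl(\operatorname{tr}(j(z)^2)\bigr)^2=4\operatorname{tr}(j(z)^4)$ for every $z\in\mathfrak n'$. (ii) If $\dim\mathfrak n'=2$, there exists a purely coclosed $\mathrm G_2$-structure $\varphi$ on $\mathfrak n$ with $g_\varphi=g$ if and only if there exists an oriented $4$-dimensional subspace $\tilde{\mathfrak r}\subset\mathfrak r$ with $\mathrm d(\mathfrak n')^*\subset\Lambda^2\tilde{\mathfrak r}^*$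 such that, for every orthonormal basis $\{\zeta_1,\zeta_2\}$ of $(\mathfrak n')^*$, the self-dual components $\mathrm d\zeta_1^+,\mathrm d\zeta_2^+\in\Lambda^2\tilde{\mathfrak r}^*$ are orthogonal and have equal norms. (iii) If $\dim\mathfrak n'=3$, there exists a purely coclosed $\mathrm G_2$-structure $\varphi$ on $\mathfrak n$ with $g_\varphi=g$ if and only if, for some orientation of the $4$-dimensional space $\mathfrak r$ and every orthonormal basis $\{\zeta_1,\zeta_2,\zeta_3\}$ of $(\mathfrak n')^*$, the Gram matrix $S$ of the self-dual components, $S_{ij}=g(\mathrm d\zeta_i^+,\mathrm d\zeta_j^+)$, satisfies $(\operatorname{tr}S)^2=2\operatorname{tr}(S^2)$. -/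

import Mathlib

noncomputable section

namespace PureCoclosedG2

/-! ### Exterior forms on a real vector space -/

section Forms

variable {V : Type*} [AddCommGroup V] [Module ℝ V]

/-- The exterior algebra `Λ V*`; its product is the wedge product of forms. The `k`-forms are the
elements of the submodule `⋀[ℝ]^k (Module.Dual ℝ V)`. -/
abbrev Forms (V : Type*) [AddCommGroup V] [Module ℝ V] : Type _ :=
  ExteriorAlgebra ℝ (Module.Dual ℝ V)

/-- A covector seen as a `1`-form. -/
def oneForm : Module.Dual ℝ V →ₗ[ℝ] Forms V :=
  ExteriorAlgebra.ι ℝ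

/-- The interior product `v ⌟ ω`, i.e. the antiderivation of degree `-1` of `Λ V*` with
`v ⌟ ζ = ζ v` for every covector `ζ`. -/
def interior : V →ₗ[ℝ] Module.End ℝ (Forms V) :=
  (CliffordAlgebra.contractLeft (Q := (0 : QuadraticForm ℝ (Module.Dual ℝ V)))).comp
    (Module.Dual.eval ℝ V)

/-- The interior product with `v` is an antiderivation, with `v ⌟ ζ = ζ v`. -/
theorem interior_oneForm_mul (v : V) (ζ : Module.Dual ℝ V) (ω : Forms V) :
    interior v (oneForm ζ * ω) = ζ v • ω - oneForm ζ * interior v ω :=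
  CliffordAlgebra.contractLeft_ι_mul _ _ _

theorem interior_oneForm (v : V) (ζ : Module.Dual ℝ V) :
    interior v (oneForm ζ) = algebraMap ℝ (Forms V) (ζ v) :=
  CliffordAlgebra.contractLeft_ι (0 : QuadraticForm ℝ (Module.Dual ℝ V))
    (Module.Dual.eval ℝ V v) ζ

theorem interior_one (v : V) : interior v (1 : Forms V) = 0 :=
  CliffordAlgebra.contractLeft_one (0 : QuadraticForm ℝ (Module.Dual ℝ V))
    (Module.Dual.eval ℝ V v)

theorem interior_interior (v : V) (ω : Forms V) : interior v (interior v ω) = 0 :=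
  CliffordAlgebra.contractLeft_contractLeft _ _

theorem oneForm_mul_self (ζ : Module.Dual ℝ V) : oneForm ζ * oneForm ζ = 0 :=
  ExteriorAlgebra.ι_sq_zero ζ

theorem oneForm_mul_comm (ζ η : Module.Dual ℝ V) :
    oneForm ζ * oneForm η = -(oneForm η * oneForm ζ) :=
  eq_neg_of_add_eq_zero_left (ExteriorAlgebra.ι_add_mul_swap ζ η)

end Forms

/-! ### Inner products and the operations on forms they induce -/

section Metric

variable {V : Type*} [AddCommGroup V] [Module ℝ V]

/-- The bilinear form underlying an inner product `g`. -/
def bilin (g : InnerProductSpace.Core ℝ V) : LinearMap.BilinForm ℝ V :=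
  LinearMap.mk₂ ℝ (fun x y => g.inner x y)
    (fun x y z => g.add_left x y z)
    (fun c x y => by simpa using g.smul_left x y c)
    (fun x y z => by
      have hs : ∀ a b : V, g.inner a b = g.inner b a := fun a b => by
        simpa using (g.conj_inner_symm a b).symm
      rw [hs x, g.add_left, hs y, hs z])
    (fun c x y => by
      have hs : ∀ a b : V, g.inner a b = g.inner b a := fun a b => by
        simpa using (g.conj_inner_symm a b).symm
      rw [hs x, hs x]
      simpa using g.smul_left y x c)

theorem bilin_comm (g : InnerProductSpace.Core ℝ V) (x y : V) : bilin g x y = bilin g y x := by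
  simpa [bilin] using (g.conj_inner_symm x y).symm

theorem bilin_self_eq_zero (g : InnerProductSpace.Core ℝ V) {x : V} (h : bilin g x x = 0) :
    x = 0 :=
  g.definite x h

/-- The restriction of an inner product to a subspace is nondegenerate. -/
theorem restrict_nondegenerate (g : InnerProductSpace.Core ℝ V) (W : Submodule ℝ V) :
    ((bilin g).restrict W).Nondegenerate :=
  ⟨fun x hx => Subtype.ext (bilin_self_eq_zero g (hx x)),
    fun x hx => Subtype.ext (bilin_self_eq_zero g (hx x))⟩

theorem bilin_nondegenerate (g : InnerProductSpace.Core ℝ V) : (bilin g).Nondegenerate :=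
  ⟨fun x hx => bilin_self_eq_zero g (hx x), fun x hx => bilin_self_eq_zero g (hx x)⟩

/-- The metric dual `v♭ = g(v, ·)` of a vector, as a `1`-form. -/
def flat (g : InnerProductSpace.Core ℝ V) : V →ₗ[ℝ] Forms V :=
  oneForm.comp (bilin g)

/-- `e` is a `g`-orthonormal basis of the subspace `W`. -/
def IsOrthonormalBasisOf (g : InnerProductSpace.Core ℝ V) (W : Submodule ℝ V) {k : ℕ}
    (e : Fin k → V) : Prop :=
  (∀ i j, bilin g (e i) (e j) = if i = j then 1 else 0) ∧ Submodule.span ℝ (Set.range e) = W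

/-- `vol = e₁♭ ∧ … ∧ e_k♭` for some `g`-orthonormal basis `e` of the `k`-dimensional subspace `W`.
There are exactly two such forms, opposite to each other; to choose one of them is to
orient `W`. The positively oriented orthonormal bases are those whose wedge product is `vol`. -/
def IsVolumeForm (g : InnerProductSpace.Core ℝ V) (W : Submodule ℝ V) (k : ℕ)
    (vol : Forms V) : Prop :=
  ∃ e : Fin k → V, IsOrthonormalBasisOf g W e ∧
    vol = ExteriorAlgebra.ιMulti ℝ k (fun i => bilin g (e i))

/-- The space `Λᵏ W* ⊆ Λᵏ V*` for a subspace `W`, where `W* ⊆ V*` through the orthogonal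
projection to `W`: it is spanned by the forms `w₁♭ ∧ … ∧ w_k♭` with `wᵢ` in `W`. -/
def formsOn (g : InnerProductSpace.Core ℝ V) (W : Submodule ℝ V) (k : ℕ) :
    Submodule ℝ (Forms V) :=
  Submodule.span ℝ {ω | ∃ w : Fin k → V, (∀ i, w i ∈ W) ∧
    ω = ExteriorAlgebra.ιMulti ℝ k (fun i => bilin g (w i))}

variable [FiniteDimensional ℝ V]

/-- The metric dual `ζ♯` of a covector. -/
def sharp (g : InnerProductSpace.Core ℝ V) : Module.Dual ℝ V →ₗ[ℝ] V :=
  ((bilin g).toDual (bilin_nondegenerate g)).symm.toLinearMap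

theorem bilin_sharp (g : InnerProductSpace.Core ℝ V) (ζ : Module.Dual ℝ V) (v : V) :
    bilin g (sharp g ζ) v = ζ v :=
  LinearMap.BilinForm.apply_toDual_symm_apply ζ v

/-- Auxiliary: `ζ₁ ∧ … ∧ ζ_k` acts on forms by `ζ₁♯ ⌟ (… (ζ_k♯ ⌟ ·))`. -/
def contractAux (g : InnerProductSpace.Core ℝ V) : Forms V →ₐ[ℝ] Module.End ℝ (Forms V) :=
  ExteriorAlgebra.lift ℝ ⟨interior.comp (sharp g), fun ζ =>
    LinearMap.ext fun ω => interior_interior (sharp g ζ) ω⟩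

/-- The contraction of `β` with `α` through `g`: for `α = ζ₁ ∧ … ∧ ζ_k` it is
`ζ_k♯ ⌟ (… (ζ₁♯ ⌟ β))`, the form `β(ζ₁♯, …, ζ_k♯, ·, …, ·)`. -/
def contract (g : InnerProductSpace.Core ℝ V) (α β : Forms V) : Forms V :=
  contractAux g (CliffordAlgebra.reverse α) β

/-- The inner product on forms induced by `g`: on `k`-forms, it is the inner product for which
`⟨ζ₁ ∧ … ∧ ζ_k, η₁ ∧ … ∧ η_k⟩ = det (⟨ζᵢ, ηⱼ⟩)`. -/
def formInner (g : InnerProductSpace.Core ℝ V) (α β : Forms V) : ℝ :=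
  ExteriorAlgebra.algebraMapInv (contract g α β)

/-- The norm of a form. -/
def formNorm (g : InnerProductSpace.Core ℝ V) (α : Forms V) : ℝ :=
  Real.sqrt (formInner g α α)

/-- The Hodge operator of an oriented Euclidean subspace `W` with volume form `vol`: for `ω` in
`Λ W*` it is the contraction of `vol` with `ω`. For a positively oriented orthonormal coframe
`e¹, …, eⁿ` of `W` it maps `e¹ ∧ … ∧ eᵏ` to `eᵏ⁺¹ ∧ … ∧ eⁿ`. -/
def hodge (g : InnerProductSpace.Core ℝ V) (vol ω : Forms V) : Forms V :=
  contract g ω vol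

/-- The self-dual component `α⁺` of a `2`-form `α` on an oriented Euclidean `4`-dimensional
subspace with volume form `vol`. -/
def selfDual (g : InnerProductSpace.Core ℝ V) (vol α : Forms V) : Forms V :=
  (1 / 2 : ℝ) • (α + hodge g vol α)

end Metric

/-! ### `G₂`-structures -/

section G2

variable {V : Type*} [AddCommGroup V] [Module ℝ V]

/-- A `G₂`-structure on a `7`-dimensional space: a `3`-form `φ` with
`(v ⌟ φ) ∧ (v ⌟ φ) ∧ φ ≠ 0` for every `v ≠ 0`. -/
def IsG2Structure (φ : Forms V) : Prop :=
  φ ∈ ⋀[ℝ]^3 (Module.Dual ℝ V) ∧ ∀ v : V, v ≠ 0 → interior v φ * interior v φ * φ ≠ 0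

/-- The inner product `g` and the volume form `vol` (of `g` and of one of the two orientations)
are the ones that the `G₂`-structure `φ` induces:
`g(v, w) vol = 1/6 (v ⌟ φ) ∧ (w ⌟ φ) ∧ φ`. -/
def Induces (φ : Forms V) (g : InnerProductSpace.Core ℝ V) (vol : Forms V) : Prop :=
  IsVolumeForm g ⊤ 7 vol ∧
    ∀ v w : V, bilin g v w • vol = (1 / 6 : ℝ) • (interior v φ * interior w φ * φ)

end G2

/-! ### Lie algebras -/

section Lie

variable {𝔫 : Type*} [LieRing 𝔫] [LieAlgebra ℝ 𝔫]

/-- The derived algebra `𝔫' = [𝔫, 𝔫]`. -/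
def derivedAlgebra (𝔫 : Type*) [LieRing 𝔫] [LieAlgebra ℝ 𝔫] : LieIdeal ℝ 𝔫 :=
  ⁅(⊤ : LieIdeal ℝ 𝔫), (⊤ : LieIdeal ℝ 𝔫)⁆

/-- `𝔫` is `2`-step nilpotent: it is not abelian and its derived algebra is central. -/
def IsTwoStepNilpotent (𝔫 : Type*) [LieRing 𝔫] [LieAlgebra ℝ 𝔫] : Prop :=
  ¬ IsLieAbelian 𝔫 ∧ derivedAlgebra 𝔫 ≤ LieAlgebra.center ℝ 𝔫

/-- The orthogonal complement `𝔯` of the derived algebra. -/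
def orthoDerived (g : InnerProductSpace.Core ℝ 𝔫) : Submodule ℝ 𝔫 :=
  (bilin g).orthogonal (derivedAlgebra 𝔫).toSubmodule

variable [FiniteDimensional ℝ 𝔫]

/-- The endomorphism `j(z)` of `𝔯` with `g(j(z) x, y) = g(z, [x, y])` for `x`, `y` in `𝔯`. -/
def j (g : InnerProductSpace.Core ℝ 𝔫) (z : 𝔫) : Module.End ℝ (orthoDerived g) :=
  (((bilin g).restrict (orthoDerived g)).toDual
      (restrict_nondegenerate g (orthoDerived g))).symm.toLinearMap.comp
    (LinearMap.mk₂ ℝ (fun x y : orthoDerived g => bilin g z ⁅(x : 𝔫), (y : 𝔫)⁆)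
      (fun x y t => by simp) (fun c x y => by simp) (fun x y t => by simp) (fun c x y => by simp))

theorem bilin_j (g : InnerProductSpace.Core ℝ 𝔫) (z : 𝔫) (x y : orthoDerived g) :
    bilin g (j g z x : 𝔫) (y : 𝔫) = bilin g z ⁅(x : 𝔫), (y : 𝔫)⁆ :=
  LinearMap.BilinForm.apply_toDual_symm_apply
    (hB := restrict_nondegenerate g (orthoDerived g)) _ y

/-- The Chevalley–Eilenberg differential on `Λ 𝔫*`: for a basis `(bᵢ)` of `𝔫` with dual basis
`(bⁱ)`, `d ω = -1/2 ∑ᵢⱼ bⁱ ∧ bʲ ∧ ([bᵢ, bⱼ] ⌟ ω)`. By the three lemmas below it is the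
antiderivation of degree `1` with `(d ζ)(x, y) = -ζ([x, y])` for every covector `ζ`. -/
def ceD : Module.End ℝ (Forms 𝔫) :=
  (-1 / 2 : ℝ) • ∑ i, ∑ k,
    (LinearMap.mulLeft ℝ (oneForm ((Module.finBasis ℝ 𝔫).coord i) *
      oneForm ((Module.finBasis ℝ 𝔫).coord k))).comp
        (interior ⁅Module.finBasis ℝ 𝔫 i, Module.finBasis ℝ 𝔫 k⁆)

theorem ceD_apply (ω : Forms 𝔫) :
    ceD ω = (-1 / 2 : ℝ) • ∑ i, ∑ k, oneForm ((Module.finBasis ℝ 𝔫).coord i) *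
      oneForm ((Module.finBasis ℝ 𝔫).coord k) *
        interior ⁅Module.finBasis ℝ 𝔫 i, Module.finBasis ℝ 𝔫 k⁆ ω := by
  simp [ceD, LinearMap.sum_apply, mul_assoc]

theorem ceD_one : ceD (1 : Forms 𝔫) = 0 := by
  simp [ceD_apply, interior_one]

theorem ceD_oneForm_mul (ζ : Module.Dual ℝ 𝔫) (ω : Forms 𝔫) :
    ceD (oneForm ζ * ω) = ceD (oneForm ζ) * ω - oneForm ζ * ceD ω := by
  have h : ∀ α β : Module.Dual ℝ 𝔫, ∀ x : Forms 𝔫,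
      oneForm α * oneForm β * (oneForm ζ * x) = oneForm ζ * (oneForm α * oneForm β * x) := by
    intro α β x
    rw [← mul_assoc, mul_assoc (oneForm α), oneForm_mul_comm β ζ, mul_neg, ← mul_assoc,
      oneForm_mul_comm α ζ]
    simp [mul_assoc]
  simp only [ceD_apply, interior_oneForm_mul, interior_oneForm, mul_sub, h,
    Finset.sum_sub_distrib, smul_sub, Finset.mul_sum, Finset.sum_mul, smul_mul_assoc,
    mul_smul_comm, ← Algebra.commutes, ← Algebra.smul_def]

theorem ceD_oneForm_apply (ζ : Module.Dual ℝ 𝔫) (x y : 𝔫) :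
    interior y (interior x (ceD (oneForm ζ))) = algebraMap ℝ (Forms 𝔫) (-ζ ⁅x, y⁆) := by
  have h : ∀ (α β : Module.Dual ℝ 𝔫) (c : ℝ),
      interior y (interior x (oneForm α * oneForm β * algebraMap ℝ (Forms 𝔫) c)) =
        algebraMap ℝ (Forms 𝔫) (c * (α x * β y) - c * (β x * α y)) := by
    intro α β c
    rw [← Algebra.commutes, ← Algebra.smul_def, map_smul, interior_oneForm_mul, interior_oneForm,
      ← Algebra.commutes, ← Algebra.smul_def, map_smul, map_sub, map_smul, map_smul,
      interior_oneForm, interior_oneForm, Algebra.smul_def, Algebra.smul_def, Algebra.smul_def,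
      ← map_mul, ← map_mul, ← map_sub, ← map_mul, mul_sub]
  have hx := (Module.finBasis ℝ 𝔫).sum_repr x
  have hy := (Module.finBasis ℝ 𝔫).sum_repr y
  have e1 : ζ ⁅x, y⁆ = ∑ i, ∑ k, ζ ⁅Module.finBasis ℝ 𝔫 i, Module.finBasis ℝ 𝔫 k⁆ *
      ((Module.finBasis ℝ 𝔫).repr x i * (Module.finBasis ℝ 𝔫).repr y k) := by
    conv_lhs => rw [← hx, ← hy]
    simp only [sum_lie, lie_sum, smul_lie, lie_smul, map_sum, map_smul,
      smul_eq_mul, Finset.mul_sum]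
    rw [Finset.sum_comm]
    exact Finset.sum_congr rfl fun i _ => Finset.sum_congr rfl fun k _ => by ring
  have e2 : -ζ ⁅x, y⁆ = ∑ i, ∑ k, ζ ⁅Module.finBasis ℝ 𝔫 i, Module.finBasis ℝ 𝔫 k⁆ *
      ((Module.finBasis ℝ 𝔫).repr x k * (Module.finBasis ℝ 𝔫).repr y i) := by
    rw [e1, Finset.sum_comm, ← Finset.sum_neg_distrib]
    refine Finset.sum_congr rfl fun i _ => ?_
    rw [← Finset.sum_neg_distrib]
    refine Finset.sum_congr rfl fun k _ => ?_
    rw [← lie_skew, map_neg]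
    ring
  have e3 : -ζ ⁅x, y⁆ = (-1 / 2 : ℝ) * (ζ ⁅x, y⁆ - -ζ ⁅x, y⁆) := by ring
  rw [e3, e2, e1, ceD_apply]
  simp only [interior_oneForm, map_smul, map_sum, h, Module.Basis.coord_apply]
  rw [Algebra.smul_def, map_mul, ← Finset.sum_sub_distrib]
  simp only [← Finset.sum_sub_distrib, map_sum]

/-- The Gram matrix of the self-dual components of `d z₁♭, …, d z_k♭`. -/
def gramSelfDual (g : InnerProductSpace.Core ℝ 𝔫) (vol : Forms 𝔫) {k : ℕ} (z : Fin k → 𝔫) :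
    Matrix (Fin k) (Fin k) ℝ :=
  Matrix.of fun a b =>
    formInner g (selfDual g vol (ceD (flat g (z a)))) (selfDual g vol (ceD (flat g (z b))))

/-- There is a purely coclosed `G₂`-structure `φ` on `𝔫` that induces the inner product `g`:
`d (* φ) = 0` and `d φ ∧ φ = 0`, where `*` is the Hodge operator of `g` and of the orientation
induced by `φ`. -/
def HasPurelyCoclosedG2 (g : InnerProductSpace.Core ℝ 𝔫) : Prop :=
  ∃ φ vol : Forms 𝔫, IsG2Structure φ ∧ Induces φ g vol ∧
    ceD (hodge g vol φ) = 0 ∧ ceD φ * φ = 0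

end Lie

end PureCoclosedG2

end

noncomputable section

namespace PureCoclosedG2

/-! Everything rests on a normal form. If `φ` induces `g`, then any two orthonormal vectors `u`, `v`
start a `g`-orthonormal basis in which `φ = θ₀₁₂ + ∑ θₐ ∧ ωₐ`, where `ω₀, ω₁, ω₂` span the self-dual
`2`-forms of the last four vectors (`Induces.exists_adapted`). To obtain it, the skew form `u ⌟ φ`
on `u⊥` is put in normal form. The polynomial equations expressing that `φ` induces `g` force its
three moduli to be `1` (`sq_eq_one_of_blockForm`). Hence the cross product with `u` is an isometry
of `u⊥`, and polarization gives the Clifford relations that determine the whole multiplication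
table.

If `dim 𝔫' = 1`, let `u` span `𝔫'`. Then `φ = ζ ∧ ω + ρ` for an `SU(3)`-structure on `𝔯`;
coclosedness says that `dζ` has type `(1, 1)`, and `dφ ∧ φ = 0` that it is primitive. If `± i aₖ`
are the eigenvalues of `j(z)`, this is possible iff `a₀ ± a₁ ± a₂ = 0` for some signs, which by
Heron's factorization means `(∑ aₖ²)² = 2 ∑ aₖ⁴`: the trace condition.

If `dim 𝔫'` is `2` or `3`, one works in a frame whose first three vectors are central and span a
space containing `𝔫'`. Let `M` be the `3 × 3` matrix of coordinates of the `(dθₐ)⁺` with respect to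
the `ωₖ`. The model form in this frame is purely coclosed when `M` is symmetric and trace-free
(`IsCentralFrame.hasPurelyCoclosedG2`). Rotating the three central vectors multiplies `M` on the
left by an orthogonal matrix, so the question is whether `M` is orthogonal times symmetric
trace-free. By polar decomposition this asks for signs that make the singular values of `M` sum to
zero; by Heron again, it is `(tr M Mᵀ)² = 2 tr (M Mᵀ)²`, and `M Mᵀ` is the Gram matrix up to a
factor. If `dim 𝔫' = 2`, one row vanishes and the condition says that the remaining `2 × 2` Gram
matrix is scalar.

Necessity has to produce the frame. For `dim 𝔫' = 2`, the cross product of a basis of `𝔫'` turns out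
to be central. For `dim 𝔫' = 3`, the space `𝔫'` may be tilted with respect to the cross product, but
the equations still give symmetry and zero trace in a basis adapted to `𝔫' ⊕ 𝔯`.

All identities of forms are reduced to scalar equations by representing forms as binary trees of
coefficients (`Coeffs`), on which products, contractions and vanishing are computable. -/

/-! ### Forms in coordinates -/

/-- Coefficients of a form in a coframe of length `n`: `node a b` stands for `a + θₙ ∧ b`, where `a`
and `b` only involve the first `n` covectors. -/
inductive Coeffs : ℕ → Type
  | zero {n : ℕ} : Coeffs n
  | scalar {n : ℕ} (r : ℝ) : Coeffs n
  | node {n : ℕ} (a b : Coeffs n) : Coeffs (n + 1)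

namespace Coeffs

/-- The node `a + θₙ ∧ b`, pruned if `a` and `b` vanish. -/
def mk : {n : ℕ} → Coeffs n → Coeffs n → Coeffs (n + 1)
  | _, zero, zero => zero
  | _, zero, scalar r => node zero (scalar r)
  | _, zero, node a b => node zero (node a b)
  | _, scalar r, y => node (scalar r) y
  | _, node a b, y => node (node a b) y

/-- Addition of a scalar. -/
def plusScalar (r : ℝ) : {n : ℕ} → Coeffs n → Coeffs n
  | _, zero => scalar r
  | _, scalar s => scalar (r + s)
  | _, node c d => node (plusScalar r c) d

/-- Addition of forms. -/
def plus : {n : ℕ} → Coeffs n → Coeffs n → Coeffs n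
  | _, zero, y => y
  | _, scalar r, y => plusScalar r y
  | _, node a b, zero => node a b
  | _, node a b, scalar s => node (plusScalar s a) b
  | _, node a b, node c d => node (plus a c) (plus b d)

/-- Multiplication by a scalar. -/
def scale (r : ℝ) : {n : ℕ} → Coeffs n → Coeffs n
  | _, zero => zero
  | _, scalar s => scalar (r * s)
  | _, node c d => node (scale r c) (scale r d)

/-- Negation of a form. -/
def opp : {n : ℕ} → Coeffs n → Coeffs n
  | _, zero => zero
  | _, scalar s => scalar (-s)
  | _, node c d => node (opp c) (opp d)

/-- The grade involution. -/
def invol : {n : ℕ} → Coeffs n → Coeffs n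
  | _, zero => zero
  | _, scalar s => scalar s
  | _, node c d => node (invol c) (opp (invol d))

/-- The wedge product. -/
def times : {n : ℕ} → Coeffs n → Coeffs n → Coeffs n
  | _, zero, _ => zero
  | _, scalar r, y => scale r y
  | _, node _ _, zero => zero
  | _, node a b, scalar s => node (scale s a) (scale s b)
  | _, node a b, node c d => mk (times a c) (plus (times b c) (times (invol a) d))

/-- The interior product with the `i`-th vector of the dual frame. -/
def contr (i : ℕ) : {n : ℕ} → Coeffs n → Coeffs n
  | _, zero => zero
  | _, scalar _ => zero
  | n + 1, node a b => if i = n then mk b zero else mk (contr i a) (opp (contr i b))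

/-- The contraction of the second form with the first. -/
def contrForm {N : ℕ} : {n : ℕ} → Coeffs n → Coeffs N → Coeffs N
  | _, zero, _ => zero
  | _, scalar r, y => scale r y
  | n + 1, node a b, y => plus (contrForm a y) (contrForm b (contr n y))

/-- The `i`-th covector of the coframe. -/
def covec (i : ℕ) : {n : ℕ} → Coeffs n
  | 0 => zero
  | n + 1 => if i = n then node zero (scalar 1) else mk (covec i) zero

/-- The vanishing of all the coefficients. -/
def IsZero : {n : ℕ} → Coeffs n → Prop
  | _, zero => True
  | _, scalar r => r = 0
  | _, node a b => IsZero a ∧ IsZero b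

/-- The scalar component. -/
def const : {n : ℕ} → Coeffs n → ℝ
  | _, zero => 0
  | _, scalar r => r
  | _, node a _ => const a

/-- The `k`-form with given coefficients, indexed by decreasing lists. -/
def gen : (n k : ℕ) → (List ℕ → ℝ) → Coeffs n
  | _, 0, c => scalar (c [])
  | 0, _ + 1, _ => zero
  | n + 1, k + 1, c => mk (gen n (k + 1) c) (gen n k fun l => c (n :: l))

variable {V : Type*} [AddCommGroup V] [Module ℝ V]

/-- The form with given coefficients in the coframe `θ`. -/
def eval (θ : ℕ → Module.Dual ℝ V) : {n : ℕ} → Coeffs n → Forms V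
  | _, zero => 0
  | _, scalar r => algebraMap ℝ (Forms V) r
  | n + 1, node a b => eval θ a + oneForm (θ n) * eval θ b

variable (θ : ℕ → Module.Dual ℝ V)

theorem eval_mk {n : ℕ} (a b : Coeffs n) :
    eval θ (mk a b) = eval θ a + oneForm (θ n) * eval θ b := by
  cases a <;> cases b <;> simp [mk, eval]

theorem eval_plusScalar (r : ℝ) {n : ℕ} (a : Coeffs n) :
    eval θ (plusScalar r a) = algebraMap ℝ (Forms V) r + eval θ a := by
  induction a with
  | zero => simp [plusScalar, eval]
  | scalar s => simp [plusScalar, eval]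
  | node c d h1 h2 => simp [plusScalar, eval, h1, add_assoc]

theorem eval_plus {n : ℕ} (a b : Coeffs n) : eval θ (plus a b) = eval θ a + eval θ b := by
  induction a with
  | zero => simp [plus, eval]
  | scalar s => simp [plus, eval, eval_plusScalar]
  | node c d h1 h2 =>
    cases b with
    | zero => simp [plus, eval]
    | scalar s => simp only [plus, eval, eval_plusScalar]; abel
    | node a b => simp only [plus, eval, h1, h2, mul_add]; abel

theorem eval_scale (r : ℝ) {n : ℕ} (a : Coeffs n) : eval θ (scale r a) = r • eval θ a := by
  induction a with
  | zero => simp [scale, eval]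
  | scalar s => simp [scale, eval, Algebra.smul_def]
  | node c d h1 h2 => simp [scale, eval, h1, h2]

theorem eval_opp {n : ℕ} (a : Coeffs n) : eval θ (opp a) = -eval θ a := by
  induction a with
  | zero => simp [opp, eval]
  | scalar s => simp [opp, eval]
  | node c d h1 h2 => simp [opp, eval, h1, h2]; abel

/-- A covector passes a form of degree `k` at the cost of `(-1)ᵏ`, which is the grade involution. -/
theorem eval_mul_oneForm {n : ℕ} (a : Coeffs n) (ζ : Module.Dual ℝ V) :
    eval θ a * oneForm ζ = oneForm ζ * eval θ (invol a) := by
  induction a with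
  | zero => simp [invol, eval]
  | scalar s => simp [invol, eval, Algebra.commutes]
  | @node n c d h1 h2 =>
    simp only [invol, eval, eval_opp, add_mul, mul_add, h1, mul_assoc, h2, mul_neg]
    rw [← mul_assoc, ← mul_assoc, oneForm_mul_comm (θ n) ζ, neg_mul]

theorem eval_times {n : ℕ} (a b : Coeffs n) : eval θ (times a b) = eval θ a * eval θ b := by
  induction n with
  | zero => cases a <;> simp [times, eval, eval_scale, Algebra.smul_def]
  | succ n ih =>
    cases a with
    | zero => simp [times, eval]
    | scalar s => simp [times, eval, eval_scale, Algebra.smul_def]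
    | node c d =>
      cases b with
      | zero => simp [times, eval]
      | scalar s => simp only [times, eval, eval_scale, ← Algebra.commutes s, Algebra.smul_def,
          mul_add, Algebra.left_comm]
      | node a b =>
        simp only [times, eval, eval_mk, eval_plus, ih, mul_add, add_mul]
        -- The fourth product contains `θ n` twice; this is why `times` has only three terms.
        have : oneForm (θ n) * eval θ d * (oneForm (θ n) * eval θ b) = 0 := by
          rw [mul_assoc, ← mul_assoc (eval θ d), eval_mul_oneForm, ← mul_assoc, ← mul_assoc,
            oneForm_mul_self, zero_mul, zero_mul]
        rw [this, ← mul_assoc (eval θ c), eval_mul_oneForm, add_zero]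
        simp only [mul_assoc]
        abel

theorem interior_algebraMap (v : V) (r : ℝ) : interior v (algebraMap ℝ (Forms V) r) = 0 := by
  rw [Algebra.algebraMap_eq_smul_one, map_smul, interior_one, smul_zero]

theorem interior_eval_eq_zero {v : V} {n : ℕ} (h : ∀ i < n, θ i v = 0) (a : Coeffs n) :
    interior v (eval θ a) = 0 := by
  induction a with
  | zero => simp [eval]
  | scalar s => simp [eval, interior_algebraMap]
  | @node n c d h1 h2 =>
    simp [eval, h1 fun i hi => h i (by omega), h2 fun i hi => h i (by omega),
      interior_oneForm_mul, h n (by omega)]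

variable {θ} {E : ℕ → V}

theorem eval_contr {i n : ℕ} (h : ∀ j < n, θ j (E i) = if i = j then 1 else 0) (a : Coeffs n) :
    eval θ (contr i a) = interior (E i) (eval θ a) := by
  induction a with
  | zero => simp [contr, eval]
  | scalar s => simp [contr, eval, interior_algebraMap]
  | @node n c d h1 h2 =>
    rw [contr, eval, map_add, interior_oneForm_mul, h n (by omega)]
    split_ifs with hi
    · subst hi
      have h0 : ∀ j < i, θ j (E i) = 0 := fun j hj => by rw [h j (by omega), if_neg (by omega)]
      simp [eval_mk, eval, interior_eval_eq_zero θ h0]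
    · simp [eval_mk, eval_opp, h1 fun i hi => h i (by omega), h2 fun i hi => h i (by omega)]

/-- Contracting with `E n` isolates the right subtree; once it vanishes, only the left one remains.
On a concrete tree, this turns an identity of forms into its list of scalar equations. -/
theorem eval_eq_zero_iff {n : ℕ} (h : ∀ i < n, ∀ j < n, θ j (E i) = if i = j then 1 else 0)
    (a : Coeffs n) : eval θ a = 0 ↔ IsZero a := by
  induction a with
  | zero => simp [IsZero, eval]
  | scalar s => simp [IsZero, eval]
  | @node n c d h1 h2 =>
    have h' : ∀ i < n, ∀ j < n, θ j (E i) = if i = j then 1 else 0 :=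
      fun i hi j hj => h i (by omega) j (by omega)
    rw [IsZero, ← h1 h', ← h2 h', eval]
    refine ⟨fun h3 => ?_, fun h3 => by simp [h3.1, h3.2]⟩
    have h0 : ∀ j < n, θ j (E n) = 0 := fun j hj => by
      rw [h n (by omega) j (by omega), if_neg (by omega)]
    have h4 := congrArg (interior (E n)) h3
    rw [map_add, interior_oneForm_mul, interior_eval_eq_zero θ h0, interior_eval_eq_zero θ h0,
      h n (by omega) n (by omega)] at h4
    simp at h4
    simpa [h4] using h3

theorem algebraMapInv_oneForm_mul (ζ : Module.Dual ℝ V) (ω : Forms V) :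
    ExteriorAlgebra.algebraMapInv (oneForm ζ * ω) = 0 := by
  simp [oneForm, ExteriorAlgebra.algebraMapInv]

theorem algebraMapInv_eval {n : ℕ} (a : Coeffs n) :
    ExteriorAlgebra.algebraMapInv (eval θ a) = const a := by
  induction a with
  | zero => simp [const, eval]
  | scalar s => simp [const, eval]
  | @node n c d h1 h2 => rw [eval, const, map_add, h1, algebraMapInv_oneForm_mul, add_zero]

theorem eval_covec {i n : ℕ} (h : i < n) : eval θ (covec i : Coeffs n) = oneForm (θ i) := by
  induction n with
  | zero => omega
  | succ n ih =>
    rw [covec]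
    split_ifs with hi
    · simp [eval, hi]
    · simp [eval_mk, ih (by omega), eval]

/-- The reversal in `contract` makes the outermost covector `θ n` act first, which matches the
recursion of `contrForm`. -/
theorem eval_contrForm [FiniteDimensional ℝ V] {g : InnerProductSpace.Core ℝ V} {n N : ℕ}
    (h : ∀ i < n, sharp g (θ i) = E i)
    (h' : ∀ i < n, ∀ j < N, θ j (E i) = if i = j then 1 else 0) (a : Coeffs n) (b : Coeffs N) :
    eval θ (contrForm a b) = contract g (eval θ a) (eval θ b) := by
  unfold contract
  induction a generalizing b with
  | zero => simp [contrForm, eval]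
  | scalar s => simp [contrForm, eval, eval_scale]
  | @node n c d h1 h2 =>
    rw [contrForm, eval_plus, h1 (fun i hi => h i (by omega)) (fun i hi => h' i (by omega)),
      h2 (fun i hi => h i (by omega)) (fun i hi => h' i (by omega)), eval_contr (h' n (by omega)),
      eval, map_add, CliffordAlgebra.reverse.map_mul, map_add, map_mul]
    have : contractAux g (CliffordAlgebra.reverse (oneForm (θ n))) = interior (E n) := by
      rw [oneForm, ExteriorAlgebra.ι, CliffordAlgebra.reverse_ι, contractAux]
      erw [ExteriorAlgebra.lift_ι_apply]
      simp [h n (by omega)]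
    rw [this]
    rfl

/-! ### The coefficients of a form -/

/-- The coefficients of a form in the coframe dual to `E`. -/
def coeff (E : ℕ → V) (β : Forms V) (l : List ℕ) : ℝ :=
  ExteriorAlgebra.algebraMapInv (l.foldl (fun ω i => interior (E i) ω) β)

/-- At level `n` the recursion only queries lists with entries below `n`. Hence one coefficient
function can be prescribed separately on lists containing `n` and on the others. -/
theorem gen_congr {n k : ℕ} {c c' : List ℕ → ℝ} (h : ∀ l, (∀ i ∈ l, i < n) → c l = c' l) :
    gen n k c = gen n k c' := by
  induction n generalizing k c c' with
  | zero => cases k <;> simp [gen, h]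
  | succ n ih =>
    cases k with
    | zero => simp [gen, h]
    | succ k =>
      rw [gen, gen, ih fun l hl => h l fun i hi => (hl i hi).trans (by omega),
        ih (c := fun l => c (n :: l)) fun l hl => h _ ?_]
      simp only [List.mem_cons, forall_eq_or_imp]
      exact ⟨by omega, fun i hi => (hl i hi).trans (by omega)⟩

theorem eval_gen_add (n k : ℕ) (c c' : List ℕ → ℝ) :
    eval θ (gen n k fun l => c l + c' l) = eval θ (gen n k c) + eval θ (gen n k c') := by
  induction n generalizing k c c' with
  | zero => cases k <;> simp [gen, eval]
  | succ n ih =>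
    cases k with
    | zero => simp [gen, eval]
    | succ k => simp only [gen, eval_mk, ih, mul_add]; abel

theorem eval_gen_smul (n k : ℕ) (r : ℝ) (c : List ℕ → ℝ) :
    eval θ (gen n k fun l => r * c l) = r • eval θ (gen n k c) := by
  induction n generalizing k c with
  | zero => cases k <;> simp [gen, eval, Algebra.smul_def]
  | succ n ih =>
    cases k with
    | zero => simp [gen, eval, Algebra.smul_def]
    | succ k => simp only [gen, eval_mk, ih, smul_add, mul_smul_comm]

theorem eval_gen_zero (n k : ℕ) : eval θ (gen n k fun _ => 0) = 0 := by
  simpa using eval_gen_smul (θ := θ) n k 0 fun _ => 0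

theorem exists_gen_oneForm_mul {i n : ℕ} (hi : i < n) (k : ℕ) (c : List ℕ → ℝ) :
    ∃ c', oneForm (θ i) * eval θ (gen n k c) = eval θ (gen n (k + 1) c') := by
  induction n generalizing k c with
  | zero => omega
  | succ n ih =>
    rcases Nat.lt_succ_iff_lt_or_eq.1 hi with h | rfl
    · cases k with
      | zero =>
        obtain ⟨c', h'⟩ := ih h 0 c
        refine ⟨fun l => if n ∈ l then 0 else c' l, ?_⟩
        have e1 : gen n 1 (fun l => if n ∈ l then 0 else c' l) = gen n 1 c' :=
          gen_congr fun l hl => if_neg fun hn => (hl n hn).false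
        rw [gen, gen, eval_mk, e1, ← h']
        simp [eval_gen_zero, gen, eval]
      | succ k =>
        obtain ⟨c1, h1⟩ := ih h (k + 1) c
        obtain ⟨c2, h2⟩ := ih h k fun l => c (n :: l)
        -- The test `n ∈ l` distinguishes the right branch from the left one; the sign comes from
        -- moving `θ i` past `θ n`.
        refine ⟨fun l => if n ∈ l then -c2 l.tail else c1 l, ?_⟩
        have e1 : gen n (k + 2) (fun l => if n ∈ l then -c2 l.tail else c1 l) = gen n (k + 2) c1 :=
          gen_congr fun l hl => if_neg fun hn => (hl n hn).false
        have e2 := eval_gen_smul (θ := θ) n (k + 1) (-1) c2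
        simp only [neg_mul, one_mul, neg_smul, one_smul] at e2
        rw [gen, gen, eval_mk, eval_mk, e1, ← h1]
        simp only [List.mem_cons, true_or, if_true, List.tail_cons, e2, ← h2, mul_add, ← mul_assoc,
          oneForm_mul_comm (θ i) (θ n), mul_neg, neg_mul]
    · cases k with
      | zero =>
        refine ⟨fun l => if i ∈ l then c [] else 0, ?_⟩
        have e1 : gen i 1 (fun l => if i ∈ l then c [] else 0) = gen i 1 fun _ => 0 :=
          gen_congr fun l hl => if_neg fun hn => (hl i hn).false
        rw [gen, gen, eval_mk, e1, eval_gen_zero]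
        simp [gen, eval]
      | succ k =>
        refine ⟨fun l => if i ∈ l then c l.tail else 0, ?_⟩
        have e1 : gen i (k + 2) (fun l => if i ∈ l then c l.tail else 0) =
            gen i (k + 2) fun _ => 0 :=
          gen_congr fun l hl => if_neg fun hn => (hl i hn).false
        rw [gen, gen, eval_mk, eval_mk, e1, eval_gen_zero, mul_add, ← mul_assoc, oneForm_mul_self]
        simp

theorem exists_eval_gen {n k : ℕ} (hspan : ∀ ζ : Module.Dual ℝ V, ∃ a : ℕ → ℝ,
    ζ = ∑ i ∈ Finset.range n, a i • θ i) {β : Forms V} (hβ : β ∈ ⋀[ℝ]^k (Module.Dual ℝ V)) :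
    ∃ c, β = eval θ (gen n k c) := by
  refine Submodule.pow_induction_on_left' (M := LinearMap.range (ExteriorAlgebra.ι ℝ))
    (C := fun k β _ => ∃ c, β = eval θ (gen n k c)) ?_ ?_ ?_ hβ
  · exact fun r => ⟨fun _ => r, by cases n <;> simp [gen, eval]⟩
  · rintro x y i hx hy ⟨c, rfl⟩ ⟨c', rfl⟩
    exact ⟨_, (eval_gen_add n i c c').symm⟩
  · rintro m ⟨ζ, rfl⟩ i x hx ⟨c, rfl⟩
    obtain ⟨a, rfl⟩ := hspan ζ
    choose! f hf using fun j (hj : j < n) => exists_gen_oneForm_mul (θ := θ) hj i c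
    rw [map_sum, Finset.sum_mul]
    have key : ∀ s ⊆ Finset.range n, ∃ c', ∑ j ∈ s, ExteriorAlgebra.ι ℝ (a j • θ j) *
        eval θ (gen n i c) = eval θ (gen n (i + 1) c') := by
      intro s
      induction s using Finset.induction_on with
      | empty => exact fun _ => ⟨fun _ => 0, by simp [eval_gen_zero]⟩
      | insert j s hj ih =>
        intro hs
        obtain ⟨c', h'⟩ := ih ((Finset.subset_insert _ _).trans hs)
        have hj' : j < n := Finset.mem_range.1 (hs (Finset.mem_insert_self _ _))
        refine ⟨fun l => a j * f j l + c' l, ?_⟩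
        rw [Finset.sum_insert hj, h', eval_gen_add, eval_gen_smul, ← hf j hj', map_smul,
          smul_mul_assoc, oneForm]
    exact key _ subset_rfl

theorem coeff_add (β γ : Forms V) (l : List ℕ) :
    coeff E (β + γ) l = coeff E β l + coeff E γ l := by
  induction l generalizing β γ with
  | nil => simp [coeff]
  | cons i l ih => simpa [coeff] using ih (interior (E i) β) (interior (E i) γ)

theorem coeff_oneForm_mul {ζ : Module.Dual ℝ V} {l : List ℕ} (h : ∀ i ∈ l, ζ (E i) = 0)
    (β : Forms V) : coeff E (oneForm ζ * β) l = 0 := by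
  induction l generalizing β with
  | nil => simp [coeff, algebraMapInv_oneForm_mul]
  | cons i l ih =>
    have := ih (fun j hj => h j (List.mem_cons_of_mem _ hj)) (-interior (E i) β)
    simpa [coeff, interior_oneForm_mul, h i List.mem_cons_self] using this

/-- For lists with entries below `n`, the contractions do not see `θ n`, so the right subtree
contributes nothing; for lists starting with `n`, the first contraction strips `θ n` and leaves the
right subtree. -/
theorem eval_gen_coeff {n k : ℕ} (h : ∀ i < n, ∀ j < n, θ j (E i) = if i = j then 1 else 0)
    (c : List ℕ → ℝ) :
    eval θ (gen n k (coeff E (eval θ (gen n k c)))) = eval θ (gen n k c) := by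
  induction n generalizing k c with
  | zero => cases k <;> simp [gen, eval, coeff]
  | succ n ih =>
    have h' : ∀ i < n, ∀ j < n, θ j (E i) = if i = j then 1 else 0 :=
      fun i hi j hj => h i (by omega) j (by omega)
    have h0 : ∀ j < n, θ j (E n) = 0 := fun j hj => by
      rw [h n (by omega) j (by omega), if_neg (by omega)]
    cases k with
    | zero => simp [gen, eval, coeff]
    | succ k =>
      rw [gen, gen, eval_mk, eval_mk]
      congr 1
      · rw [← ih h' c]
        refine congrArg _ (gen_congr fun l hl => ?_)
        rw [coeff_add, coeff_oneForm_mul, add_zero, ih h' c]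
        intro i hi
        rw [h i (by have := hl i hi; omega) n (by omega), if_neg (hl i hi).ne]
      · rw [← ih h' fun l => c (n :: l)]
        refine congrArg _ (congrArg _ (gen_congr fun l hl => ?_))
        rw [ih h' fun l => c (n :: l)]
        simp only [coeff, List.foldl_cons]
        rw [map_add, interior_oneForm_mul, interior_eval_eq_zero θ h0, interior_eval_eq_zero θ h0,
          h n (by omega) n (by omega)]
        simp

/-- A `k`-form is determined by its coefficients. -/
theorem eq_eval_gen {n k : ℕ} (h : ∀ i < n, ∀ j < n, θ j (E i) = if i = j then 1 else 0)
    (hspan : ∀ ζ : Module.Dual ℝ V, ∃ a : ℕ → ℝ, ζ = ∑ i ∈ Finset.range n, a i • θ i)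
    {β : Forms V} (hβ : β ∈ ⋀[ℝ]^k (Module.Dual ℝ V)) :
    β = eval θ (gen n k (coeff E β)) := by
  obtain ⟨c, rfl⟩ := exists_eval_gen hspan hβ
  exact (eval_gen_coeff h c).symm

end Coeffs

/-- A skew-symmetric form has an invariant plane. -/
theorem exists_skew_plane_of_inner {E : Type*} [NormedAddCommGroup E] [InnerProductSpace ℝ E]
    [FiniteDimensional ℝ E] (ω : E →ₗ[ℝ] E →ₗ[ℝ] ℝ) (hω : ∀ x, ω x x = 0)
    (hE : 2 ≤ Module.finrank ℝ E) :
    ∃ (u v : E) (a : ℝ), inner ℝ u u = (1 : ℝ) ∧ inner ℝ v v = (1 : ℝ) ∧ inner ℝ u v = (0 : ℝ) ∧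
      ∀ x, ω u x = a * inner ℝ v x ∧ ω v x = -(a * inner ℝ u x) := by
  have skew : ∀ x y, ω x y = -ω y x := fun x y => by
    have := hω (x + y)
    simp only [map_add, LinearMap.add_apply, hω] at this
    linarith
  let A : E →ₗ[ℝ] E := ((InnerProductSpace.toDual ℝ E).symm.toLinearEquiv.toLinearMap ∘ₗ
    (LinearMap.toContinuousLinearMap.toLinearMap)) ∘ₗ ω
  have hA : ∀ x y : E, inner ℝ (A x) y = ω x y := fun x y => by
    simp [A]
  have : Nontrivial E := Module.nontrivial_of_finrank_pos (R := ℝ) (by omega)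
  have hne : (Metric.sphere (0 : E) 1).Nonempty := NormedSpace.sphere_nonempty.2 zero_le_one
  -- A unit vector `u` maximizing `‖A x‖` spans an invariant plane together with `A u`.
  obtain ⟨u, hu, hmax⟩ := (isCompact_sphere (0 : E) 1).exists_isMaxOn hne
    (f := fun x => ‖A x‖) (LinearMap.continuous_of_finiteDimensional A).norm.continuousOn
  have hu1 : ‖u‖ = 1 := by simpa using hu
  have hle : ∀ x, ‖A x‖ ≤ ‖A u‖ * ‖x‖ := fun x => by
    by_cases hx : x = 0
    · simp [hx]
    · have h1 : (‖x‖⁻¹ • x) ∈ Metric.sphere (0 : E) 1 := by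
        simp [norm_smul, hx]
      have h2 : ‖A (‖x‖⁻¹ • x)‖ ≤ ‖A u‖ := hmax h1
      simp only [map_smul, norm_smul, norm_inv, norm_norm] at h2
      have h3 : 0 < ‖x‖ := norm_pos_iff.2 hx
      rwa [inv_mul_le_iff₀ h3, mul_comm] at h2
  by_cases hm : ‖A u‖ = 0
  · have h0 : ∀ x : E, ∀ y, ω x y = 0 := fun x y => by
      have h : A x = 0 :=
        norm_eq_zero.1 (le_antisymm (by simpa [hm] using hle x) (norm_nonneg _))
      rw [← hA, h, inner_zero_left]
    let b := stdOrthonormalBasis ℝ E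
    have hb := orthonormal_iff_ite.1 b.orthonormal
    exact ⟨b ⟨0, by omega⟩, b ⟨1, by omega⟩, 0, by simp [hb], by simp [hb], by simp [hb],
      fun x => by simp [h0]⟩
  · obtain ⟨m, hmdef⟩ : ∃ m, m = ‖A u‖ := ⟨_, rfl⟩
    rw [← hmdef] at hm hle
    have hmpos : 0 < m := hmdef ▸ (norm_nonneg _).lt_of_ne' (hmdef ▸ hm)
    have huA : inner ℝ (A u) u = 0 := by rw [hA, hω]
    obtain ⟨w, hw⟩ : ∃ w, w = m⁻¹ • A u := ⟨_, rfl⟩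
    have hAu : A u = m • w := by rw [hw, smul_smul, mul_inv_cancel₀ hm, one_smul]
    have hw1 : ‖w‖ = 1 := by
      rw [hw, norm_smul, norm_inv, Real.norm_of_nonneg hmpos.le, ← hmdef, inv_mul_cancel₀ hm]
    -- Equality case of Cauchy–Schwarz: `⟨A w, u⟩ = -m` and `‖A w‖ ≤ m` give `‖A w + m u‖² ≤ m² - 2
    -- m² + m² = 0`.
    have hAw : A w = -(m • u) := by
      rw [← add_eq_zero_iff_eq_neg, ← norm_eq_zero, ← sq_eq_zero_iff]
      have h1 : inner ℝ (A w) u = -m := by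
        rw [hA, skew, ← hA, hAu, real_inner_smul_left, real_inner_self_eq_norm_sq, hw1]; simp
      have h2 := hle w
      rw [hw1, mul_one] at h2
      have h3 : ‖A w‖ ^ 2 ≤ m ^ 2 := pow_le_pow_left₀ (norm_nonneg _) h2 2
      have h4 : ‖m • u‖ = m := by rw [norm_smul, hu1, mul_one, Real.norm_of_nonneg hmpos.le]
      have h5 := norm_add_sq_real (A w) (m • u)
      rw [real_inner_smul_right, h1, h4] at h5
      nlinarith [sq_nonneg ‖A w + m • u‖]
    refine ⟨u, w, m, ?_, ?_, ?_, fun x => ⟨?_, ?_⟩⟩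
    · rw [real_inner_self_eq_norm_sq, hu1, one_pow]
    · rw [real_inner_self_eq_norm_sq, hw1, one_pow]
    · rw [hw, real_inner_smul_right, real_inner_comm, huA, mul_zero]
    · rw [← hA, hAu, real_inner_smul_left]
    · rw [← hA, hAw, inner_neg_left, real_inner_smul_left]

/-! ### Orthonormal families -/

section Orthonormal

variable {V : Type*} [AddCommGroup V] [Module ℝ V] (g : InnerProductSpace.Core ℝ V)

/-- `e` is a `g`-orthonormal family. -/
def IsON {ι : Type*} [DecidableEq ι] (e : ι → V) : Prop :=
  ∀ i j, bilin g (e i) (e j) = if i = j then 1 else 0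

variable {g}

theorem bilin_self_nonneg (x : V) : 0 ≤ bilin g x x := g.re_inner_nonneg x

theorem bilin_self_pos {x : V} (h : x ≠ 0) : 0 < bilin g x x :=
  (bilin_self_nonneg x).lt_of_ne fun h' => h (bilin_self_eq_zero g h'.symm)

theorem IsON.linearIndependent {ι : Type*} [DecidableEq ι] [Fintype ι] {e : ι → V}
    (h : IsON g e) : LinearIndependent ℝ e := by
  rw [Fintype.linearIndependent_iff]
  intro c hc i
  have := congrArg (bilin g (e i)) hc
  simpa [map_sum, h i] using this

theorem IsON.finrank_span {k : ℕ} {e : Fin k → V} (h : IsON g e) :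
    Module.finrank ℝ (Submodule.span ℝ (Set.range e)) = k := by
  simpa using finrank_span_eq_card h.linearIndependent

theorem IsOrthonormalBasisOf.isON {W : Submodule ℝ V} {k : ℕ} {e : Fin k → V}
    (h : IsOrthonormalBasisOf g W e) : IsON g e := h.1

theorem IsOrthonormalBasisOf.mem {W : Submodule ℝ V} {k : ℕ} {e : Fin k → V}
    (h : IsOrthonormalBasisOf g W e) (i : Fin k) : e i ∈ W :=
  h.2 ▸ Submodule.subset_span ⟨i, rfl⟩

theorem IsOrthonormalBasisOf.finrank_eq {W : Submodule ℝ V} {k : ℕ} {e : Fin k → V}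
    (h : IsOrthonormalBasisOf g W e) : Module.finrank ℝ W = k := by
  rw [← h.2, h.isON.finrank_span]

theorem IsON.sum_eq {ι : Type*} [DecidableEq ι] [Fintype ι] {e : ι → V} (h : IsON g e) {x : V}
    (hx : x ∈ Submodule.span ℝ (Set.range e)) : ∑ i, bilin g (e i) x • e i = x := by
  obtain ⟨c, rfl⟩ := (Submodule.mem_span_range_iff_exists_fun ℝ).1 hx
  refine Finset.sum_congr rfl fun i _ => ?_
  simp [map_sum, h i]

theorem IsOrthonormalBasisOf.sum_eq {W : Submodule ℝ V} {k : ℕ} {e : Fin k → V}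
    (h : IsOrthonormalBasisOf g W e) {x : V} (hx : x ∈ W) : ∑ i, bilin g (e i) x • e i = x :=
  h.isON.sum_eq (h.2 ▸ hx)

theorem IsON.append {k l : ℕ} {e : Fin k → V} {f : Fin l → V} (he : IsON g e) (hf : IsON g f)
    (h : ∀ i j, bilin g (e i) (f j) = 0) : IsON g (Fin.append e f) := by
  intro i j
  induction i using Fin.addCases with
  | left i =>
    induction j using Fin.addCases with
    | left j => simp [he i j]
    | right j =>
      have : Fin.castAdd l i ≠ Fin.natAdd k j := fun h' => by
        have := congrArg Fin.val h'; simp at this; omega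
      simp [h, this]
  | right i =>
    induction j using Fin.addCases with
    | left j =>
      have : Fin.natAdd k i ≠ Fin.castAdd l j := fun h' => by
        have := congrArg Fin.val h'; simp at this; omega
      rw [bilin_comm]
      simp [h, this]
    | right j => simp [hf i j]

variable [FiniteDimensional ℝ V]

theorem IsON.isOrthonormalBasisOf {W : Submodule ℝ V} {k : ℕ} {e : Fin k → V} (h : IsON g e)
    (hW : ∀ i, e i ∈ W) (hk : Module.finrank ℝ W = k) : IsOrthonormalBasisOf g W e := by
  refine ⟨h, Submodule.eq_of_le_of_finrank_eq ?_ ?_⟩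
  · rw [Submodule.span_le]
    rintro _ ⟨i, rfl⟩
    exact hW i
  · rw [h.finrank_span, hk]

theorem IsON.isOrthonormalBasisOf_top {k : ℕ} {e : Fin k → V} (h : IsON g e)
    (hk : Module.finrank ℝ V = k) : IsOrthonormalBasisOf g ⊤ e :=
  h.isOrthonormalBasisOf (fun _ => trivial) (by rw [finrank_top, hk])

theorem exists_isOrthonormalBasisOf (g : InnerProductSpace.Core ℝ V) {W : Submodule ℝ V} {k : ℕ}
    (hk : Module.finrank ℝ W = k) : ∃ e : Fin k → V, IsOrthonormalBasisOf g W e := by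
  let _ := @InnerProductSpace.Core.toNormedAddCommGroup ℝ V _ _ _ g
  let _ := InnerProductSpace.ofCore g.toCore
  let b := (stdOrthonormalBasis ℝ W).reindex (finCongr hk)
  refine ⟨fun i => (b i : V), IsON.isOrthonormalBasisOf (fun i j => ?_) (fun i => (b i).2) hk⟩
  exact orthonormal_iff_ite.1 b.orthonormal i j

theorem finrank_orthogonal_add (g : InnerProductSpace.Core ℝ V) (W : Submodule ℝ V) :
    Module.finrank ℝ W + Module.finrank ℝ ((bilin g).orthogonal W) = Module.finrank ℝ V := by
  let _ := @InnerProductSpace.Core.toNormedAddCommGroup ℝ V _ _ _ g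
  let _ := InnerProductSpace.ofCore g.toCore
  exact W.finrank_add_finrank_orthogonal

theorem mem_orthogonal_span_range_iff {ι : Type*} {e : ι → V} {x : V} :
    x ∈ (bilin g).orthogonal (Submodule.span ℝ (Set.range e)) ↔ ∀ i, bilin g (e i) x = 0 := by
  rw [LinearMap.BilinForm.mem_orthogonal_iff]
  refine ⟨fun h i => h _ (Submodule.subset_span ⟨i, rfl⟩), fun h y hy => ?_⟩
  induction hy using Submodule.span_induction with
  | mem y hy => obtain ⟨i, rfl⟩ := hy; exact h i
  | zero => simp
  | add y z _ _ hy hz => simp_all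
  | smul c y _ hy => simp_all

/-- An orthonormal family which is too short to span can be extended. -/
theorem IsON.exists_unit {k : ℕ} {e : Fin k → V} (h : IsON g e) {W : Submodule ℝ V}
    (hW : ∀ i, e i ∈ W) (hk : k < Module.finrank ℝ W) :
    ∃ x ∈ W, bilin g x x = 1 ∧ ∀ i, bilin g (e i) x = 0 := by
  have h1 := finrank_orthogonal_add g (Submodule.span ℝ (Set.range e))
  rw [h.finrank_span] at h1
  have h2 := Submodule.finrank_sup_add_finrank_inf_eq W
    ((bilin g).orthogonal (Submodule.span ℝ (Set.range e)))
  have h3 := (W ⊔ (bilin g).orthogonal (Submodule.span ℝ (Set.range e))).finrank_le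
  have h4 : 0 < Module.finrank ℝ
      (W ⊓ (bilin g).orthogonal (Submodule.span ℝ (Set.range e)) : Submodule ℝ V) := by omega
  obtain ⟨f, hf⟩ := exists_isOrthonormalBasisOf g rfl
    (W := W ⊓ (bilin g).orthogonal (Submodule.span ℝ (Set.range e)))
  have h5 := hf.mem ⟨0, h4⟩
  exact ⟨f ⟨0, h4⟩, h5.1, by simp [hf.1], mem_orthogonal_span_range_iff.1 h5.2⟩

/-! ### The normal form of a skew-symmetric form -/

/-- A skew-symmetric form has an invariant plane. -/
theorem exists_skew_plane (ω : LinearMap.BilinForm ℝ V) (hω : ∀ x, ω x x = 0)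
    {W : Submodule ℝ V} (hW : 2 ≤ Module.finrank ℝ W) :
    ∃ u ∈ W, ∃ v ∈ W, ∃ a : ℝ, bilin g u u = 1 ∧ bilin g v v = 1 ∧ bilin g u v = 0 ∧
      ∀ x ∈ W, ω u x = a * bilin g v x ∧ ω v x = -(a * bilin g u x) := by
  let _ := @InnerProductSpace.Core.toNormedAddCommGroup ℝ V _ _ _ g
  let _ := InnerProductSpace.ofCore g.toCore
  obtain ⟨u, v, a, h1, h2, h3, h4⟩ := exists_skew_plane_of_inner (E := W) (ω.restrict W)
    (fun x => hω x) hW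
  exact ⟨u, u.2, v, v.2, a, h1, h2, h3, fun x hx => h4 ⟨x, hx⟩⟩

/-- The normal form of a skew-symmetric form on an even-dimensional Euclidean space. -/
theorem exists_skew_normal_form (g : InnerProductSpace.Core ℝ V) (ω : LinearMap.BilinForm ℝ V)
    (hω : ∀ x, ω x x = 0) (m : ℕ) {W : Submodule ℝ V} (hW : Module.finrank ℝ W = 2 * m) :
    ∃ (u v : Fin m → V) (a : Fin m → ℝ), (∀ i, u i ∈ W) ∧ (∀ i, v i ∈ W) ∧ IsON g u ∧ IsON g v ∧
      (∀ i k, bilin g (u i) (v k) = 0) ∧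
      ∀ i, ∀ x ∈ W, ω (u i) x = a i * bilin g (v i) x ∧ ω (v i) x = -(a i * bilin g (u i) x) := by
  have skew : ∀ x y, ω x y = -ω y x := fun x y => by
    have := hω (x + y)
    simp only [map_add, LinearMap.add_apply, hω] at this
    linarith
  induction m generalizing W with
  | zero =>
    exact ⟨Fin.elim0, Fin.elim0, Fin.elim0, fun i => i.elim0, fun i => i.elim0, fun i => i.elim0,
      fun i => i.elim0, fun i => i.elim0, fun i => i.elim0⟩
  | succ m ih =>
    obtain ⟨u, hu, v, hv, a, huu, hvv, huv, h⟩ := exists_skew_plane (g := g) ω hω (W := W)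
      (by omega)
    have hvu : bilin g v u = 0 := by rw [bilin_comm, huv]
    have hON : IsON g ![u, v] := by
      intro i j; fin_cases i <;> fin_cases j <;> simp [huu, hvv, huv, hvu]
    set P := (bilin g).orthogonal (Submodule.span ℝ (Set.range ![u, v])) with hP
    have memP : ∀ x, x ∈ P ↔ bilin g u x = 0 ∧ bilin g v x = 0 := fun x => by
      rw [hP, mem_orthogonal_span_range_iff, Fin.forall_fin_two]; rfl
    have hdec : ∀ x, x - bilin g u x • u - bilin g v x • v ∈ P := fun x => by
      rw [memP]
      simp [huu, hvv, huv, hvu]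
    have hdim : Module.finrank ℝ (W ⊓ P : Submodule ℝ V) = 2 * m := by
      have h1 := finrank_orthogonal_add g (Submodule.span ℝ (Set.range ![u, v]))
      rw [hON.finrank_span, ← hP] at h1
      have h2 := Submodule.finrank_sup_add_finrank_inf_eq W P
      have h3 : W ⊔ P = ⊤ := by
        rw [eq_top_iff]
        intro x _
        rw [Submodule.mem_sup]
        refine ⟨bilin g u x • u + bilin g v x • v, W.add_mem (W.smul_mem _ hu) (W.smul_mem _ hv),
          _, hdec x, by abel⟩
      rw [h3, finrank_top] at h2
      omega
    obtain ⟨u', v', a', hu', hv', hON1, hON2, hort, h'⟩ := ih hdim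
    have hu'P := fun i => (memP _).1 (hu' i).2
    have hv'P := fun i => (memP _).1 (hv' i).2
    -- The induction hypothesis covers only `x` in `W ⊓ P`. It extends to `W` because `ω u` and `ω
    -- v` are multiples of `g(v, ·)` and `g(u, ·)`, which vanish on `u' i` and `v' i`.
    have key : ∀ i, ∀ x ∈ W, ω (u' i) x = a' i * bilin g (v' i) x ∧
        ω (v' i) x = -(a' i * bilin g (u' i) x) := by
      intro i x hx
      have hx' : x - bilin g u x • u - bilin g v x • v ∈ W ⊓ P :=
        ⟨W.sub_mem (W.sub_mem hx (W.smul_mem _ hu)) (W.smul_mem _ hv), hdec x⟩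
      have h1 := h' i _ hx'
      have e1 := skew (u' i) u
      have e2 := skew (u' i) v
      have e3 := skew (v' i) u
      have e4 := skew (v' i) v
      rw [(h _ (hu' i).1).1, (hu'P i).2] at e1
      rw [(h _ (hu' i).1).2, (hu'P i).1] at e2
      rw [(h _ (hv' i).1).1, (hv'P i).2] at e3
      rw [(h _ (hv' i).1).2, (hv'P i).1] at e4
      have f1 : bilin g (u' i) u = 0 := by rw [bilin_comm]; exact (hu'P i).1
      have f2 : bilin g (u' i) v = 0 := by rw [bilin_comm]; exact (hu'P i).2
      have f3 : bilin g (v' i) u = 0 := by rw [bilin_comm]; exact (hv'P i).1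
      have f4 : bilin g (v' i) v = 0 := by rw [bilin_comm]; exact (hv'P i).2
      simpa [e1, e2, e3, e4, f1, f2, f3, f4] using h1
    refine ⟨Fin.cons u u', Fin.cons v v', Fin.cons a a', ?_, ?_, ?_, ?_, ?_, ?_⟩
    · exact Fin.cases hu fun i => (hu' i).1
    · exact Fin.cases hv fun i => (hv' i).1
    · refine Fin.cases (Fin.cases (by simpa using huu) fun i => ?_)
        fun i => Fin.cases ?_ fun k => ?_
      · simpa [(Fin.succ_ne_zero i).symm] using (hu'P i).1
      · rw [bilin_comm]; simpa using (hu'P i).1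
      · simpa using hON1 i k
    · refine Fin.cases (Fin.cases (by simpa using hvv) fun i => ?_)
        fun i => Fin.cases ?_ fun k => ?_
      · simpa [(Fin.succ_ne_zero i).symm] using (hv'P i).2
      · rw [bilin_comm]; simpa using (hv'P i).2
      · simpa using hON2 i k
    · refine Fin.cases (Fin.cases (by simpa using huv) fun i => ?_)
        fun i => Fin.cases ?_ fun k => ?_
      · simpa using (hv'P i).1
      · rw [bilin_comm]; simpa using (hu'P i).2
      · simpa using hort i k
    · refine Fin.cases ?_ fun i => ?_
      · simpa using h
      · simpa using key i

end Orthonormal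

open Coeffs

set_option linter.constructorNameAsVariable false
set_option linter.unusedSimpArgs false

/-! ### Orthonormal coframes and volume forms. -/

section Frames

variable {V : Type*} [AddCommGroup V] [Module ℝ V] {g : InnerProductSpace.Core ℝ V}

/-- A finite family as a sequence, extended by zero. -/
def frame {k : ℕ} (e : Fin k → V) (i : ℕ) : V := if h : i < k then e ⟨i, h⟩ else 0

/-- The metric duals of a finite family. -/
def coframe (g : InnerProductSpace.Core ℝ V) {k : ℕ} (e : Fin k → V) (i : ℕ) : Module.Dual ℝ V :=
  bilin g (frame e i)

theorem frame_of_lt {k : ℕ} (e : Fin k → V) {i : ℕ} (h : i < k) : frame e i = e ⟨i, h⟩ :=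
  dif_pos h

theorem IsON.coframe_frame {k : ℕ} {e : Fin k → V} (h : IsON g e) :
    ∀ i < k, ∀ j < k, coframe g e j (frame e i) = if i = j then 1 else 0 := by
  intro i hi j hj
  rw [coframe, frame_of_lt e hi, frame_of_lt e hj, h]
  simp [eq_comm]

theorem oneForm_bilin_eq_eval {k : ℕ} (e : Fin k → V) (i : Fin k) :
    oneForm (bilin g (e i)) = eval (coframe g e) (covec i : Coeffs k) := by
  rw [eval_covec i.2, coframe, frame_of_lt e i.2]

/-- Trees list covectors in decreasing order, and reversing seven covectors is an odd permutation
(`21` transpositions), whence the coefficient `-1`. -/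
theorem ιMulti_seven (e : Fin 7 → V) : ExteriorAlgebra.ιMulti ℝ 7 (fun i => bilin g (e i)) =
    eval (coframe g e) (gen 7 7 fun _ => -1) := by
  have h := fun i => oneForm_bilin_eq_eval (g := g) e i
  simp only [oneForm] at h
  rw [ExteriorAlgebra.ιMulti_apply]
  simp only [List.ofFn_succ, List.ofFn_zero, List.prod_cons, List.prod_nil, h, mul_one,
    ← eval_times]
  congr 1
  simp [covec, gen, mk, times, plus, plusScalar, scale, opp, invol]

theorem IsOrthonormalBasisOf.exists_eq_sum {k : ℕ} {e : Fin k → V}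
    (h : IsOrthonormalBasisOf g ⊤ e) (ζ : Module.Dual ℝ V) :
    ∃ a : ℕ → ℝ, ζ = ∑ i ∈ Finset.range k, a i • coframe g e i := by
  refine ⟨fun i => ζ (frame e i), LinearMap.ext fun x => ?_⟩
  conv_lhs => rw [← h.sum_eq (x := x) trivial]
  rw [Finset.sum_range]
  simp [coframe, frame_of_lt, mul_comm]

/-- The coordinates of a form in an orthonormal basis. -/
theorem IsOrthonormalBasisOf.eq_eval {n k : ℕ} {e : Fin n → V}
    (h : IsOrthonormalBasisOf g ⊤ e) {β : Forms V} (hβ : β ∈ ⋀[ℝ]^k (Module.Dual ℝ V)) :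
    β = eval (coframe g e) (gen n k (coeff (frame e) β)) :=
  eq_eval_gen h.isON.coframe_frame h.exists_eq_sum hβ

variable [FiniteDimensional ℝ V]

theorem sharp_bilin (v : V) : sharp g (bilin g v) = v := by
  have h : ∀ y, bilin g (sharp g (bilin g v) - v) y = 0 := fun y => by
    rw [map_sub, LinearMap.sub_apply, bilin_sharp, sub_self]
  exact sub_eq_zero.1 (bilin_self_eq_zero g (h _))

theorem eval_contrForm_coframe {k : ℕ} {e : Fin k → V} (h : IsON g e) (a b : Coeffs k) :
    eval (coframe g e) (contrForm a b) =
      contract g (eval (coframe g e) a) (eval (coframe g e) b) :=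
  eval_contrForm (E := frame e) (fun _ _ => sharp_bilin _) h.coframe_frame a b

/-- In an orthonormal basis, a volume form is the product of the covectors, up to sign. -/
theorem IsVolumeForm.eq_eval {vol : Forms V} (hvol : IsVolumeForm g ⊤ 7 vol) {e : Fin 7 → V}
    (he : IsOrthonormalBasisOf g ⊤ e) :
    ∃ κ : ℝ, κ ^ 2 = 1 ∧ vol = eval (coframe g e) (gen 7 7 fun _ => κ) := by
  obtain ⟨e', he', rfl⟩ := hvol
  set vol := ExteriorAlgebra.ιMulti ℝ 7 fun i => bilin g (e' i) with hv
  -- The squared norm of `vol` is the square of its coefficient in every orthonormal basis;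
  -- comparing with `e'`, where the coefficient is `-1`, gives `κ² = 1`.
  have key : ∀ {e : Fin 7 → V} (_ : IsOrthonormalBasisOf g ⊤ e) (κ : ℝ),
      vol = eval (coframe g e) (gen 7 7 fun _ => κ) → formInner g vol vol = κ ^ 2 := by
    intro e he κ h
    rw [formInner, h, ← eval_contrForm_coframe he.isON, algebraMapInv_eval]
    simp [gen, mk, contrForm, contr, const, plus, scale, opp, sq]
  have h1 := key he' (-1) (ιMulti_seven e')
  have h2 : vol ∈ ⋀[ℝ]^7 (Module.Dual ℝ V) := by
    rw [← ExteriorAlgebra.ιMulti_span_fixedDegree]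
    exact Submodule.subset_span ⟨_, rfl⟩
  have h3 := he.eq_eval h2
  have h4 : vol = eval (coframe g e) (gen 7 7 fun _ =>
      coeff (frame e) vol [6, 5, 4, 3, 2, 1, 0]) := by
    conv_lhs => rw [h3]
    simp only [gen, mk]
  exact ⟨_, by rw [← key he _ h4, h1]; norm_num, h4⟩

end Frames

/-! ### The polynomial system for a `3`-form that induces a given metric. -/

/-- The `3`-form `θ₀ ∧ ω + ρ`, where `ω` is in normal form and `ρ` does not involve `θ₀`. -/
def blockForm (a b c r321 r421 r521 r621 r431 r531 r631 r541 r641 r651 r432 r532 r632 r542 r642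
    r652 r543 r643 r653 r654 : ℝ) : Coeffs 7 :=
  (node (node (node (node (node zero (node zero (node zero (scalar a)))) (node zero (node zero
      (scalar r321)))) (node (node zero (node zero (scalar r421))) (node (node (node zero (scalar b))
      (scalar r431)) (scalar r432)))) (node (node (node zero (node zero (scalar r521))) (node (node
      zero (scalar r531)) (scalar r532))) (node (node (node zero (scalar r541)) (scalar r542))
      (scalar r543)))) (node (node (node (node zero (node zero (scalar r621))) (node (node zero
      (scalar r631)) (scalar r632))) (node (node (node zero (scalar r641)) (scalar r642)) (scalar
      r643))) (node (node (node (node (node zero (scalar c)) (scalar r651)) (scalar r652)) (scalar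
      r653)) (scalar r654))))

set_option maxHeartbeats 1000000 in
/-- If a `3`-form in block form induces the inner product for which the coframe is orthonormal,
then the coefficients of the skew form `ω` are `±1`. -/
theorem sq_eq_one_of_blockForm {a b c r321 r421 r521 r621 r431 r531 r631 r541 r641 r651 r432 r532
    r632 r542 r642 r652 r543 r643 r653 r654 κ : ℝ} {F : Coeffs 7}
    (hF : F = blockForm a b c r321 r421 r521 r621 r431 r531 r631 r541 r641 r651 r432 r532 r632
        r542 r642 r652 r543 r643 r653 r654) (hκ : κ ^ 2 = 1)
    (h : ∀ i < 7, ∀ j < 7, IsZero (plus (times (times (contr i F) (contr j F)) F)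
      (gen 7 7 fun _ => if i = j then -(6 * κ) else 0))) :
    a ^ 2 = 1 ∧ b ^ 2 = 1 ∧ c ^ 2 = 1 := by
  have h00 := h 0 (by norm_num) 0 (by norm_num)
  have h01 := h 0 (by norm_num) 1 (by norm_num)
  have h02 := h 0 (by norm_num) 2 (by norm_num)
  have h03 := h 0 (by norm_num) 3 (by norm_num)
  have h04 := h 0 (by norm_num) 4 (by norm_num)
  have h05 := h 0 (by norm_num) 5 (by norm_num)
  have h06 := h 0 (by norm_num) 6 (by norm_num)
  have h11 := h 1 (by norm_num) 1 (by norm_num)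
  have h12 := h 1 (by norm_num) 2 (by norm_num)
  have h13 := h 1 (by norm_num) 3 (by norm_num)
  have h14 := h 1 (by norm_num) 4 (by norm_num)
  have h15 := h 1 (by norm_num) 5 (by norm_num)
  have h16 := h 1 (by norm_num) 6 (by norm_num)
  have h22 := h 2 (by norm_num) 2 (by norm_num)
  have h23 := h 2 (by norm_num) 3 (by norm_num)
  have h24 := h 2 (by norm_num) 4 (by norm_num)
  have h25 := h 2 (by norm_num) 5 (by norm_num)
  have h26 := h 2 (by norm_num) 6 (by norm_num)
  have h33 := h 3 (by norm_num) 3 (by norm_num)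
  have h34 := h 3 (by norm_num) 4 (by norm_num)
  have h35 := h 3 (by norm_num) 5 (by norm_num)
  have h36 := h 3 (by norm_num) 6 (by norm_num)
  have h44 := h 4 (by norm_num) 4 (by norm_num)
  have h45 := h 4 (by norm_num) 5 (by norm_num)
  have h46 := h 4 (by norm_num) 6 (by norm_num)
  have h55 := h 5 (by norm_num) 5 (by norm_num)
  have h56 := h 5 (by norm_num) 6 (by norm_num)
  have h66 := h 6 (by norm_num) 6 (by norm_num)
  clear h
  simp only [hF, blockForm, gen, mk, contr, times, plus, scale, opp, invol, plusScalar, IsZero,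
    reduceIte, Nat.reduceEqDiff, Nat.zero_ne_one, OfNat.ofNat_ne_zero, OfNat.zero_ne_ofNat,
    OfNat.one_ne_ofNat, OfNat.ofNat_ne_one, true_and, and_true, neg_neg, zero_ne_one]
    at h00 h01 h02 h03 h04 h05 h06 h11 h12 h13 h14 h15 h16 h22 h23 h24 h25 h26 h33 h34 h35 h36
        h44 h45 h46 h55 h56 h66
  -- The equation `(0, 0)` gives `a b c = κ`, so none of `a`, `b`, `c` vanishes. The equations `(0,
  -- j)` amount to `ω ∧ ρ = 0`, and each of them eliminates one coefficient of `ρ`.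
  have habc : a * b * c = κ := by linear_combination h00 / 6
  have hne : a * b * c ≠ 0 := by
    rw [habc]
    rintro rfl
    norm_num at hκ
  have ha : a ≠ 0 := fun h => hne (by rw [h]; ring)
  have hb : b ≠ 0 := fun h => hne (by rw [h]; ring)
  have hc : c ≠ 0 := fun h => hne (by rw [h]; ring)
  obtain ⟨x1, rfl⟩ : ∃ x, r431 = b * x := ⟨r431 / b, by field_simp⟩
  obtain rfl : r651 = -(c * x1) := by
    refine mul_left_cancel₀ (mul_ne_zero ha hb) ?_
    linear_combination h01 / 3
  obtain ⟨x2, rfl⟩ : ∃ x, r432 = b * x := ⟨r432 / b, by field_simp⟩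
  obtain rfl : r652 = -(c * x2) := by
    refine mul_left_cancel₀ (mul_ne_zero ha hb) ?_
    linear_combination h02 / 3
  obtain ⟨x3, rfl⟩ : ∃ x, r321 = a * x := ⟨r321 / a, by field_simp⟩
  obtain rfl : r653 = -(c * x3) := by
    refine mul_left_cancel₀ (mul_ne_zero hb ha) ?_
    linear_combination h03 / 3
  obtain ⟨x4, rfl⟩ : ∃ x, r421 = a * x := ⟨r421 / a, by field_simp⟩
  obtain rfl : r654 = -(c * x4) := by
    refine mul_left_cancel₀ (mul_ne_zero hb ha) ?_
    linear_combination h04 / 3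
  obtain ⟨x5, rfl⟩ : ∃ x, r521 = a * x := ⟨r521 / a, by field_simp⟩
  obtain rfl : r543 = -(b * x5) := by
    refine mul_left_cancel₀ (mul_ne_zero hc ha) ?_
    linear_combination h05 / 3
  obtain ⟨x6, rfl⟩ : ∃ x, r621 = a * x := ⟨r621 / a, by field_simp⟩
  obtain rfl : r643 = -(b * x6) := by
    refine mul_left_cancel₀ (mul_ne_zero hc ha) ?_
    linear_combination h06 / 3
  have B11 : - a*b*c*x1*x1 - a*r531*r641 + a*r541*r631 = κ := by
    linear_combination h11 / 6
  have B12 : - 2*a*b*c*x1*x2 - a*r531*r642 - a*r532*r641 + a*r541*r632 + a*r542*r631 = 0 := by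
    linear_combination h12 / 3
  have B13 : - a*b*c*x1*x3 + a*b*r531*x6 - a*b*r631*x5 = 0 := by
    linear_combination h13 / 6
  have B14 : - a*b*c*x1*x4 + a*b*r541*x6 - a*b*r641*x5 = 0 := by
    linear_combination h14 / 6
  have B15 : a*b*c*x1*x5 - a*c*r531*x4 + a*c*r541*x3 = 0 := by
    linear_combination h15 / 6
  have B16 : a*b*c*x1*x6 - a*c*r631*x4 + a*c*r641*x3 = 0 := by
    linear_combination h16 / 6
  have B22 : - a*b*c*x2*x2 - a*r532*r642 + a*r542*r632 = κ := by
    linear_combination h22 / 6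
  have B23 : - a*b*c*x2*x3 + a*b*r532*x6 - a*b*r632*x5 = 0 := by
    linear_combination h23 / 6
  have B24 : - a*b*c*x2*x4 + a*b*r542*x6 - a*b*r642*x5 = 0 := by
    linear_combination h24 / 6
  have B25 : a*b*c*x2*x5 - a*c*r532*x4 + a*c*r542*x3 = 0 := by
    linear_combination h25 / 6
  have B26 : a*b*c*x2*x6 - a*c*r632*x4 + a*c*r642*x3 = 0 := by
    linear_combination h26 / 6
  have B33 : - a*b*c*x3*x3 - b*r531*r632 + b*r532*r631 = κ := by
    linear_combination h33 / 6
  have B34 : - 2*a*b*c*x3*x4 - b*r531*r642 + b*r532*r641 - b*r541*r632 + b*r542*r631 = 0 := by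
    linear_combination h34 / 3
  have B35 : - a*b*c*x3*x5 + b*c*r531*x2 - b*c*r532*x1 = 0 := by
    linear_combination h35 / 6
  have B36 : - a*b*c*x3*x6 + b*c*r631*x2 - b*c*r632*x1 = 0 := by
    linear_combination h36 / 6
  have B44 : - a*b*c*x4*x4 - b*r541*r642 + b*r542*r641 = κ := by
    linear_combination h44 / 6
  have B45 : - a*b*c*x4*x5 + b*c*r541*x2 - b*c*r542*x1 = 0 := by
    linear_combination h45 / 6
  have B46 : - a*b*c*x4*x6 + b*c*r641*x2 - b*c*r642*x1 = 0 := by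
    linear_combination h46 / 6
  have B55 : - a*b*c*x5*x5 - c*r531*r542 + c*r532*r541 = κ := by
    linear_combination h55 / 6
  have B56 : - 2*a*b*c*x5*x6 - c*r531*r642 + c*r532*r641 + c*r541*r632 - c*r542*r631 = 0 := by
    linear_combination h56 / 3
  have B66 : - a*b*c*x6*x6 - c*r631*r642 + c*r632*r641 = κ := by
    linear_combination h66 / 6
  clear h00 h01 h02 h03 h04 h05 h06 h11 h12 h13 h14 h15 h16 h22 h23 h24 h25 h26 h33 h34 h35 h36
      h44 h45 h46 h55 h56 h66
  -- The left-hand sides of the `B` equations form a symmetric matrix that has to equal `κ` times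
  -- the identity (the doubled entries `12`, `34`, `56` account for the halves). Its `2 × 2` minors
  -- on the index pairs `{1, 2}`, `{3, 4}`, `{5, 6}` satisfy a universal polynomial relation.
  -- Inserting the prescribed values leaves `c² (b² - a²) κ² = 0`; the companion `e2` leaves `b² (c²
  -- - a²) κ² = 0`.
  have e1 : b ^ 2 * c ^ 2 * ((- a*b*c*x1*x1 - a*r531*r641 + a*r541*r631) * (- a*b*c*x2*x2 -
      a*r532*r642 + a*r542*r632) -
        (- 2*a*b*c*x1*x2 - a*r531*r642 - a*r532*r641 + a*r541*r632 + a*r542*r631) / 2 * (-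
          2*a*b*c*x1*x2 - a*r531*r642 - a*r532*r641 + a*r541*r632 + a*r542*r631) / 2) -
      a ^ 2 * c ^ 2 * ((- a*b*c*x3*x3 - b*r531*r632 + b*r532*r631) * (- a*b*c*x4*x4 - b*r541*r642
        + b*r542*r641) -
        (- 2*a*b*c*x3*x4 - b*r531*r642 + b*r532*r641 - b*r541*r632 + b*r542*r631) / 2 * (-
          2*a*b*c*x3*x4 - b*r531*r642 + b*r532*r641 - b*r541*r632 + b*r542*r631) / 2) +
      a * b ^ 2 * c * ((a*b*c*x1*x5 - a*c*r531*x4 + a*c*r541*x3) * (a*b*c*x2*x6 - a*c*r632*x4 +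
        a*c*r642*x3) -
        (a*b*c*x1*x6 - a*c*r631*x4 + a*c*r641*x3) * (a*b*c*x2*x5 - a*c*r532*x4 + a*c*r542*x3)) -
      a ^ 2 * b * c * ((- a*b*c*x3*x5 + b*c*r531*x2 - b*c*r532*x1) * (- a*b*c*x4*x6 + b*c*r641*x2
        - b*c*r642*x1) -
        (- a*b*c*x3*x6 + b*c*r631*x2 - b*c*r632*x1) * (- a*b*c*x4*x5 + b*c*r541*x2 -
          b*c*r542*x1)) = 0 := by
    ring
  rw [B11, B12, B15, B16, B22, B25, B26, B33, B34, B35, B36, B44, B45, B46] at e1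
  have e2 : b ^ 2 * c ^ 2 * ((- a*b*c*x1*x1 - a*r531*r641 + a*r541*r631) * (- a*b*c*x2*x2 -
      a*r532*r642 + a*r542*r632) -
        (- 2*a*b*c*x1*x2 - a*r531*r642 - a*r532*r641 + a*r541*r632 + a*r542*r631) / 2 * (-
          2*a*b*c*x1*x2 - a*r531*r642 - a*r532*r641 + a*r541*r632 + a*r542*r631) / 2) -
      a ^ 2 * b ^ 2 * ((- a*b*c*x5*x5 - c*r531*r542 + c*r532*r541) * (- a*b*c*x6*x6 - c*r631*r642
        + c*r632*r641) -
        (- 2*a*b*c*x5*x6 - c*r531*r642 + c*r532*r641 + c*r541*r632 - c*r542*r631) / 2 * (-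
          2*a*b*c*x5*x6 - c*r531*r642 + c*r532*r641 + c*r541*r632 - c*r542*r631) / 2) +
      a * b * c ^ 2 * ((- a*b*c*x1*x3 + a*b*r531*x6 - a*b*r631*x5) * (- a*b*c*x2*x4 + a*b*r542*x6
        - a*b*r642*x5) -
        (- a*b*c*x1*x4 + a*b*r541*x6 - a*b*r641*x5) * (- a*b*c*x2*x3 + a*b*r532*x6 - a*b*r632*x5)) -
      a ^ 2 * b * c * ((- a*b*c*x3*x5 + b*c*r531*x2 - b*c*r532*x1) * (- a*b*c*x4*x6 + b*c*r641*x2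
        - b*c*r642*x1) -
        (- a*b*c*x3*x6 + b*c*r631*x2 - b*c*r632*x1) * (- a*b*c*x4*x5 + b*c*r541*x2 -
          b*c*r542*x1)) = 0 := by
    ring
  rw [B11, B12, B13, B14, B22, B23, B24, B35, B36, B45, B46, B55, B56, B66] at e2
  have hab : a ^ 2 = b ^ 2 := by
    refine mul_left_cancel₀ (pow_ne_zero 2 hc) ?_
    linear_combination (b ^ 2 * c ^ 2 - a ^ 2 * c ^ 2) * hκ - e1
  have hac : a ^ 2 = c ^ 2 := by
    refine mul_left_cancel₀ (pow_ne_zero 2 hb) ?_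
    linear_combination (b ^ 2 * c ^ 2 - a ^ 2 * b ^ 2) * hκ - e2
  have h3 : (a ^ 2) ^ 3 = 1 := by
    rw [← hκ, ← habc, mul_pow, mul_pow, ← hab, ← hac]; ring
  have h1 : a ^ 2 = 1 := by
    nlinarith [sq_nonneg (a ^ 2 + 1), sq_nonneg (a ^ 2 - 1), sq_nonneg a, h3]
  exact ⟨h1, by rw [← hab, h1], by rw [← hac, h1]⟩

/-! ### The cross product with a unit vector. -/

section Cross

variable {V : Type*} [AddCommGroup V] [Module ℝ V] {g : InnerProductSpace.Core ℝ V}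

theorem interior_comm (u v : V) (ω : Forms V) :
    interior u (interior v ω) = -interior v (interior u ω) :=
  CliffordAlgebra.contractLeft_comm _ _ _

/-- The trilinear map underlying a `3`-form. -/
def trilin (φ : Forms V) : V →ₗ[ℝ] V →ₗ[ℝ] V →ₗ[ℝ] ℝ :=
  LinearMap.mk₂ ℝ (fun u v => ExteriorAlgebra.algebraMapInv.toLinearMap ∘ₗ
      interior.flip (interior v (interior u φ)))
    (fun _ _ _ => by simp [LinearMap.comp_add]) (fun _ _ _ => by simp [LinearMap.comp_smul])
    (fun _ _ _ => by simp [LinearMap.comp_add]) (fun _ _ _ => by simp [LinearMap.comp_smul])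

theorem trilin_apply (φ : Forms V) (u v w : V) : trilin φ u v w =
    ExteriorAlgebra.algebraMapInv (interior w (interior v (interior u φ))) := rfl

theorem trilin_swap (φ : Forms V) (u v w : V) : trilin φ u v w = -trilin φ v u w := by
  rw [trilin_apply, trilin_apply, interior_comm v u]
  simp

theorem trilin_swap' (φ : Forms V) (u v w : V) : trilin φ u v w = -trilin φ u w v := by
  rw [trilin_apply, trilin_apply, interior_comm w v]
  simp

theorem trilin_self (φ : Forms V) (u v : V) : trilin φ u v v = 0 := by
  rw [trilin_apply, interior_interior]
  simp

theorem trilin_self' (φ : Forms V) (u v : V) : trilin φ u u v = 0 := by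
  rw [trilin_apply, interior_interior]
  simp

theorem IsOrthonormalBasisOf.bilin_eq_sum {W : Submodule ℝ V} {k : ℕ} {e : Fin k → V}
    (h : IsOrthonormalBasisOf g W e) {x : V} (hx : x ∈ W) (y : V) :
    bilin g x y = ∑ i, bilin g (e i) x * bilin g (e i) y := by
  conv_lhs => rw [← h.sum_eq hx]
  simp

variable [FiniteDimensional ℝ V]

/-- The equations for the coordinates of a form inducing a given metric. -/
theorem Induces.isZero {φ vol : Forms V} (h : Induces φ g vol) {e : Fin 7 → V} (he : IsON g e)
    {F : Coeffs 7} (hF : φ = eval (coframe g e) F) {κ : ℝ}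
    (hvol : vol = eval (coframe g e) (gen 7 7 fun _ => κ)) (i : ℕ) (hi : i < 7) (j : ℕ)
    (hj : j < 7) : IsZero (plus (times (times (contr i F) (contr j F)) F)
      (gen 7 7 fun _ => if i = j then -(6 * κ) else 0)) := by
  have h1 := h.2 (frame e i) (frame e j)
  rw [hF, hvol, frame_of_lt e hi, frame_of_lt e hj, he, ← frame_of_lt e hi, ← frame_of_lt e hj,
    ← eval_contr (he.coframe_frame i hi), ← eval_contr (he.coframe_frame j hj), ← eval_times,
    ← eval_times] at h1
  rw [← eval_eq_zero_iff he.coframe_frame, eval_plus]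
  have h2 : eval (coframe g e) (gen 7 7 fun _ => if i = j then -(6 * κ) else 0) =
      (if i = j then -6 else 0 : ℝ) • eval (coframe g e) (gen 7 7 fun _ => κ) := by
    rw [← eval_gen_smul]
    congr 2
    ext
    split_ifs <;> ring
  have h3 : eval (coframe g e) (times (times (contr i F) (contr j F)) F) =
      (if i = j then 6 else 0 : ℝ) • eval (coframe g e) (gen 7 7 fun _ => κ) := by
    have h4 := congrArg (fun x => (6 : ℝ) • x) h1
    simp only [smul_smul, Fin.mk.injEq] at h4
    norm_num at h4
    rw [← h4, ite_smul, zero_smul]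
  rw [h2, h3, ← add_smul]
  split_ifs <;> simp

/-- The cross product with a unit vector is an isometry of its orthogonal complement. -/
theorem Induces.trilin_isometry {φ vol : Forms V} (hφ : φ ∈ ⋀[ℝ]^3 (Module.Dual ℝ V))
    (h : Induces φ g vol) (hdim : Module.finrank ℝ V = 7) {u w : V} (hu : bilin g u u = 1)
    (huw : bilin g u w = 0) :
    bilin g (sharp g (trilin φ u w)) (sharp g (trilin φ u w)) = bilin g w w := by
  have hONu : IsON g (fun _ : Fin 1 => u) := fun i j => by simp [hu, Subsingleton.elim i j]
  set W := (bilin g).orthogonal (Submodule.span ℝ (Set.range fun _ : Fin 1 => u)) with hWdef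
  have hW : Module.finrank ℝ W = 2 * 3 := by
    have := finrank_orthogonal_add g (Submodule.span ℝ (Set.range fun _ : Fin 1 => u))
    rw [hONu.finrank_span, ← hWdef, hdim] at this
    omega
  have memW : ∀ x, x ∈ W ↔ bilin g u x = 0 := fun x => by
    rw [hWdef, mem_orthogonal_span_range_iff]
    simp
  -- In a basis putting `u ⌟ φ` in normal form on `u⊥`, the form `φ` has block form, so `a i ^ 2 =
  -- 1`: the skew form rotates each of the three planes isometrically.
  obtain ⟨p, q, a, hpW, hqW, hp, hq, hpq, hω⟩ := exists_skew_normal_form g (trilin φ u)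
    (trilin_self φ u) 3 hW
  have hup := fun i => (memW _).1 (hpW i)
  have huq := fun i => (memW _).1 (hqW i)
  have hpu : ∀ i, bilin g (p i) u = 0 := fun i => by rw [bilin_comm, hup]
  have hqu : ∀ i, bilin g (q i) u = 0 := fun i => by rw [bilin_comm, huq]
  have hqp : ∀ i j, bilin g (q i) (p j) = 0 := fun i j => by rw [bilin_comm, hpq]
  have he : IsON g ![u, p 0, q 0, p 1, q 1, p 2, q 2] := by
    intro i j
    fin_cases i <;> fin_cases j <;> simp [hu, hup, huq, hpu, hqu, hp _ _, hq _ _, hpq, hqp]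
  have heb := he.isOrthonormalBasisOf_top hdim
  obtain ⟨κ, hκ, hvol⟩ := h.1.eq_eval heb
  have hpp : ∀ i j, trilin φ u (p i) (p j) = 0 := fun i j => by
    rw [(hω i _ (hpW j)).1, hqp, mul_zero]
  have hqq : ∀ i j, trilin φ u (q i) (q j) = 0 := fun i j => by
    rw [(hω i _ (hqW j)).2, hpq, mul_zero, neg_zero]
  have hpq' : ∀ i j, trilin φ u (p i) (q j) = if i = j then a i else 0 := fun i j => by
    rw [(hω i _ (hqW j)).1, hq i j]; split_ifs <;> simp
  have hqp' : ∀ i j, trilin φ u (q i) (p j) = if i = j then -a i else 0 := fun i j => by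
    rw [(hω i _ (hpW j)).2, hp i j]; split_ifs <;> simp
  have hcyc : ∀ x y, trilin φ x y u = trilin φ u x y := fun x y => by
    rw [trilin_swap', trilin_swap]; simp
  -- The coefficient of `θ₂ ∧ θ₁ ∧ θ₀` is `φ(u, q 0, p 0) = -a 0`, and similarly for the other two
  -- planes; the remaining twenty coefficients are arbitrary.
  have hblock : ∃ x1 x2 x3 x4 x5 x6 x7 x8 x9 x10 x11 x12 x13 x14 x15 x16 x17 x18 x19 x20 : ℝ,
      φ = eval (coframe g ![u, p 0, q 0, p 1, q 1, p 2, q 2]) (blockForm (-a 0) (-a 1) (-a 2)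
        x1 x2 x3 x4 x5 x6 x7 x8 x9 x10 x11 x12 x13 x14 x15 x16 x17 x18 x19 x20) := by
    have h1 := heb.eq_eval hφ
    set e := ![u, p 0, q 0, p 1, q 1, p 2, q 2] with hedef
    obtain ⟨c, hc⟩ : ∃ c, c = coeff (frame e) φ := ⟨_, rfl⟩
    have hc' : ∀ i j, c [i, j, 0] = trilin φ u (frame e i) (frame e j) := fun i j => by
      rw [hc, ← hcyc]; rfl
    rw [← hc] at h1
    have fe : frame e 1 = p 0 ∧ frame e 2 = q 0 ∧ frame e 3 = p 1 ∧ frame e 4 = q 1 ∧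
      frame e 5 = p 2 ∧ frame e 6 = q 2 := ⟨rfl, rfl, rfl, rfl, rfl, rfl⟩
    obtain ⟨f1, f2, f3, f4, f5, f6⟩ := fe
    refine ⟨c [3, 2, 1], c [4, 2, 1], c [5, 2, 1], c [6, 2, 1], c [4, 3, 1], c [5, 3, 1],
      c [6, 3, 1], c [5, 4, 1], c [6, 4, 1], c [6, 5, 1], c [4, 3, 2], c [5, 3, 2], c [6, 3, 2],
      c [5, 4, 2], c [6, 4, 2], c [6, 5, 2], c [5, 4, 3], c [6, 4, 3], c [6, 5, 3], c [6, 5, 4],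
      h1.trans ?_⟩
    simp only [gen, mk, eval, blockForm, hc', f1, f2, f3, f4, f5, f6, hpp, hqq, hpq', hqp',
      reduceIte, map_zero, mul_zero, add_zero, zero_add, Fin.reduceEq, Fin.isValue, zero_ne_one,
      one_ne_zero]
  obtain ⟨x1, x2, x3, x4, x5, x6, x7, x8, x9, x10, x11, x12, x13, x14, x15, x16, x17, x18, x19,
    x20, hF⟩ := hblock
  obtain ⟨h1, h2, h3⟩ := sq_eq_one_of_blockForm rfl hκ (h.isZero he hF hvol)
  have key : ∀ x y, bilin g (sharp g (trilin φ u x)) y = trilin φ u x y := fun x y => by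
    rw [bilin_sharp]
  have hwW := (memW w).2 huw
  have hwp : ∀ i, trilin φ u w (p i) = -(a i * bilin g (q i) w) := fun i => by
    rw [trilin_swap', (hω i w hwW).1]
  have hwq : ∀ i, trilin φ u w (q i) = a i * bilin g (p i) w := fun i => by
    rw [trilin_swap', (hω i w hwW).2, neg_neg]
  have hwu : trilin φ u w u = 0 := by rw [trilin_swap', trilin_self', neg_zero]
  rw [heb.bilin_eq_sum trivial, heb.bilin_eq_sum (x := w) trivial]
  simp only [bilin_comm g _ (sharp g _), key, Fin.sum_univ_seven]
  simp only [Matrix.cons_val, hwp, hwq, hwu, huw]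
  linear_combination ((bilin g (p 0) w) ^ 2 + (bilin g (q 0) w) ^ 2) * h1 +
    ((bilin g (p 1) w) ^ 2 + (bilin g (q 1) w) ^ 2) * h2 +
    ((bilin g (p 2) w) ^ 2 + (bilin g (q 2) w) ^ 2) * h3

end Cross

/-! ### Orthonormal bases adapted to a `G₂`-structure. -/

section Adapted

variable {V : Type*} [AddCommGroup V] [Module ℝ V] {g : InnerProductSpace.Core ℝ V}

/-- The model `θ₀₁₂ + θ₀₃₄ + θ₀₅₆ + θ₁₃₅ - θ₁₄₆ - θ₂₃₆ - θ₂₄₅` of a `G₂`-structure. -/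
def stdForm : Coeffs 7 :=
  (node (node (node (node (node zero (node zero (node zero (scalar (-1))))) zero) (node zero
    (node (node (node zero (scalar (-1))) zero) zero))) (node (node zero (node (node zero
    (scalar (-1))) zero)) (node (node zero (scalar 1)) zero))) (node (node (node zero (node zero
    (scalar 1))) (node (node (node zero (scalar 1)) zero) zero)) (node (node (node (node (node
    zero (scalar (-1))) zero) zero) zero) zero)))

variable [FiniteDimensional ℝ V]

/-- The cross product of a `3`-form. -/
def cross (g : InnerProductSpace.Core ℝ V) (φ : Forms V) : V →ₗ[ℝ] V →ₗ[ℝ] V :=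
  (trilin φ).compr₂ (sharp g)

theorem bilin_cross (φ : Forms V) (x y z : V) : bilin g (cross g φ x y) z = trilin φ x y z :=
  bilin_sharp _ _ _

theorem cross_swap (φ : Forms V) (x y : V) : cross g φ x y = -cross g φ y x := by
  have : trilin φ x y = -trilin φ y x := LinearMap.ext fun z => trilin_swap φ x y z
  simp only [cross, LinearMap.compr₂_apply, this, map_neg]

theorem ext_bilin {x y : V} (h : ∀ z, bilin g x z = bilin g y z) : x = y := by
  refine sub_eq_zero.1 (bilin_self_eq_zero g ?_)
  have h' : ∀ z, bilin g (x - y) z = 0 := fun z => by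
    rw [map_sub, LinearMap.sub_apply, h, sub_self]
  exact h' _

variable {φ vol : Forms V}

/-- Polarization of `Induces.trilin_isometry`. -/
theorem Induces.bilin_cross_cross (hI : Induces φ g vol)
    (hφ : φ ∈ ⋀[ℝ]^3 (Module.Dual ℝ V)) (hdim : Module.finrank ℝ V = 7)
    {u x y : V} (hu : bilin g u u = 1) (hx : bilin g u x = 0)
    (hy : bilin g u y = 0) : bilin g (cross g φ u x) (cross g φ u y) = bilin g x y := by
  have key : ∀ w, bilin g u w = 0 → bilin g (cross g φ u w) (cross g φ u w) = bilin g w w :=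
    fun w hw => hI.trilin_isometry hφ hdim hu hw
  have h1 := key (x + y) (by rw [map_add, hx, hy, add_zero])
  have h2 := key x hx
  have h3 := key y hy
  simp only [map_add, LinearMap.add_apply] at h1
  rw [bilin_comm g y x, bilin_comm g (cross g φ u y)] at h1
  linarith

/-- The cross product with `u` is skew-symmetric and restricts to an isometry of `u⊥`, so its square
there is `-1`. -/
theorem Induces.cross_cross_of_unit (hI : Induces φ g vol)
    (hφ : φ ∈ ⋀[ℝ]^3 (Module.Dual ℝ V)) (hdim : Module.finrank ℝ V = 7)
    {u x : V} (hu : bilin g u u = 1) (hx : bilin g u x = 0) :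
    cross g φ u (cross g φ u x) = -x := by
  have hux : ∀ x, bilin g u (cross g φ u x) = 0 := fun x => by
    rw [bilin_comm, bilin_cross, trilin_swap', trilin_self', neg_zero]
  refine ext_bilin (g := g) fun z => ?_
  obtain ⟨y, hy⟩ : ∃ y, y = z - bilin g u z • u := ⟨_, rfl⟩
  have hz : z = y + bilin g u z • u := by rw [hy, sub_add_cancel]
  have huy : bilin g u y = 0 := by rw [hy, map_sub, map_smul, hu]; simp
  rw [bilin_cross, trilin_swap', ← bilin_cross (g := g)]
  have h1 : cross g φ u z = cross g φ u y := by
    rw [hz, map_add, map_smul]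
    have : cross g φ u u = 0 := ext_bilin (g := g) fun z => by rw [bilin_cross, trilin_self']; simp
    rw [this, smul_zero, add_zero]
  rw [h1, bilin_comm, hI.bilin_cross_cross hφ hdim hu hx huy, map_neg, LinearMap.neg_apply, hz,
    map_add, map_smul, bilin_comm g x u, hx, smul_zero, add_zero]

theorem Induces.cross_cross (hI : Induces φ g vol)
    (hφ : φ ∈ ⋀[ℝ]^3 (Module.Dual ℝ V)) (hdim : Module.finrank ℝ V = 7)
    {u x : V} (hx : bilin g u x = 0) :
    cross g φ u (cross g φ u x) = -(bilin g u u • x) := by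
  by_cases hu : u = 0
  · simp [hu]
  · have hpos := bilin_self_pos (g := g) hu
    set r := Real.sqrt (bilin g u u) with hr
    have hr2 : r * r = bilin g u u := Real.mul_self_sqrt hpos.le
    have hr0 : r ≠ 0 := (Real.sqrt_pos.2 hpos).ne'
    have h1 := hI.cross_cross_of_unit hφ hdim (u := r⁻¹ • u) (x := x)
      (by simp only [map_smul, LinearMap.smul_apply, smul_eq_mul, ← hr2]; field_simp)
      (by simp [hx])
    simp only [map_smul, LinearMap.smul_apply, smul_smul] at h1
    rw [← hr2, ← smul_neg, ← h1, smul_smul]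
    field_simp
    rw [one_smul]

/-- Polarizing `Induces.cross_cross` in `u` gives the Clifford relation, from which products of
iterated cross products are computed. -/
theorem Induces.cross_cross_comm (hI : Induces φ g vol)
    (hφ : φ ∈ ⋀[ℝ]^3 (Module.Dual ℝ V)) (hdim : Module.finrank ℝ V = 7)
    {u v x : V} (hux : bilin g u x = 0) (hvx : bilin g v x = 0)
    (huv : bilin g u v = 0) :
    cross g φ u (cross g φ v x) = -cross g φ v (cross g φ u x) := by
  have h1 := hI.cross_cross hφ hdim hux
  have h2 := hI.cross_cross hφ hdim hvx
  have h3 := hI.cross_cross hφ hdim (u := u + v) (x := x) (by simp [hux, hvx])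
  simp only [map_add, LinearMap.add_apply, h1, h2, huv, bilin_comm g v u] at h3
  simp only [add_zero, zero_add, add_smul, neg_add] at h3
  rw [eq_neg_iff_add_eq_zero]
  have h4 : cross g φ u (cross g φ v x) + cross g φ v (cross g φ u x) =
    (-(bilin g u u • x) + cross g φ v (cross g φ u x) +
      (cross g φ u (cross g φ v x) + -(bilin g v v • x))) -
      (-(bilin g u u • x) + -(bilin g v v • x)) := by abel
  rw [h4, h3, sub_self]

/-- A `G₂`-structure is standard in an orthonormal basis, of which the first two vectors are
arbitrary and the fourth one is orthogonal to the first two and to their cross product. -/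
theorem Induces.exists_adapted (hI : Induces φ g vol)
    (hφ : φ ∈ ⋀[ℝ]^3 (Module.Dual ℝ V)) (hdim : Module.finrank ℝ V = 7)
    {u v x : V} (huu : bilin g u u = 1) (hvv : bilin g v v = 1)
    (huv : bilin g u v = 0) (hxx : bilin g x x = 1) (hux : bilin g u x = 0)
    (hvx : bilin g v x = 0) (hx2 : bilin g (cross g φ u v) x = 0) :
    ∃ e : Fin 7 → V, IsOrthonormalBasisOf g ⊤ e ∧ e 0 = u ∧ e 1 = v ∧ e 2 = cross g φ u v ∧
      e 3 = x ∧ φ = eval (coframe g e) stdForm ∧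
      vol = eval (coframe g e) (gen 7 7 fun _ => -1) := by
  obtain ⟨y, hy⟩ : ∃ y, y = cross g φ u v := ⟨_, rfl⟩
  rw [← hy] at hx2 ⊢
  have sw := fun x y => cross_swap (g := g) φ x y
  have tr := fun x y z => bilin_cross (g := g) φ x y z
  have iso := fun {u x y : V} => hI.bilin_cross_cross hφ hdim (u := u) (x := x) (y := y)
  have cc := fun {u x : V} => hI.cross_cross_of_unit hφ hdim (u := u) (x := x)
  have co := fun {u v x : V} => hI.cross_cross_comm hφ hdim (u := u) (v := v) (x := x)
  have orth1 : ∀ x y, bilin g x (cross g φ x y) = 0 := fun x y => by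
    rw [bilin_comm, tr, trilin_swap', trilin_self', neg_zero]
  have orth2 : ∀ x y, bilin g x (cross g φ y x) = 0 := fun x y => by
    rw [bilin_comm, tr, trilin_self]
  have huy : bilin g u y = 0 := by rw [hy, orth1]
  have hvy : bilin g v y = 0 := by rw [hy, orth2]
  have hyy : bilin g y y = 1 := by rw [hy, iso huu huv huv, hvv]
  have hvu : bilin g v u = 0 := by rw [bilin_comm, huv]
  have hxu : bilin g x u = 0 := by rw [bilin_comm, hux]
  have hxv : bilin g x v = 0 := by rw [bilin_comm, hvx]
  have hxy : bilin g x y = 0 := by rw [bilin_comm, hx2]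
  have hyu : bilin g y u = 0 := by rw [bilin_comm, huy]
  have hyv : bilin g y v = 0 := by rw [bilin_comm, hvy]
  -- The vectors `u`, `v`, `x` generate the rest of the basis. The table of products `p..` follows
  -- from the Clifford relations, the orthogonality relations from the isometry property, and `φ` is
  -- then determined by its values on basis triples.
  obtain ⟨e4, h4⟩ : ∃ e, e = cross g φ u x := ⟨_, rfl⟩
  obtain ⟨e5, h5⟩ : ∃ e, e = cross g φ v x := ⟨_, rfl⟩
  obtain ⟨e6, h6⟩ : ∃ e, e = cross g φ x y := ⟨_, rfl⟩
  have p01 : cross g φ u v = y := hy.symm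
  have p03 : cross g φ u x = e4 := h4.symm
  have p13 : cross g φ v x = e5 := h5.symm
  have p23 : cross g φ y x = -e6 := by rw [sw, h6]
  have p05 : cross g φ u e5 = e6 := by
    rw [h6, hy, co hxv huv hxu, h5, sw x v, map_neg, neg_neg]
  have p14 : cross g φ v e4 = -e6 := by rw [h4, co hvx hux hvu, ← h5, p05]
  have p41 : e6 = -cross g φ v e4 := by rw [p14, neg_neg]
  have hu4 : bilin g u e4 = 0 := by rw [h4, orth1]
  have hv4 : bilin g v e4 = 0 := by rw [h4, bilin_comm, tr, trilin_swap', ← tr, ← hy, hx2, neg_zero]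
  have hy4 : bilin g y e4 = 0 := by rw [hy, h4, iso huu huv hux, hvx]
  have hx4 : bilin g x e4 = 0 := by rw [h4, orth2]
  have h44 : bilin g e4 e4 = 1 := by rw [h4, iso huu hux hux, hxx]
  have hu5 : bilin g u e5 = 0 := by
    rw [h5, bilin_comm, tr, trilin_swap', trilin_swap, neg_neg, ← tr, ← hy, hx2]
  have hv5 : bilin g v e5 = 0 := by rw [h5, orth1]
  have hy5 : bilin g y e5 = 0 := by
    rw [hy, h5, sw u v, map_neg, LinearMap.neg_apply, iso hvv hvu hvx, hux, neg_zero]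
  have hx5 : bilin g x e5 = 0 := by rw [h5, orth2]
  have h45 : bilin g e4 e5 = 0 := by
    rw [h4, h5, sw u x, sw v x, map_neg, map_neg, LinearMap.neg_apply, neg_neg,
      iso hxx hxu hxv, huv]
  have h55 : bilin g e5 e5 = 1 := by rw [h5, iso hvv hvx hvx, hxx]
  have hu6 : bilin g u e6 = 0 := by rw [← p05, orth1]
  have hv6 : bilin g v e6 = 0 := by rw [p41, map_neg, orth1, neg_zero]
  have hy6 : bilin g y e6 = 0 := by rw [h6, orth2]
  have hx6 : bilin g x e6 = 0 := by rw [h6, orth1]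
  have h46 : bilin g e4 e6 = 0 := by rw [← p05, h4, iso huu hux hu5, hx5]
  have h56 : bilin g e5 e6 = 0 := by
    rw [p41, map_neg, h5, iso hvv hvx hv4, hx4, neg_zero]
  have h66 : bilin g e6 e6 = 1 := by rw [h6, iso hxx hxy hxy, hyy]
  have h54 : bilin g e5 e4 = 0 := by rw [bilin_comm, h45]
  have h64 : bilin g e6 e4 = 0 := by rw [bilin_comm, h46]
  have h65 : bilin g e6 e5 = 0 := by rw [bilin_comm, h56]
  have p02 : cross g φ u y = -v := by rw [hy, cc huu huv]
  have p12 : cross g φ v y = u := by rw [hy, sw u v, map_neg, cc hvv hvu, neg_neg]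
  have p04 : cross g φ u e4 = -x := by rw [h4, cc huu hux]
  have p15 : cross g φ v e5 = -x := by rw [h5, cc hvv hvx]
  have p06 : cross g φ u e6 = -e5 := by rw [← p05, cc huu hu5]
  have p16 : cross g φ v e6 = e4 := by rw [p41, map_neg, cc hvv hv4, neg_neg]
  have p24 : cross g φ y e4 = -e5 := by
    rw [h4, co hx2 hux hyu, p23, map_neg, neg_neg, p06]
  have p25 : cross g φ y e5 = e4 := by
    rw [h5, co hx2 hvx hyv, p23, map_neg, neg_neg, p16]
  have p26 : cross g φ y e6 = x := by rw [h6, sw x y, map_neg, cc hyy hx2, neg_neg]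
  have p34 : cross g φ x e4 = u := by rw [h4, sw u x, map_neg, cc hxx hxu, neg_neg]
  have p35 : cross g φ x e5 = v := by rw [h5, sw v x, map_neg, cc hxx hxv, neg_neg]
  have p45 : cross g φ e4 e5 = -y := by
    have h4v : bilin g e4 v = 0 := by rw [bilin_comm, hv4]
    have h4x : bilin g e4 x = 0 := by rw [bilin_comm, hx4]
    rw [h5, co h4x hvx h4v, sw e4 x, p34, map_neg, neg_neg, sw v u, p01]
  have he : IsON (ι := Fin 7) g ![u, v, y, x, e4, e5, e6] := by
    have sym : ∀ {i j : Fin 7}, (bilin g (![u, v, y, x, e4, e5, e6] i)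
        (![u, v, y, x, e4, e5, e6] j) = if i = j then 1 else 0) →
        bilin g (![u, v, y, x, e4, e5, e6] j) (![u, v, y, x, e4, e5, e6] i) =
          if j = i then 1 else 0 := fun {i j} h => by rw [bilin_comm, h]; simp [eq_comm]
    have low : ∀ i j : Fin 7, i ≤ j → bilin g (![u, v, y, x, e4, e5, e6] i)
        (![u, v, y, x, e4, e5, e6] j) = if i = j then 1 else 0 := by
      intro i j hij
      fin_cases i <;> fin_cases j <;> first | (exact absurd hij (by decide)) | assumption
    intro i j
    rcases le_total i j with h | h
    · exact low i j h
    · exact sym (low j i h)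
  have heb : IsOrthonormalBasisOf (k := 7) g ⊤ _ := he.isOrthonormalBasisOf_top hdim
  obtain ⟨e, hedef⟩ : ∃ e : Fin 7 → V, e = ![u, v, y, x, e4, e5, e6] := ⟨_, rfl⟩
  rw [← hedef] at he heb
  have f0 : frame e 0 = u := by rw [hedef]; rfl
  have f1 : frame e 1 = v := by rw [hedef]; rfl
  have f2 : frame e 2 = y := by rw [hedef]; rfl
  have f3 : frame e 3 = x := by rw [hedef]; rfl
  have f4 : frame e 4 = e4 := by rw [hedef]; rfl
  have f5 : frame e 5 = e5 := by rw [hedef]; rfl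
  have f6 : frame e 6 = e6 := by rw [hedef]; rfl
  have hstd : φ = eval (coframe g e) stdForm := by
    have h1 := heb.eq_eval hφ
    obtain ⟨c, hc⟩ : ∃ c, c = coeff (frame e) φ := ⟨_, rfl⟩
    have hc' : ∀ i j k, c [k, j, i] =
        -bilin g (cross g φ (frame e i) (frame e j)) (frame e k) := fun i j k => by
      rw [hc, tr, trilin_swap, trilin_swap', trilin_swap]
      simp only [neg_neg]
      rfl
    rw [← hc] at h1
    rw [h1]
    simp only [gen, mk, hc', f0, f1, f2, f3, f4, f5, f6, p01, p02, p03, p04, p05, p06, p12, p13,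
      p14, p15, p16, p23, p24, p25, p26, p34, p35, p45, map_neg, LinearMap.neg_apply, huu, hvv,
      huv, hxx, hux, hvx, hx2, huy, hvy, hyy, hvu, hxu, hxv, hxy, hyu, hyv, hu4, hv4, hy4, hx4,
      h44, hu5, hv5, hy5, hx5, h45, h55, hu6, hv6, hy6, hx6, h46, h56, h66, h54,
      h64, h65, stdForm, Nat.reduceAdd, eval,
      neg_zero, neg_neg, map_zero, mul_zero, add_zero, zero_add]
  obtain ⟨κ, hκ, hvol⟩ := hI.1.eq_eval heb
  obtain ⟨F, hF⟩ : ∃ F, F = stdForm := ⟨_, rfl⟩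
  have h00 := hI.isZero he (hF ▸ hstd) hvol 0 (by norm_num) 0 (by norm_num)
  simp only [hF, stdForm, gen, mk, contr, times, plus, scale, opp, invol, plusScalar, IsZero,
    reduceIte, Nat.reduceEqDiff, OfNat.ofNat_ne_zero, OfNat.zero_ne_ofNat, Nat.zero_ne_one,
    zero_ne_one, true_and, and_true] at h00
  -- The equation `(0, 0)` fixes the orientation: `vol` is `θ₀ ∧ … ∧ θ₆`, whose coefficient in
  -- decreasing order is `-1`.
  obtain rfl : κ = -1 := by linarith
  exact ⟨e, heb, f0, f1, f2, f3, hstd, hvol⟩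

end Adapted

/-! ### The model `G₂`-structure and its Hodge dual. -/

namespace Coeffs

/-- All the components have degree `k`. -/
def IsHomogeneous : {n : ℕ} → ℕ → Coeffs n → Prop
  | _, _, zero => True
  | _, k, scalar _ => k = 0
  | _, 0, node a b => IsHomogeneous 0 a ∧ b = zero
  | _, k + 1, node a b => IsHomogeneous (k + 1) a ∧ IsHomogeneous k b

theorem IsHomogeneous.eval_mem {V : Type*} [AddCommGroup V] [Module ℝ V]
    (θ : ℕ → Module.Dual ℝ V) {n k : ℕ} {a : Coeffs n} (h : IsHomogeneous k a) :
    eval θ a ∈ ⋀[ℝ]^k (Module.Dual ℝ V) := by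
  induction a generalizing k with
  | zero => exact Submodule.zero_mem _
  | scalar r =>
    obtain rfl : k = 0 := by cases k <;> simpa [IsHomogeneous] using h
    rw [eval, ExteriorAlgebra.exteriorPower, pow_zero]
    exact Submodule.algebraMap_mem r
  | node a b iha ihb =>
    cases k with
    | zero =>
      obtain ⟨h1, rfl⟩ := h
      rw [eval, eval, mul_zero, add_zero]
      exact iha h1
    | succ k =>
      refine Submodule.add_mem _ (iha h.1) ?_
      rw [ExteriorAlgebra.exteriorPower, pow_succ']
      exact Submodule.mul_mem_mul ⟨_, rfl⟩ (ihb h.2)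

end Coeffs

section Standard

variable {V : Type*} [AddCommGroup V] [Module ℝ V] [FiniteDimensional ℝ V]
  {g : InnerProductSpace.Core ℝ V}

theorem interior_eq_sum {e : Fin 7 → V} (he : IsOrthonormalBasisOf g ⊤ e) (v : V) :
    interior v = ∑ i : Fin 7, bilin g (e i) v • interior (V := V) (e i) := by
  conv_lhs => rw [← he.sum_eq (x := v) trivial]
  simp

theorem stdForm_homogeneous : IsHomogeneous 3 stdForm := by
  simp [stdForm, IsHomogeneous]

set_option maxHeartbeats 1000000 in
theorem induces_stdForm {e : Fin 7 → V} (he : IsOrthonormalBasisOf g ⊤ e) :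
    Induces (eval (coframe g e) stdForm) g (eval (coframe g e) (gen 7 7 fun _ => -1)) := by
  refine ⟨⟨e, he, (ιMulti_seven e).symm⟩, fun v w => ?_⟩
  obtain ⟨F, hF⟩ : ∃ F, F = stdForm := ⟨_, rfl⟩
  have hint : ∀ v, interior v (eval (coframe g e) F) = eval (coframe g e)
      (plus (scale (bilin g (e 0) v) (contr 0 F)) (plus (scale (bilin g (e 1) v) (contr 1 F))
      (plus (scale (bilin g (e 2) v) (contr 2 F)) (plus (scale (bilin g (e 3) v) (contr 3 F))
      (plus (scale (bilin g (e 4) v) (contr 4 F)) (plus (scale (bilin g (e 5) v) (contr 5 F))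
      (scale (bilin g (e 6) v) (contr 6 F)))))))) := fun v => by
    have h := fun i hi => eval_contr (he.isON.coframe_frame i hi) F
    rw [interior_eq_sum he]
    simp only [eval_plus, eval_scale, h 0 (by norm_num), h 1 (by norm_num), h 2 (by norm_num),
      h 3 (by norm_num), h 4 (by norm_num), h 5 (by norm_num), h 6 (by norm_num),
      Fin.sum_univ_seven, LinearMap.add_apply, LinearMap.smul_apply, add_assoc]
    rfl
  have hvw : bilin g v w = ∑ i, bilin g (e i) v * bilin g (e i) w := he.bilin_eq_sum trivial w
  rw [← hF, hint, hint, ← eval_times, ← eval_times, ← eval_scale, ← eval_scale, ← sub_eq_zero,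
    sub_eq_add_neg, ← eval_opp, ← eval_plus, eval_eq_zero_iff he.isON.coframe_frame, hvw,
    Fin.sum_univ_seven]
  simp only [hF, stdForm, gen, mk, contr, times, plus, scale, opp, invol, plusScalar, IsZero,
    reduceIte, Nat.reduceEqDiff, OfNat.ofNat_ne_zero, OfNat.zero_ne_ofNat, Nat.zero_ne_one,
    OfNat.one_ne_ofNat, OfNat.ofNat_ne_one, zero_ne_one, true_and, and_true]
  ring

/-- Nondegeneracy is a consequence of the induced metric: `(v ⌟ φ) ∧ (v ⌟ φ) ∧ φ` is a nonzero
multiple of `g(v, v) vol`. -/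
theorem isG2Structure_stdForm {e : Fin 7 → V} (he : IsOrthonormalBasisOf g ⊤ e) :
    IsG2Structure (eval (coframe g e) stdForm) := by
  refine ⟨stdForm_homogeneous.eval_mem _, fun v hv h => ?_⟩
  have h1 := (induces_stdForm he).2 v v
  rw [h, smul_zero, smul_eq_zero, or_iff_right (bilin_self_pos hv).ne',
    eval_eq_zero_iff he.isON.coframe_frame] at h1
  simp [gen, mk, IsZero] at h1

/-- The Hodge dual of the model form. -/
def stdDual : Coeffs 7 :=
  (node (node (node zero (node zero (node zero (node zero (scalar 1))))) (node (node zero (node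
    zero (node (node zero (scalar (-1))) zero))) (node (node (node zero (node zero (scalar
    (-1)))) zero) zero))) (node (node (node zero (node (node zero (node zero (scalar (-1))))
    zero)) (node (node zero (node (node zero (scalar 1)) zero)) zero)) (node (node (node zero
    (node zero (scalar 1))) zero) (node zero (scalar 1)))))

theorem hodge_stdForm {e : Fin 7 → V} (he : IsON g e) :
    hodge g (eval (coframe g e) (gen 7 7 fun _ => -1)) (eval (coframe g e) stdForm) =
      eval (coframe g e) stdDual := by
  rw [hodge, ← eval_contrForm_coframe he]
  simp [stdForm, stdDual, gen, mk, contr, contrForm, plus, plusScalar, scale, opp, eval]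

end Standard

/-! ### The Chevalley–Eilenberg differential in a frame. -/

section Differential

variable {𝔫 : Type*} [LieRing 𝔫] [LieAlgebra ℝ 𝔫] [FiniteDimensional ℝ 𝔫]
  {g : InnerProductSpace.Core ℝ 𝔫}

theorem lie_mem_derivedAlgebra (x y : 𝔫) : ⁅x, y⁆ ∈ (derivedAlgebra 𝔫).toSubmodule :=
  LieSubmodule.lie_mem_lie (I := (⊤ : LieIdeal ℝ 𝔫)) (N := (⊤ : LieIdeal ℝ 𝔫)) trivial trivial

/-- The differential in an orthonormal basis of a subspace that contains the brackets. -/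
theorem ceD_eq_sum {p : ℕ} {U : Submodule ℝ 𝔫} {z : Fin p → 𝔫}
    (hz : IsOrthonormalBasisOf g U z) (hU : ∀ x y : 𝔫, ⁅x, y⁆ ∈ U) (ω : Forms 𝔫) :
    ceD ω = ∑ a, ceD (flat g (z a)) * interior (z a) ω := by
  have h : ∀ x y : 𝔫, interior ⁅x, y⁆ ω = ∑ a, bilin g (z a) ⁅x, y⁆ • interior (z a) ω :=
    fun x y => by
      conv_lhs => rw [← hz.sum_eq (hU x y)]
      simp
  simp only [ceD_apply, flat, LinearMap.comp_apply, interior_oneForm, h, Finset.mul_sum,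
    Finset.sum_mul, smul_mul_assoc, Finset.smul_sum, mul_smul_comm, mul_assoc,
    ← Algebra.smul_def]
  rw [Finset.sum_congr rfl fun i _ => Finset.sum_comm, Finset.sum_comm]

theorem ceD_flat_mem (z : 𝔫) : ceD (flat g z) ∈ ⋀[ℝ]^2 (Module.Dual ℝ 𝔫) := by
  rw [ceD_apply, ExteriorAlgebra.exteriorPower, sq]
  refine Submodule.smul_mem _ _ (Submodule.sum_mem _ fun i _ => Submodule.sum_mem _ fun k _ => ?_)
  rw [flat, LinearMap.comp_apply, interior_oneForm, ← Algebra.commutes, ← Algebra.smul_def]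
  exact Submodule.smul_mem _ _ (Submodule.mul_mem_mul ⟨_, rfl⟩ ⟨_, rfl⟩)

/-- The minus sign of `dζ(x, y) = -ζ([x, y])` is absorbed by the decreasing order of the covectors,
since `c [j, i]` multiplies `θⱼ ∧ θᵢ`. -/
theorem ceD_flat_eq_eval {n : ℕ} {e : Fin n → 𝔫} (he : IsOrthonormalBasisOf g ⊤ e) (z : 𝔫) :
    ∃ c : List ℕ → ℝ, ceD (flat g z) = eval (coframe g e) (gen n 2 c) ∧
      ∀ i j, c [j, i] = bilin g z ⁅frame e i, frame e j⁆ := by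
  refine ⟨_, he.eq_eval (ceD_flat_mem z), fun i j => ?_⟩
  simp [coeff, flat, ceD_oneForm_apply]
  rw [← lie_skew, map_neg, neg_neg]

theorem bilin_lie_of_mem (hnil : IsTwoStepNilpotent 𝔫) {x : 𝔫}
    (hx : x ∈ (derivedAlgebra 𝔫).toSubmodule) (y : 𝔫) : ⁅x, y⁆ = 0 ∧ ⁅y, x⁆ = 0 := by
  have h := hnil.2 hx
  rw [LieModule.mem_maxTrivSubmodule] at h
  exact ⟨by rw [← lie_skew, h, neg_zero], h y⟩

end Differential

/-! ### Traces in orthonormal bases, and adapted bases from two vectors. -/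

section General

variable {V : Type*} [AddCommGroup V] [Module ℝ V] [FiniteDimensional ℝ V]
  {g : InnerProductSpace.Core ℝ V}

theorem IsOrthonormalBasisOf.mem_orthogonal_iff {W : Submodule ℝ V} {k : ℕ} {e : Fin k → V}
    (h : IsOrthonormalBasisOf g W e) {x : V} :
    x ∈ (bilin g).orthogonal W ↔ ∀ i, bilin g (e i) x = 0 := by
  rw [← h.2, mem_orthogonal_span_range_iff]

/-- The trace of a power in an orthonormal basis. -/
theorem trace_pow_eq {W : Submodule ℝ V} {k : ℕ} {e : Fin k → V}
    (h : IsOrthonormalBasisOf g W e) (L : Module.End ℝ W) (m : ℕ) :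
    LinearMap.trace ℝ W (L ^ m) =
      ((Matrix.of fun i j => bilin g (e i) (L ⟨e j, h.mem j⟩ : W)) ^ m).trace := by
  let f : Fin k → W := fun i => ⟨e i, h.mem i⟩
  have hrepr : ∀ x : W, ∑ i, bilin g (e i) x • f i = x := fun x => by
    ext
    simp [f, h.sum_eq x.2]
  have hli : LinearIndependent ℝ f :=
    LinearIndependent.of_comp W.subtype h.isON.linearIndependent
  let b : Module.Basis (Fin k) ℝ W := Module.Basis.mk hli fun x _ => by
    rw [← hrepr x]
    exact Submodule.sum_mem _ fun i _ => Submodule.smul_mem _ _ (Submodule.subset_span ⟨i, rfl⟩)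
  have hb : ∀ i, b i = f i := fun i => by simp [b]
  have hM : LinearMap.toMatrix b b L =
      Matrix.of fun i j => bilin g (e i) (L ⟨e j, h.mem j⟩ : W) := by
    ext i j
    rw [LinearMap.toMatrix_apply, hb, Matrix.of_apply]
    have h1 := hrepr (L (f j))
    rw [← h1, map_sum]
    simp only [map_smul, ← hb, Module.Basis.repr_self, Finsupp.coe_finsetSum, Finset.sum_apply,
      Finsupp.smul_apply, Finsupp.single_apply, smul_eq_mul, mul_ite, mul_one, mul_zero,
      Finset.sum_ite_eq', Finset.mem_univ, if_true]
    simp only [hb]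
    rw [h1]
  rw [LinearMap.trace_eq_matrix_trace ℝ b, ← hM, LinearMap.toMatrix_pow]

/-- Two orthonormal vectors extend to a basis in which the form is the model. -/
theorem Induces.exists_adapted_of_pair {φ vol : Forms V} (hI : Induces φ g vol)
    (hφ : φ ∈ ⋀[ℝ]^3 (Module.Dual ℝ V)) (hdim : Module.finrank ℝ V = 7) {u v : V}
    (huu : bilin g u u = 1) (hvv : bilin g v v = 1) (huv : bilin g u v = 0) :
    ∃ e : Fin 7 → V, IsOrthonormalBasisOf g ⊤ e ∧ e 0 = u ∧ e 1 = v ∧ e 2 = cross g φ u v ∧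
      φ = eval (coframe g e) stdForm ∧ vol = eval (coframe g e) (gen 7 7 fun _ => -1) := by
  have hvu : bilin g v u = 0 := by rw [bilin_comm, huv]
  have h1 : bilin g u (cross g φ u v) = 0 := by
    rw [bilin_comm, bilin_cross, trilin_swap', trilin_self', neg_zero]
  have h2 : bilin g v (cross g φ u v) = 0 := by rw [bilin_comm, bilin_cross, trilin_self]
  have h3 : bilin g (cross g φ u v) (cross g φ u v) = 1 := by
    rw [hI.bilin_cross_cross hφ hdim huu huv huv, hvv]
  have hON : IsON g ![u, v, cross g φ u v] := by
    intro i j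
    fin_cases i <;> fin_cases j <;>
      simp [huu, hvv, huv, hvu, h1, h2, h3, bilin_comm g (cross g φ u v)]
  obtain ⟨x, -, hxx, hx⟩ := hON.exists_unit (W := ⊤) (fun _ => trivial)
    (by rw [finrank_top, hdim]; norm_num)
  obtain ⟨e, h1, h2, h3, h4, -, h5⟩ := hI.exists_adapted hφ hdim huu hvv huv hxx (hx 0) (hx 1)
    (hx 2)
  exact ⟨e, h1, h2, h3, h4, h5⟩

end General

/-! ### One-dimensional derived algebra. -/

section RankOne

variable {𝔫 : Type*} [LieRing 𝔫] [LieAlgebra ℝ 𝔫] [FiniteDimensional ℝ 𝔫]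
  {g : InnerProductSpace.Core ℝ 𝔫}

theorem bilin_j_eq (z : 𝔫) {x : 𝔫} (hx : x ∈ orthoDerived g) {y : 𝔫} (hy : y ∈ orthoDerived g) :
    bilin g y (j g z ⟨x, hx⟩ : orthoDerived g) = bilin g z ⁅x, y⁆ := by
  rw [bilin_comm]
  exact bilin_j g z ⟨x, hx⟩ ⟨y, hy⟩

/-- A trace identity for primitive forms of type `(1, 1)` in dimension six. -/
theorem trace_sq_sq_eq {M : Matrix (Fin 6) (Fin 6) ℝ} (hM : ∀ i k, M i k = -M k i)
    (h1 : M 0 2 = M 1 3) (h2 : M 0 3 = -M 1 2) (h3 : M 0 4 = M 1 5) (h4 : M 0 5 = -M 1 4)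
    (h5 : M 2 4 = M 3 5) (h6 : M 2 5 = -M 3 4) (h7 : M 0 1 + M 2 3 + M 4 5 = 0) :
    (M ^ 2).trace ^ 2 = 4 * (M ^ 4).trace := by
  -- The hypotheses `h1`–`h6` say that `M` commutes with the complex structure pairing `0, 1`, then
  -- `2, 3`, then `4, 5`; `h7` says that its complex trace vanishes. So `M` is a trace-free
  -- skew-Hermitian `3 × 3` matrix, and the identity can be checked by expansion.
  have hd : ∀ i, M i i = 0 := fun i => by have := hM i i; linarith
  have h45 : M 4 5 = -(M 0 1 + M 2 3) := by linarith
  have e2 : M ^ 4 = M ^ 2 * M ^ 2 := by rw [← pow_add]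
  have t2 : (M ^ 2).trace = -2 * (M 0 1 ^ 2 + M 2 3 ^ 2 + (M 0 1 + M 2 3) ^ 2 +
      2 * (M 1 3 ^ 2 + M 1 2 ^ 2 + M 1 5 ^ 2 + M 1 4 ^ 2 + M 3 5 ^ 2 + M 3 4 ^ 2)) := by
    rw [sq M, Matrix.trace]
    simp only [Matrix.diag_apply, Matrix.mul_apply, Fin.sum_univ_six]
    simp only [hM 1 0, hM 2 0, hM 3 0, hM 4 0, hM 5 0, hM 2 1, hM 3 1, hM 4 1, hM 5 1, hM 3 2,
      hM 4 2, hM 5 2, hM 4 3, hM 5 3, hM 5 4, hd, h1, h2, h3, h4, h5, h6, h45]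
    ring
  rw [t2, e2, Matrix.trace]
  simp only [Matrix.diag_apply, sq M]
  simp only [Matrix.mul_apply, Fin.sum_univ_six]
  simp only [hM 1 0, hM 2 0, hM 3 0, hM 4 0, hM 5 0, hM 2 1, hM 3 1, hM 4 1, hM 5 1, hM 3 2,
    hM 4 2, hM 5 2, hM 4 3, hM 5 3, hM 5 4, hd, h1, h2, h3, h4, h5, h6, h45]
  ring

theorem trace_sq_skewBlock (a : Fin 3 → ℝ) :
    (!![0, -a 0, 0, 0, 0, 0; a 0, 0, 0, 0, 0, 0; 0, 0, 0, -a 1, 0, 0; 0, 0, a 1, 0, 0, 0;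
        0, 0, 0, 0, 0, -a 2; 0, 0, 0, 0, a 2, 0] ^ 2).trace =
      -2 * (a 0 ^ 2 + a 1 ^ 2 + a 2 ^ 2) := by
  rw [sq, Matrix.trace]
  simp [Matrix.mul_apply, Fin.sum_univ_six]
  ring

theorem trace_pow_four_skewBlock (a : Fin 3 → ℝ) :
    (!![0, -a 0, 0, 0, 0, 0; a 0, 0, 0, 0, 0, 0; 0, 0, 0, -a 1, 0, 0; 0, 0, a 1, 0, 0, 0;
        0, 0, 0, 0, 0, -a 2; 0, 0, 0, 0, a 2, 0] ^ 4).trace =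
      2 * (a 0 ^ 4 + a 1 ^ 4 + a 2 ^ 4) := by
  rw [pow_succ _ 3, pow_succ _ 2, sq, Matrix.trace]
  simp [Matrix.mul_apply, Fin.sum_univ_six]
  ring

theorem tail_isOrthonormalBasisOf {e : Fin 7 → 𝔫} (he : IsOrthonormalBasisOf g ⊤ e)
    {z : Fin 1 → 𝔫} (hz : IsOrthonormalBasisOf g (derivedAlgebra 𝔫).toSubmodule z)
    (h0 : e 0 = z 0) : IsOrthonormalBasisOf g (orthoDerived g) fun i : Fin 6 => e i.succ := by
  refine IsON.isOrthonormalBasisOf (fun i k => by simp [he.1]) (fun i => ?_) ?_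
  · refine hz.mem_orthogonal_iff.2 fun k => ?_
    rw [Subsingleton.elim k 0, ← h0, he.1]
    simp [(Fin.succ_ne_zero i).symm]
  · have h1 := finrank_orthogonal_add g (derivedAlgebra 𝔫).toSubmodule
    rw [hz.finrank_eq, ← finrank_top ℝ 𝔫, he.finrank_eq] at h1
    rw [orthoDerived]
    omega

/-- The differential of the dual of the derived algebra, in adapted coordinates. -/
theorem exists_ceD_eval (hnil : IsTwoStepNilpotent 𝔫) {e : Fin 7 → 𝔫}
    (he : IsOrthonormalBasisOf g ⊤ e) {z : Fin 1 → 𝔫}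
    (hz : IsOrthonormalBasisOf g (derivedAlgebra 𝔫).toSubmodule z) (h0 : e 0 = z 0) :
    ∃ c : List ℕ → ℝ, (∀ i j, c [j, i] = bilin g (e 0) ⁅frame e i, frame e j⁆) ∧
      (∀ j, c [j, 0] = 0) ∧ ∀ F : Coeffs 7, ceD (eval (coframe g e) F) =
        eval (coframe g e) (times (gen 7 2 c) (contr 0 F)) := by
  obtain ⟨c, hc, hc'⟩ := ceD_flat_eq_eval he (e 0)
  refine ⟨c, hc', fun j => ?_, fun F => ?_⟩
  · have hmem : e 0 ∈ (derivedAlgebra 𝔫).toSubmodule := h0 ▸ hz.mem 0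
    have h1 := (bilin_lie_of_mem hnil hmem (frame e j)).1
    rw [hc', show frame e 0 = e 0 from rfl, h1, map_zero]
  · rw [ceD_eq_sum hz lie_mem_derivedAlgebra, Fin.sum_univ_one, ← h0, hc, eval_times,
      eval_contr (he.isON.coframe_frame 0 (by norm_num))]
    rfl

/-- With `e 0` spanning `𝔫'`, one has `dφ = dζ ∧ ω` and `d * φ = dζ ∧ (e 0 ⌟ * φ)`. The six
equations `d * φ = 0` say that `dζ` has type `(1, 1)`, and `dφ ∧ φ = 0` that it is primitive; these
are the hypotheses of `trace_sq_sq_eq`. -/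
theorem trace_sq_sq_of_hasPurelyCoclosedG2 (hdim : Module.finrank ℝ 𝔫 = 7)
    (hnil : IsTwoStepNilpotent 𝔫) (h1 : Module.finrank ℝ (derivedAlgebra 𝔫) = 1)
    (h : HasPurelyCoclosedG2 g) {w : 𝔫} (hw : w ∈ derivedAlgebra 𝔫) :
    LinearMap.trace ℝ (orthoDerived g) (j g w ^ 2) ^ 2 =
      4 * LinearMap.trace ℝ (orthoDerived g) (j g w ^ 4) := by
  obtain ⟨φ, vol, hG, hI, hψ, hφφ⟩ := h
  obtain ⟨z, hz⟩ := exists_isOrthonormalBasisOf g (W := (derivedAlgebra 𝔫).toSubmodule) h1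
  obtain ⟨v, -, hvv, hv⟩ := hz.isON.exists_unit (W := ⊤) (fun _ => trivial)
    (by rw [finrank_top, hdim]; norm_num)
  obtain ⟨e, he, he0, -, -, hφ, hvol⟩ := hI.exists_adapted_of_pair hG.1 hdim
    (by simpa using hz.1 0 0) hvv (hv 0)
  obtain ⟨c, hc, hc0, hd⟩ := exists_ceD_eval hnil he hz he0
  obtain ⟨F, hF⟩ : ∃ F, F = stdForm := ⟨_, rfl⟩
  obtain ⟨G, hG'⟩ : ∃ G, G = stdDual := ⟨_, rfl⟩
  rw [hφ, hvol, hodge_stdForm he.isON, ← hG', hd, eval_eq_zero_iff he.isON.coframe_frame] at hψ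
  rw [hφ, ← hF, hd, ← eval_times, eval_eq_zero_iff he.isON.coframe_frame] at hφφ
  simp only [hG', stdDual, gen, mk, contr, times, plus, scale, opp, invol, plusScalar, IsZero,
    reduceIte, Nat.reduceEqDiff, OfNat.ofNat_ne_zero, OfNat.zero_ne_ofNat, Nat.zero_ne_one,
    OfNat.one_ne_ofNat, OfNat.ofNat_ne_one, zero_ne_one, true_and, and_true, hc0,
    neg_zero, zero_mul, neg_neg] at hψ
  simp only [hF, stdForm, gen, mk, contr, times, plus, scale, opp, invol, plusScalar, IsZero,
    reduceIte, Nat.reduceEqDiff, OfNat.ofNat_ne_zero, OfNat.zero_ne_ofNat, Nat.zero_ne_one,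
    OfNat.one_ne_ofNat, OfNat.ofNat_ne_one, zero_ne_one, true_and, and_true, hc0,
    neg_zero, zero_mul, neg_neg] at hφφ
  have hb := tail_isOrthonormalBasisOf he hz he0
  rw [trace_pow_eq hb, trace_pow_eq hb]
  obtain ⟨t, rfl⟩ : ∃ t : ℝ, w = t • e 0 :=
    ⟨_, by rw [he0]; simpa using (hz.sum_eq hw).symm⟩
  -- Indices are shifted by one because the basis of `𝔯` starts at `e 1`.
  have hM : ∀ i k : Fin 6, (Matrix.of fun i k => bilin g (e i.succ)
      (j g (t • e 0) ⟨e k.succ, hb.mem k⟩ : orthoDerived g)) i k =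
      t * c [(i : ℕ) + 1, (k : ℕ) + 1] := fun i k => by
    rw [Matrix.of_apply, bilin_j_eq _ (hb.mem k) (hb.mem i), hc, map_smul, LinearMap.smul_apply,
      frame_of_lt e (by omega), frame_of_lt e (by omega)]
    rfl
  have hskew : ∀ i k, c [i, k] = -c [k, i] := fun i k => by
    rw [hc, hc, ← lie_skew, map_neg]
  obtain ⟨g1, g2, g3, g4, g5, g6⟩ := hψ
  refine trace_sq_sq_eq (fun i k => ?_) ?_ ?_ ?_ ?_ ?_ ?_ ?_ <;> simp only [hM]
  · rw [hskew, mul_neg]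
  · change t * c [1, 3] = t * c [2, 4]
    rw [hskew 1 3, hskew 2 4]
    linear_combination -t * g2
  · change t * c [1, 4] = -(t * c [2, 3])
    rw [hskew 1 4, hskew 2 3]
    linear_combination -t * g1
  · change t * c [1, 5] = t * c [2, 6]
    rw [hskew 1 5, hskew 2 6]
    linear_combination t * g4
  · change t * c [1, 6] = -(t * c [2, 5])
    rw [hskew 1 6, hskew 2 5]
    linear_combination t * g3
  · change t * c [3, 5] = t * c [4, 6]
    rw [hskew 3 5, hskew 4 6]
    linear_combination -t * g6
  · change t * c [3, 6] = -(t * c [4, 5])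
    rw [hskew 3 6, hskew 4 5]
    linear_combination -t * g5
  · change t * c [1, 2] + t * c [3, 4] + t * c [5, 6] = 0
    rw [hskew 1 2, hskew 3 4, hskew 5 6]
    linear_combination -t * hφφ / 2

/-- The model form in the basis `z, u₀, v₀, u₁, v₁, u₂, v₂` works: a combination of the planes `uᵢ♭
∧ vᵢ♭` always has type `(1, 1)`, and it is primitive exactly when its coefficients sum to zero. -/
theorem hasPurelyCoclosedG2_of_skew_normal_form (hdim : Module.finrank ℝ 𝔫 = 7)
    (hnil : IsTwoStepNilpotent 𝔫) {z : Fin 1 → 𝔫}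
    (hz : IsOrthonormalBasisOf g (derivedAlgebra 𝔫).toSubmodule z) {u v : Fin 3 → 𝔫}
    {a : Fin 3 → ℝ} (huW : ∀ i, u i ∈ orthoDerived g) (hvW : ∀ i, v i ∈ orthoDerived g)
    (hu : IsON g u) (hv : IsON g v) (huv : ∀ i k, bilin g (u i) (v k) = 0)
    (h : ∀ i, ∀ x ∈ orthoDerived g, bilin g (z 0) ⁅u i, x⁆ = a i * bilin g (v i) x ∧
      bilin g (z 0) ⁅v i, x⁆ = -(a i * bilin g (u i) x)) (ha : a 0 + a 1 + a 2 = 0) :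
    HasPurelyCoclosedG2 g := by
  have hzz : bilin g (z 0) (z 0) = 1 := by simpa using hz.1 0 0
  have hzu : ∀ i, bilin g (z 0) (u i) = 0 := fun i => hz.mem_orthogonal_iff.1 (huW i) 0
  have hzv : ∀ i, bilin g (z 0) (v i) = 0 := fun i => hz.mem_orthogonal_iff.1 (hvW i) 0
  have hvu : ∀ i k, bilin g (v i) (u k) = 0 := fun i k => by rw [bilin_comm, huv]
  obtain ⟨e, hedef⟩ : ∃ e : Fin 7 → 𝔫, e = ![z 0, u 0, v 0, u 1, v 1, u 2, v 2] := ⟨_, rfl⟩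
  have heON : IsON g e := by
    rw [hedef]
    intro i k
    fin_cases i <;> fin_cases k <;>
      simp [hzz, hzu, hzv, hu _ _, hv _ _, huv, hvu, bilin_comm g _ (z 0)]
  have he := heON.isOrthonormalBasisOf_top hdim
  have f0 : e 0 = z 0 := by rw [hedef]; rfl
  have f1 : frame e 1 = u 0 := by rw [hedef]; rfl
  have f2 : frame e 2 = v 0 := by rw [hedef]; rfl
  have f3 : frame e 3 = u 1 := by rw [hedef]; rfl
  have f4 : frame e 4 = v 1 := by rw [hedef]; rfl
  have f5 : frame e 5 = u 2 := by rw [hedef]; rfl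
  have f6 : frame e 6 = v 2 := by rw [hedef]; rfl
  obtain ⟨c, hc, hc0, hd⟩ := exists_ceD_eval hnil he hz f0
  have huu' : ∀ i k, bilin g (z 0) ⁅u i, u k⁆ = 0 := fun i k => by
    rw [(h i _ (huW k)).1, hvu, mul_zero]
  have hvv' : ∀ i k, bilin g (z 0) ⁅v i, v k⁆ = 0 := fun i k => by
    rw [(h i _ (hvW k)).2, huv, mul_zero, neg_zero]
  have huv' : ∀ i k, bilin g (z 0) ⁅u i, v k⁆ = if i = k then a i else 0 := fun i k => by
    rw [(h i _ (hvW k)).1, hv i k]; split_ifs <;> simp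
  have hvu' : ∀ i k, bilin g (z 0) ⁅v i, u k⁆ = if i = k then -a i else 0 := fun i k => by
    rw [(h i _ (huW k)).2, hu i k]; split_ifs <;> simp
  rw [f0] at hc
  refine ⟨_, _, isG2Structure_stdForm he, induces_stdForm he, ?_, ?_⟩
  · rw [hodge_stdForm heON, hd, eval_eq_zero_iff heON.coframe_frame]
    simp [stdDual, gen, mk, contr, times, plus, scale, opp, invol, plusScalar, IsZero, hc0, hc,
      f1, f2, f3, f4, f5, f6, huu', hvv', huv', hvu']
  · rw [hd, ← eval_times, eval_eq_zero_iff heON.coframe_frame]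
    simp only [stdForm, gen, mk, contr, times, plus, scale, opp, invol, plusScalar, IsZero, hc0,
      hc, f1, f2, f3, f4, f5, f6, huu', hvv', huv', hvu', reduceIte, Nat.reduceEqDiff,
      OfNat.ofNat_ne_zero, OfNat.zero_ne_ofNat, Nat.zero_ne_one, OfNat.one_ne_ofNat,
      OfNat.ofNat_ne_one, zero_ne_one, true_and, and_true, Fin.isValue]
    linear_combination 2 * ha

/-- Heron's factorization. -/
theorem exists_signed_sum_eq_zero {a b c : ℝ}
    (h : (a ^ 2 + b ^ 2 + c ^ 2) ^ 2 = 2 * (a ^ 4 + b ^ 4 + c ^ 4)) :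
    ∃ s t : ℝ, (s = 1 ∨ s = -1) ∧ (t = 1 ∨ t = -1) ∧ a + s * b + t * c = 0 := by
  have h1 : (a + b + c) * (a + b - c) * ((a - b + c) * (a - b - c)) = 0 := by
    linear_combination -h
  rcases mul_eq_zero.1 h1 with h1 | h1 <;> rcases mul_eq_zero.1 h1 with h1 | h1
  · exact ⟨1, 1, by simp, by simp, by linarith⟩
  · exact ⟨1, -1, by simp, by simp, by linarith⟩
  · exact ⟨-1, 1, by simp, by simp, by linarith⟩
  · exact ⟨-1, -1, by simp, by simp, by linarith⟩

theorem hasPurelyCoclosedG2_of_trace (hdim : Module.finrank ℝ 𝔫 = 7)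
    (hnil : IsTwoStepNilpotent 𝔫) (h1 : Module.finrank ℝ (derivedAlgebra 𝔫) = 1)
    (h : ∀ z ∈ derivedAlgebra 𝔫, LinearMap.trace ℝ (orthoDerived g) (j g z ^ 2) ^ 2 =
      4 * LinearMap.trace ℝ (orthoDerived g) (j g z ^ 4)) : HasPurelyCoclosedG2 g := by
  obtain ⟨z, hz⟩ := exists_isOrthonormalBasisOf g (W := (derivedAlgebra 𝔫).toSubmodule) h1
  have hW : Module.finrank ℝ (orthoDerived g) = 2 * 3 := by
    have := finrank_orthogonal_add g (derivedAlgebra 𝔫).toSubmodule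
    rw [hz.finrank_eq, hdim] at this
    rw [orthoDerived]
    omega
  let ω : LinearMap.BilinForm ℝ 𝔫 := LinearMap.mk₂ ℝ (fun x y => bilin g (z 0) ⁅x, y⁆)
    (fun _ _ _ => by simp) (fun _ _ _ => by simp) (fun _ _ _ => by simp) (fun _ _ _ => by simp)
  have hω' : ∀ x y, ω x y = bilin g (z 0) ⁅x, y⁆ := fun _ _ => rfl
  obtain ⟨u, v, a, huW, hvW, hu, hv, huv, hω⟩ := exists_skew_normal_form g ω
    (fun x => by simp [hω']) 3 hW
  simp only [hω'] at hω
  have hvu : ∀ i k, bilin g (v i) (u k) = 0 := fun i k => by rw [bilin_comm, huv]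
  have hON : IsON (ι := Fin 6) g ![u 0, v 0, u 1, v 1, u 2, v 2] := by
    intro i k
    fin_cases i <;> fin_cases k <;> simp [hu _ _, hv _ _, huv, hvu]
  have hb : IsOrthonormalBasisOf (k := 6) g (orthoDerived g) ![u 0, v 0, u 1, v 1, u 2, v 2] :=
    hON.isOrthonormalBasisOf (fun i => by fin_cases i <;> simp [huW, hvW]) hW
  have h2 := h (z 0) (hz.mem 0)
  have huu' : ∀ i k, bilin g (z 0) ⁅u i, u k⁆ = 0 := fun i k => by
    rw [(hω i _ (huW k)).1, hvu, mul_zero]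
  have hvv' : ∀ i k, bilin g (z 0) ⁅v i, v k⁆ = 0 := fun i k => by
    rw [(hω i _ (hvW k)).2, huv, mul_zero, neg_zero]
  have huv' : ∀ i k, bilin g (z 0) ⁅u i, v k⁆ = if i = k then a i else 0 := fun i k => by
    rw [(hω i _ (hvW k)).1, hv i k]; split_ifs <;> simp
  have hvu' : ∀ i k, bilin g (z 0) ⁅v i, u k⁆ = if i = k then -a i else 0 := fun i k => by
    rw [(hω i _ (huW k)).2, hu i k]; split_ifs <;> simp
  have hM : (Matrix.of fun i k => bilin g ((![u 0, v 0, u 1, v 1, u 2, v 2] : Fin 6 → 𝔫) i)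
      (j g (z 0) ⟨(![u 0, v 0, u 1, v 1, u 2, v 2] : Fin 6 → 𝔫) k, hb.mem k⟩ : orthoDerived g)) =
      !![0, -a 0, 0, 0, 0, 0; a 0, 0, 0, 0, 0, 0; 0, 0, 0, -a 1, 0, 0; 0, 0, a 1, 0, 0, 0;
        0, 0, 0, 0, 0, -a 2; 0, 0, 0, 0, a 2, 0] := by
    ext i k
    rw [Matrix.of_apply, bilin_j_eq _ (hb.mem k) (hb.mem i)]
    fin_cases i <;> fin_cases k <;> simp [huu', hvv', huv', hvu']
  rw [trace_pow_eq hb, trace_pow_eq hb, hM, trace_sq_skewBlock, trace_pow_four_skewBlock] at h2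
  -- The traces are `-2 ∑ aₖ²` and `2 ∑ aₖ⁴`, so the hypothesis is Heron's relation. Replacing `v i`
  -- by `-v i` changes the sign of `a i`, so the signs can be realized by a change of basis.
  obtain ⟨s, t, hs, ht, hst⟩ := exists_signed_sum_eq_zero (a := a 0) (b := a 1) (c := a 2)
    (by linear_combination h2 / 4)
  let ε : Fin 3 → ℝ := ![1, s, t]
  have hε : ∀ i, ε i = 1 ∨ ε i = -1 := by
    intro i
    fin_cases i
    · exact Or.inl rfl
    · exact hs
    · exact ht
  refine hasPurelyCoclosedG2_of_skew_normal_form hdim hnil hz (u := u)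
    (v := fun i => ε i • v i) (a := fun i => ε i * a i) huW
    (fun i => Submodule.smul_mem _ _ (hvW i)) hu (fun i k => ?_)
    (fun i k => by rw [map_smul, huv, smul_zero]) (fun i x hx => ⟨?_, ?_⟩)
    (by simpa [ε] using hst)
  · simp only [map_smul, LinearMap.smul_apply, hv i k, smul_eq_mul]
    split_ifs with hik
    · subst hik
      rcases hε i with h | h <;> simp [h]
    · simp
  · rw [(hω i x hx).1, map_smul, LinearMap.smul_apply, smul_eq_mul]
    rcases hε i with h | h <;> simp [h]
  · rw [smul_lie, map_smul, (hω i x hx).2, smul_eq_mul]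
    ring

end RankOne

/-! ### Frames with three central vectors, and self-dual components. -/

section Central

variable {𝔫 : Type*} [LieRing 𝔫] [LieAlgebra ℝ 𝔫]

/-- An orthonormal basis whose first three vectors are central and span a subspace that contains
the derived algebra. -/
structure IsCentralFrame (g : InnerProductSpace.Core ℝ 𝔫) (e : Fin 7 → 𝔫) : Prop where
  basis : IsOrthonormalBasisOf g ⊤ e
  central : ∀ i < 3, ∀ y : 𝔫, ⁅frame e i, y⁆ = 0
  orthogonal : ∀ i, 3 ≤ i → ∀ x y : 𝔫, bilin g (frame e i) ⁅x, y⁆ = 0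

/-- The coordinates, up to a common factor, of the self-dual component of `d z♭` on the span of the
last four vectors of a central frame. -/
def sdCoord (g : InnerProductSpace.Core ℝ 𝔫) (e : Fin 7 → 𝔫) (z : 𝔫) : Fin 3 → ℝ :=
  ![bilin g z ⁅e 3, e 4⁆ + bilin g z ⁅e 5, e 6⁆, bilin g z ⁅e 3, e 5⁆ - bilin g z ⁅e 4, e 6⁆,
    -(bilin g z ⁅e 3, e 6⁆ + bilin g z ⁅e 4, e 5⁆)]

theorem sdCoord_add (g : InnerProductSpace.Core ℝ 𝔫) (e : Fin 7 → 𝔫) (z w : 𝔫) :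
    sdCoord g e (z + w) = sdCoord g e z + sdCoord g e w := by
  ext k
  fin_cases k <;> simp [sdCoord] <;> ring

theorem sdCoord_smul (g : InnerProductSpace.Core ℝ 𝔫) (e : Fin 7 → 𝔫) (r : ℝ) (z : 𝔫) :
    sdCoord g e (r • z) = r • sdCoord g e z := by
  ext k
  fin_cases k <;> simp [sdCoord] <;> ring

/-- The coordinates of the self-dual components for the first three vectors of a frame. -/
def sdMatrix (g : InnerProductSpace.Core ℝ 𝔫) (e : Fin 7 → 𝔫) : Matrix (Fin 3) (Fin 3) ℝ :=
  Matrix.of fun a => sdCoord g e (frame e a)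

variable [FiniteDimensional ℝ 𝔫] {g : InnerProductSpace.Core ℝ 𝔫} {e : Fin 7 → 𝔫}

/-- The `2`-form `∑ b i j θⱼ ∧ θᵢ`, the sum being over `3 ≤ i < j ≤ 6`. -/
def tailForm (b : ℕ → ℕ → ℝ) : Coeffs 7 :=
  node (node (node zero (node zero (scalar (b 3 4))))
      (node (node zero (scalar (b 3 5))) (scalar (b 4 5))))
    (node (node (node zero (scalar (b 3 6))) (scalar (b 4 6))) (scalar (b 5 6)))

theorem IsCentralFrame.ceD_flat (he : IsCentralFrame g e) (z : 𝔫) :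
    ceD (flat g z) = eval (coframe g e)
      (tailForm fun i j => bilin g z ⁅frame e i, frame e j⁆) := by
  obtain ⟨c, h1, h2⟩ := ceD_flat_eq_eval he.basis z
  have k : ∀ i < 3, ∀ j, c [j, i] = 0 := fun i hi j => by rw [h2, he.central i hi, map_zero]
  have k0 := k 0 (by norm_num)
  have k1 := k 1 (by norm_num)
  have k2 := k 2 (by norm_num)
  rw [h1]
  simp [gen, Coeffs.mk, eval, tailForm, k0, k1, k2, ← h2]

theorem IsCentralFrame.ceD_flat_eq_zero (he : IsCentralFrame g e) {i : ℕ} (hi : 3 ≤ i) :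
    ceD (flat g (frame e i)) = 0 := by
  rw [he.ceD_flat]
  simp [he.orthogonal i hi, tailForm, eval]

theorem IsCentralFrame.ceD_eval (he : IsCentralFrame g e) (F : Coeffs 7) :
    ceD (eval (coframe g e) F) = eval (coframe g e)
      (plus (plus
        (times (tailForm fun i j => bilin g (e 0) ⁅frame e i, frame e j⁆) (contr 0 F))
        (times (tailForm fun i j => bilin g (e 1) ⁅frame e i, frame e j⁆) (contr 1 F)))
        (times (tailForm fun i j => bilin g (e 2) ⁅frame e i, frame e j⁆) (contr 2 F))) := by
  have h3 : ceD (flat g (e 3)) = 0 := he.ceD_flat_eq_zero (i := 3) (by norm_num)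
  have h4 : ceD (flat g (e 4)) = 0 := he.ceD_flat_eq_zero (i := 4) (by norm_num)
  have h5 : ceD (flat g (e 5)) = 0 := he.ceD_flat_eq_zero (i := 5) (by norm_num)
  have h6 : ceD (flat g (e 6)) = 0 := he.ceD_flat_eq_zero (i := 6) (by norm_num)
  have h := fun i hi => eval_contr (he.basis.isON.coframe_frame i hi) F
  rw [ceD_eq_sum he.basis fun _ _ => trivial, Fin.sum_univ_seven, h3, h4, h5, h6, eval_plus,
    eval_plus, eval_times, eval_times, eval_times, h 0 (by norm_num), h 1 (by norm_num),
    h 2 (by norm_num), ← he.ceD_flat, ← he.ceD_flat, ← he.ceD_flat]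
  simp only [zero_mul, add_zero]
  rfl

/-- For `φ = θ₀₁₂ + ∑ θₐ ∧ ωₐ`, the dual form is the volume form of the last four vectors, which is
closed, plus terms `± θₐ ∧ θ_b ∧ ω_c`. As only `dθ₀, dθ₁, dθ₂` are nonzero, the coefficients of `d *
φ` are differences of opposite entries of `sdMatrix`, and `dφ ∧ φ` is a multiple of its trace. -/
theorem IsCentralFrame.hasPurelyCoclosedG2 (he : IsCentralFrame g e)
    (hs : (sdMatrix g e).IsSymm) (ht : (sdMatrix g e).trace = 0) : HasPurelyCoclosedG2 g := by
  have hON := he.basis.isON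
  obtain ⟨b0, h0⟩ : ∃ b : ℕ → ℕ → ℝ, ∀ i j, bilin g (e 0) ⁅frame e i, frame e j⁆ = b i j :=
    ⟨_, fun _ _ => rfl⟩
  obtain ⟨b1, h1⟩ : ∃ b : ℕ → ℕ → ℝ, ∀ i j, bilin g (e 1) ⁅frame e i, frame e j⁆ = b i j :=
    ⟨_, fun _ _ => rfl⟩
  obtain ⟨b2, h2⟩ : ∃ b : ℕ → ℕ → ℝ, ∀ i j, bilin g (e 2) ⁅frame e i, frame e j⁆ = b i j :=
    ⟨_, fun _ _ => rfl⟩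
  have hd := he.ceD_eval
  simp only [h0, h1, h2] at hd
  have s01 : sdMatrix g e 1 0 = sdMatrix g e 0 1 := hs.apply 0 1
  have s02 : sdMatrix g e 2 0 = sdMatrix g e 0 2 := hs.apply 0 2
  have s12 : sdMatrix g e 2 1 = sdMatrix g e 1 2 := hs.apply 1 2
  rw [Matrix.trace_fin_three] at ht
  simp only [sdMatrix, sdCoord, Matrix.of_apply, Matrix.cons_val] at s01 s02 s12 ht
  have f0 : frame e ((0 : Fin 3) : ℕ) = e 0 := rfl
  have f1 : frame e ((1 : Fin 3) : ℕ) = e 1 := rfl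
  have f2 : frame e ((2 : Fin 3) : ℕ) = e 2 := rfl
  have f3 : e 3 = frame e 3 := rfl
  have f4 : e 4 = frame e 4 := rfl
  have f5 : e 5 = frame e 5 := rfl
  have f6 : e 6 = frame e 6 := rfl
  simp only [f0, f1, f2, f3, f4, f5, f6, h0, h1, h2] at s01 s02 s12 ht
  refine ⟨_, _, isG2Structure_stdForm he.basis, induces_stdForm he.basis, ?_, ?_⟩
  · rw [hodge_stdForm hON, hd, eval_eq_zero_iff hON.coframe_frame]
    simp only [stdDual, tailForm, gen, Coeffs.mk, contr, times, plus, scale, opp, invol, plusScalar,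
      IsZero, reduceIte, Nat.reduceEqDiff, OfNat.ofNat_ne_zero, OfNat.zero_ne_ofNat,
      Nat.zero_ne_one, OfNat.one_ne_ofNat, OfNat.ofNat_ne_one, zero_ne_one, one_ne_zero, true_and,
      and_true, and_assoc]
    constructorm* _ ∧ _ <;> linarith
  · rw [hd, ← eval_times, eval_eq_zero_iff hON.coframe_frame]
    simp only [stdForm, tailForm, gen, Coeffs.mk, contr, times, plus, scale, opp, invol, plusScalar,
      IsZero, reduceIte, Nat.reduceEqDiff, OfNat.ofNat_ne_zero, OfNat.zero_ne_ofNat,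
      Nat.zero_ne_one, OfNat.one_ne_ofNat, OfNat.ofNat_ne_one, zero_ne_one, one_ne_zero, true_and,
      and_true]
    linarith

/-- Reversing four covectors is an even permutation, so here the coefficient is `+1`. -/
theorem ιMulti_four_eq_eval (e : Fin 7 → 𝔫) :
    ExteriorAlgebra.ιMulti ℝ 4 (fun i : Fin 4 => bilin g (e (Fin.natAdd 3 i))) =
      eval (coframe g e) (node (node (node (node (node (node (node zero zero) zero) zero) zero)
        zero) zero) (node zero (node zero (node zero (scalar 1)))) : Coeffs 7) := by
  have h := fun i => oneForm_bilin_eq_eval (g := g) e i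
  simp only [oneForm] at h
  rw [ExteriorAlgebra.ιMulti_apply]
  simp only [List.ofFn_succ, List.ofFn_zero, List.prod_cons, List.prod_nil, h, mul_one,
    ← eval_times]
  simp [covec, Coeffs.mk, times, plus, plusScalar, scale, opp, invol, eval]

/-- The forms `θ₃₄ + θ₅₆`, `θ₃₅ - θ₄₆`, `-(θ₃₆ + θ₄₅)` are self-dual, orthogonal and of squared norm
`2`. The component of `d z♭` along each is `-1/2` times the corresponding entry of `sdCoord`, whence
the factor `1/2`. -/
theorem IsCentralFrame.formInner_selfDual (he : IsCentralFrame g e) (z w : 𝔫) :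
    formInner g (selfDual g (ExteriorAlgebra.ιMulti ℝ 4 fun i : Fin 4 =>
        bilin g (e (Fin.natAdd 3 i))) (ceD (flat g z)))
      (selfDual g (ExteriorAlgebra.ιMulti ℝ 4 fun i : Fin 4 =>
        bilin g (e (Fin.natAdd 3 i))) (ceD (flat g w))) =
      (1 / 2) * ∑ k, sdCoord g e z k * sdCoord g e w k := by
  have hON := he.basis.isON
  rw [he.ceD_flat, he.ceD_flat, ιMulti_four_eq_eval, selfDual, selfDual, hodge, hodge,
    ← eval_contrForm_coframe hON, ← eval_contrForm_coframe hON, ← eval_plus, ← eval_plus,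
    ← eval_scale, ← eval_scale, formInner, ← eval_contrForm_coframe hON, algebraMapInv_eval]
  have f3 : e 3 = frame e 3 := rfl
  have f4 : e 4 = frame e 4 := rfl
  have f5 : e 5 = frame e 5 := rfl
  have f6 : e 6 = frame e 6 := rfl
  simp only [sdCoord, Fin.sum_univ_three, f3, f4, f5, f6, Matrix.cons_val]
  simp only [tailForm, Coeffs.mk, contr, contrForm, const, times, plus, scale, opp, invol, plusScalar,
      reduceIte, Nat.reduceEqDiff, OfNat.ofNat_ne_zero, OfNat.zero_ne_ofNat, Nat.zero_ne_one,
      OfNat.one_ne_ofNat, OfNat.ofNat_ne_one, zero_ne_one, one_ne_zero]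
  ring

theorem IsCentralFrame.ceD_flat_mem_formsOn (he : IsCentralFrame g e) {W : Submodule ℝ 𝔫}
    (hW : ∀ i : Fin 4, e (Fin.natAdd 3 i) ∈ W) (z : 𝔫) : ceD (flat g z) ∈ formsOn g W 2 := by
  have hmem : ∀ (r : ℝ) (i k : Fin 4),
      oneForm (coframe g e (3 + i)) * (oneForm (coframe g e (3 + k)) * algebraMap ℝ _ r) ∈
        formsOn g W 2 := fun r i k => by
    rw [← Algebra.commutes, ← Algebra.smul_def, mul_smul_comm]
    refine Submodule.smul_mem _ _ (Submodule.subset_span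
      ⟨![e (Fin.natAdd 3 i), e (Fin.natAdd 3 k)], fun l => ?_, ?_⟩)
    · fin_cases l
      · exact hW i
      · exact hW k
    · rw [ExteriorAlgebra.ιMulti_apply]
      simp only [List.ofFn_succ, List.ofFn_zero, List.prod_cons, List.prod_nil, mul_one]
      rw [coframe, coframe, frame_of_lt e (by omega), frame_of_lt e (by omega)]
      rfl
  rw [he.ceD_flat]
  simp only [tailForm, eval, mul_zero, add_zero, zero_add, mul_add]
  exact Submodule.add_mem _ (Submodule.add_mem _ (hmem _ 1 0)
    (Submodule.add_mem _ (hmem _ 2 0) (hmem _ 2 1)))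
    (Submodule.add_mem _ (Submodule.add_mem _ (hmem _ 3 0) (hmem _ 3 1)) (hmem _ 3 2))

/-- Contraction with a vector orthogonal to `W` annihilates `Λ² W*`. In dimension two, this makes
the direction of `𝔯` left over by `W` central. -/
theorem bilin_lie_eq_zero_of_mem_formsOn {W : Submodule ℝ 𝔫} {z : 𝔫}
    (hz : ceD (flat g z) ∈ formsOn g W 2) {x : 𝔫} (hx : x ∈ (bilin g).orthogonal W) (y : 𝔫) :
    bilin g z ⁅x, y⁆ = 0 := by
  have h : ∀ ω ∈ formsOn g W 2, interior x ω = 0 := fun ω hω => by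
    refine Submodule.span_induction ?_ (map_zero _) (fun _ _ _ _ h1 h2 => by
      rw [map_add, h1, h2, add_zero]) (fun r _ _ h1 => by rw [map_smul, h1, smul_zero]) hω
    rintro _ ⟨w, hw, rfl⟩
    rw [ExteriorAlgebra.ιMulti_apply]
    simp only [List.ofFn_succ, List.ofFn_zero, List.prod_cons, List.prod_nil, mul_one]
    change interior x (oneForm _ * oneForm _) = 0
    rw [interior_oneForm_mul, interior_oneForm, show bilin g (w 0) x = 0 from hx _ (hw 0)]
    rw [show bilin g (w (Fin.succ 0)) x = 0 from hx _ (hw _)]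
    simp
  have h1 := ceD_oneForm_apply (bilin g z) x y
  rw [show ceD (oneForm (bilin g z)) = ceD (flat g z) from rfl, h _ hz, map_zero] at h1
  have h2 := (ExteriorAlgebra.algebraMap_leftInverse (R := ℝ) (Module.Dual ℝ 𝔫)).injective
    (h1.symm.trans (map_zero _).symm)
  linarith

end Central

/-! ### Polar decomposition with signed singular values. -/

section Polar

open Matrix

/-- A matrix with orthogonal columns of lengths `|d k|` is the product of an orthogonal matrix and
of the diagonal matrix `d`. -/
theorem exists_orthogonal_mul_diagonal {B : Matrix (Fin 3) (Fin 3) ℝ} {d : Fin 3 → ℝ}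
    (h : Bᵀ * B = diagonal fun k => d k ^ 2) :
    ∃ Q : Matrix (Fin 3) (Fin 3) ℝ, Qᵀ * Q = 1 ∧ B = Q * diagonal d := by
  have hB : ∀ i k, ∑ l, B l i * B l k = if i = k then d i ^ 2 else 0 := fun i k => by
    have := congrFun (congrFun h i) k
    rwa [mul_apply, diagonal_apply] at this
  -- The columns with `d k ≠ 0`, divided by `d k`, are orthonormal. Those with `d k = 0` vanish, so
  -- any completion to an orthonormal basis supplies the missing columns of `Q`.
  let v : Fin 3 → EuclideanSpace ℝ (Fin 3) := fun k => WithLp.toLp 2 fun l => (d k)⁻¹ * B l k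
  have hv : Orthonormal ℝ (Set.domRestrict {k | d k ≠ 0} v) := by
    rw [orthonormal_iff_ite]
    rintro ⟨i, hi⟩ ⟨k, hk⟩
    have h1 : inner ℝ (v i) (v k) = (d i)⁻¹ * (d k)⁻¹ * ∑ l, B l i * B l k := by
      rw [PiLp.inner_apply, Finset.mul_sum]
      refine Finset.sum_congr rfl fun l _ => ?_
      simp [v]
      ring
    change inner ℝ (v i) (v k) = _
    simp only [Subtype.mk.injEq, h1, hB]
    split_ifs with hik
    · subst hik
      have : d i ≠ 0 := hi
      field_simp
    · simp
  obtain ⟨b, hb⟩ := hv.exists_orthonormalBasis_extension_of_card_eq (by simp)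
  refine ⟨of fun l k => b k l, ?_, ?_⟩
  · ext i k
    have h1 := orthonormal_iff_ite.1 b.orthonormal i k
    rw [PiLp.inner_apply] at h1
    rw [mul_apply, one_apply, ← h1]
    exact Finset.sum_congr rfl fun l _ => by simp [mul_comm]
  · ext l k
    rw [mul_diagonal, of_apply]
    by_cases hk : d k = 0
    · have h1 := hB k k
      rw [if_pos rfl, hk, zero_pow two_ne_zero,
        Finset.sum_eq_zero_iff_of_nonneg fun l _ => mul_self_nonneg _] at h1
      rw [hk, mul_zero]
      exact mul_self_eq_zero.1 (h1 l (Finset.mem_univ l))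
    · rw [hb k hk]
      simp only [v]
      field_simp

/-- A matrix `A` with `(tr A Aᵀ)² = 2 tr (A Aᵀ)²` is the product of an orthogonal matrix and of
a symmetric trace-free one. -/
theorem exists_orthogonal_isSymm_trace_eq_zero {A : Matrix (Fin 3) (Fin 3) ℝ}
    (h : (A * Aᵀ).trace ^ 2 = 2 * ((A * Aᵀ) ^ 2).trace) :
    ∃ R : Matrix (Fin 3) (Fin 3) ℝ, Rᵀ * R = 1 ∧ (Rᵀ * A).IsSymm ∧ (Rᵀ * A).trace = 0 := by
  have hA : (Aᵀ * A).IsHermitian := by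
    simpa [conjTranspose_eq_transpose_of_trivial] using isHermitian_conjTranspose_mul_self A
  have hpos : (Aᵀ * A).PosSemidef := by
    simpa [conjTranspose_eq_transpose_of_trivial] using posSemidef_conjTranspose_mul_self A
  obtain ⟨U, hUdef⟩ : ∃ U : Matrix (Fin 3) (Fin 3) ℝ, U = hA.eigenvectorUnitary := ⟨_, rfl⟩
  obtain ⟨μ, hμdef⟩ : ∃ μ : Fin 3 → ℝ, μ = hA.eigenvalues := ⟨_, rfl⟩
  have hμ : ∀ k, 0 ≤ μ k := fun k => by rw [hμdef]; exact hpos.eigenvalues_nonneg k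
  have hU : Uᵀ * U = 1 := by
    have := Unitary.coe_star_mul_self hA.eigenvectorUnitary
    rwa [star_eq_conjTranspose, conjTranspose_eq_transpose_of_trivial, ← hUdef] at this
  have hU' : U * Uᵀ = 1 := mul_eq_one_comm.1 hU
  have hspec : Aᵀ * A = U * diagonal μ * Uᵀ := by
    have := hA.spectral_theorem
    rw [Unitary.conjStarAlgAut_apply] at this
    simpa [← hUdef, hμdef, star_eq_conjTranspose, conjTranspose_eq_transpose_of_trivial,
      Function.comp_def] using this
  have htr : (A * Aᵀ).trace = ∑ k, μ k := by
    rw [trace_mul_comm, hspec, trace_mul_comm, ← mul_assoc, hU, one_mul, trace_diagonal]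
  have htr2 : ((A * Aᵀ) ^ 2).trace = ∑ k, μ k ^ 2 := by
    have h1 : ((A * Aᵀ) ^ 2).trace = ((Aᵀ * A) * (Aᵀ * A)).trace := by
      rw [sq, mul_assoc, trace_mul_comm]
      simp only [mul_assoc]
    rw [h1, hspec, show U * diagonal μ * Uᵀ * (U * diagonal μ * Uᵀ) =
      U * (diagonal μ * (Uᵀ * U) * diagonal μ) * Uᵀ by simp only [mul_assoc], hU, mul_one,
      trace_mul_comm, ← mul_assoc, hU, one_mul, diagonal_mul_diagonal, trace_diagonal]
    exact Finset.sum_congr rfl fun k _ => (sq _).symm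
  have hsq : ∀ k, Real.sqrt (μ k) ^ 2 = μ k := fun k => Real.sq_sqrt (hμ k)
  have hsq4 : ∀ k, Real.sqrt (μ k) ^ 4 = μ k ^ 2 := fun k => by
    rw [show 4 = 2 * 2 by norm_num, pow_mul, hsq]
  rw [htr, htr2, Fin.sum_univ_three, Fin.sum_univ_three] at h
  -- The hypothesis is Heron's relation for the singular values `√μₖ`. The signed values `d` sum to
  -- zero, at the price that the symmetric factor is not positive.
  obtain ⟨s, t, hs, ht, hst⟩ := exists_signed_sum_eq_zero (a := Real.sqrt (μ 0))
    (b := Real.sqrt (μ 1)) (c := Real.sqrt (μ 2)) (by simpa only [hsq, hsq4] using h)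
  obtain ⟨d, hd, hd0⟩ : ∃ d : Fin 3 → ℝ, (∀ k, d k ^ 2 = μ k) ∧ d 0 + d 1 + d 2 = 0 := by
    refine ⟨![Real.sqrt (μ 0), s * Real.sqrt (μ 1), t * Real.sqrt (μ 2)], fun k => ?_, hst⟩
    fin_cases k
    · exact hsq 0
    · rcases hs with rfl | rfl <;> simp [hsq]
    · rcases ht with rfl | rfl <;> simp [hsq]
  obtain ⟨Q, hQ, hAU⟩ := exists_orthogonal_mul_diagonal (B := A * U) (d := d) (by
    simp only [hd]
    rw [transpose_mul, mul_assoc, ← mul_assoc Aᵀ, hspec, mul_assoc _ Uᵀ, hU, mul_one,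
      ← mul_assoc, hU, one_mul])
  -- From `A = Q d Uᵀ = (Q Uᵀ) (U d Uᵀ)`: the first factor is orthogonal, the second symmetric with
  -- trace `∑ dₖ = 0`.
  have hA' : (Q * Uᵀ)ᵀ * A = U * diagonal d * Uᵀ := by
    have h1 : A = Q * diagonal d * Uᵀ := by rw [← hAU, mul_assoc, hU', mul_one]
    rw [h1, transpose_mul, transpose_transpose, mul_assoc Q, mul_assoc, ← mul_assoc Qᵀ, hQ,
      one_mul, mul_assoc]
  refine ⟨Q * Uᵀ, ?_, ?_, ?_⟩
  · rw [transpose_mul, transpose_transpose, mul_assoc, ← mul_assoc Qᵀ, hQ, one_mul, hU']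
  · rw [hA', IsSymm, transpose_mul, transpose_mul, transpose_transpose, diagonal_transpose,
      mul_assoc]
  · rw [hA', trace_mul_comm, ← mul_assoc, hU, one_mul, trace_diagonal, Fin.sum_univ_three, hd0]

/-- Here `A Aᵀ = A²`, and three eigenvalues with zero sum satisfy `(∑ λ²)² = 2 ∑ λ⁴`. -/
theorem trace_mul_transpose_of_isSymm {A : Matrix (Fin 3) (Fin 3) ℝ} (hs : A.IsSymm)
    (ht : A.trace = 0) : (A * Aᵀ).trace ^ 2 = 2 * ((A * Aᵀ) ^ 2).trace := by
  have s01 : A 1 0 = A 0 1 := hs.apply 0 1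
  have s02 : A 2 0 = A 0 2 := hs.apply 0 2
  have s12 : A 2 1 = A 1 2 := hs.apply 1 2
  rw [trace_fin_three] at ht
  have h22 : A 2 2 = -(A 0 0 + A 1 1) := by linarith
  rw [hs.eq, sq (A * A)]
  simp only [trace_fin_three, mul_apply, Fin.sum_univ_three, s01, s02, s12, h22]
  ring

end Polar

/-! ### Rotating the central vectors. -/

section Sufficiency

variable {𝔫 : Type*} [LieRing 𝔫] [LieAlgebra ℝ 𝔫] [FiniteDimensional ℝ 𝔫]
  {g : InnerProductSpace.Core ℝ 𝔫} {e : Fin 7 → 𝔫}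

theorem isCentralFrame_append (hdim : Module.finrank ℝ 𝔫 = 7) {q : Fin 3 → 𝔫} {x : Fin 4 → 𝔫}
    (hq : IsON g q) (hx : IsON g x) (hqx : ∀ i k, bilin g (q i) (x k) = 0)
    (hc : ∀ i, ∀ y : 𝔫, ⁅q i, y⁆ = 0) (ho : ∀ i, ∀ y z : 𝔫, bilin g (x i) ⁅y, z⁆ = 0) :
    IsCentralFrame g (Fin.append q x : Fin (3 + 4) → 𝔫) := by
  refine ⟨(hq.append hx hqx).isOrthonormalBasisOf_top hdim, fun i hi y => ?_, fun i hi y z => ?_⟩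
  · rw [frame_of_lt _ (by omega)]
    exact (congrArg (⁅·, y⁆) (Fin.append_left q x ⟨i, hi⟩)).trans (hc _ y)
  · by_cases h7 : i < 7
    · rw [frame_of_lt _ h7]
      have h1 : (⟨i, h7⟩ : Fin (3 + 4)) = Fin.natAdd 3 ⟨i - 3, by omega⟩ := by
        ext
        simp
        omega
      have h2 : (Fin.append q x : Fin (3 + 4) → 𝔫) ⟨i, h7⟩ = x ⟨i - 3, by omega⟩ := by
        rw [h1, Fin.append_right]
      exact (congrArg (fun w => bilin g w ⁅y, z⁆) h2).trans (ho _ y z)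
    · rw [frame, dif_neg h7, map_zero, LinearMap.zero_apply]

theorem IsCentralFrame.finrank_eq (he : IsCentralFrame g e) : Module.finrank ℝ 𝔫 = 7 := by
  rw [← finrank_top, he.basis.finrank_eq]

/-- The first three vectors of a central frame may be rotated. -/
theorem IsCentralFrame.rotate (he : IsCentralFrame g e) {R : Matrix (Fin 3) (Fin 3) ℝ}
    (hR : R.transpose * R = 1) :
    ∃ e' : Fin 7 → 𝔫, IsCentralFrame g e' ∧ sdMatrix g e' = R.transpose * sdMatrix g e := by
  have hf : ∀ b : Fin 3, frame e b = e (Fin.castLE (by norm_num) b) := fun b =>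
    frame_of_lt e (by omega)
  have hfx : ∀ i : Fin 4, frame e (3 + i) = e (Fin.natAdd 3 i) := fun i =>
    frame_of_lt e (by omega)
  refine ⟨_, isCentralFrame_append he.finrank_eq (q := fun a : Fin 3 => ∑ b, R b a • frame e b)
    (x := fun i : Fin 4 => e (Fin.natAdd 3 i)) (fun i k => ?_) (fun i k => ?_) (fun i k => ?_)
    (fun i y => ?_) (fun i y z => ?_), ?_⟩
  · have h1 := congrFun (congrFun hR i) k
    rw [Matrix.mul_apply, Matrix.one_apply] at h1
    rw [← h1]
    simp only [map_sum, map_smul, LinearMap.sum_apply, LinearMap.smul_apply, hf, he.basis.1]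
    simp [Matrix.transpose_apply, mul_comm]
  · rw [he.basis.1]
    simp [Fin.ext_iff]
  · simp only [map_sum, map_smul, LinearMap.sum_apply, LinearMap.smul_apply, hf, he.basis.1]
    refine Finset.sum_eq_zero fun b _ => ?_
    rw [if_neg, smul_zero]
    intro h
    have := congrArg Fin.val h
    simp at this
    omega
  · simp [sum_lie, he.central]
  · rw [← hfx]
    exact he.orthogonal _ (by omega) y z
  · ext a k
    have h1 : ∀ z, sdCoord g (Fin.append (fun a : Fin 3 => ∑ b, R b a • frame e b)
      (fun i : Fin 4 => e (Fin.natAdd 3 i))) z = sdCoord g e z := fun z => rfl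
    have h2 : frame (Fin.append (fun a : Fin 3 => ∑ b, R b a • frame e b)
      (fun i : Fin 4 => e (Fin.natAdd 3 i))) a = ∑ b, R b a • frame e b := by
      rw [frame_of_lt _ (by omega)]
      exact Fin.append_left _ _ a
    rw [sdMatrix, Matrix.of_apply, h1, h2, Matrix.mul_apply]
    simp only [Fin.sum_univ_three, sdCoord_add, sdCoord_smul]
    simp [sdMatrix]

/-- The orthogonal factor of the polar decomposition is absorbed by a rotation of the three central
vectors, which leaves the other four, and hence self-duality, unchanged. -/
theorem IsCentralFrame.hasPurelyCoclosedG2_of_trace (he : IsCentralFrame g e)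
    (h : (sdMatrix g e * (sdMatrix g e).transpose).trace ^ 2 =
      2 * ((sdMatrix g e * (sdMatrix g e).transpose) ^ 2).trace) : HasPurelyCoclosedG2 g := by
  obtain ⟨R, hR, hs, ht⟩ := exists_orthogonal_isSymm_trace_eq_zero h
  obtain ⟨e', he', hM⟩ := he.rotate hR
  exact he'.hasPurelyCoclosedG2 (hM ▸ hs) (hM ▸ ht)

end Sufficiency

/-! ### Equations satisfied by a given purely coclosed structure. -/

section Necessity

variable {𝔫 : Type*} [LieRing 𝔫] [LieAlgebra ℝ 𝔫] [FiniteDimensional ℝ 𝔫]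
  {g : InnerProductSpace.Core ℝ 𝔫}

/-- The `2`-form `∑ b i j θⱼ ∧ θᵢ`, the sum being over `2 ≤ i < j ≤ 6`. -/
def headForm (b : ℕ → ℕ → ℝ) : Coeffs 7 :=
  node
    (node
      (node (node zero (node zero (scalar (b 2 3))))
        (node (node zero (scalar (b 2 4))) (scalar (b 3 4))))
      (node (node (node zero (scalar (b 2 5))) (scalar (b 3 5))) (scalar (b 4 5))))
    (node (node (node (node zero (scalar (b 2 6))) (scalar (b 3 6))) (scalar (b 4 6)))
      (scalar (b 5 6)))

theorem ceD_flat_eq_headForm {e : Fin 7 → 𝔫} (he : IsOrthonormalBasisOf g ⊤ e)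
    (h0 : ∀ y : 𝔫, ⁅e 0, y⁆ = 0) (h1 : ∀ y : 𝔫, ⁅e 1, y⁆ = 0) (z : 𝔫) :
    ceD (flat g z) = eval (coframe g e)
      (headForm fun i j => bilin g z ⁅frame e i, frame e j⁆) := by
  obtain ⟨c, h2, h3⟩ := ceD_flat_eq_eval he z
  have k0 : ∀ j, c [j, 0] = 0 := fun j => by
    rw [h3, show frame e 0 = e 0 from rfl, h0, map_zero]
  have k1 : ∀ j, c [j, 1] = 0 := fun j => by
    rw [h3, show frame e 1 = e 1 from rfl, h1, map_zero]
  rw [h2]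
  simp [gen, mk, eval, headForm, k0, k1, ← h3]

theorem isSymm_and_trace_of_three {A : Matrix (Fin 3) (Fin 3) ℝ} (h : A 0 1 = A 1 0 ∧
    A 0 2 = A 2 0 ∧ A 1 2 = A 2 1 ∧ A 0 0 + A 1 1 + A 2 2 = 0) : A.IsSymm ∧ A.trace = 0 := by
  refine ⟨?_, (Matrix.trace_fin_three A).trans h.2.2.2⟩
  ext i k
  fin_cases i <;> fin_cases k <;> simp [h.1, h.2.1, h.2.2.1]

/-- In a basis adapted to `z 0`, `z 1`, coclosedness contains `dζ₁ ∧ ω₂ = dζ₂ ∧ ω₂ = 0`. Wedging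
with the nondegenerate `ω₂` is injective on `1`-forms of the last four vectors, so `e 2`, the cross
product of `z 0` and `z 1`, contracts to zero with both differentials and is central. The other
equations are symmetry and zero trace. -/
theorem exists_isCentralFrame_of_finrank_eq_two (hdim : Module.finrank ℝ 𝔫 = 7)
    (hnil : IsTwoStepNilpotent 𝔫) (h : HasPurelyCoclosedG2 g) {z : Fin 2 → 𝔫}
    (hz : IsOrthonormalBasisOf g (derivedAlgebra 𝔫).toSubmodule z) :
    ∃ e, IsCentralFrame g e ∧ e 0 = z 0 ∧ e 1 = z 1 ∧ (sdMatrix g e).IsSymm ∧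
      (sdMatrix g e).trace = 0 := by
  obtain ⟨φ, vol, hG, hI, hψ, hφφ⟩ := h
  obtain ⟨e, he, he0, he1, -, hφ, hvol⟩ := hI.exists_adapted_of_pair hG.1 hdim
    (by simpa using hz.1 0 0) (by simpa using hz.1 1 1) (by simpa using hz.1 0 1)
  have hl0 : ∀ y : 𝔫, ⁅e 0, y⁆ = 0 := fun y => (bilin_lie_of_mem hnil (he0 ▸ hz.mem 0) y).1
  have hl1 : ∀ y : 𝔫, ⁅e 1, y⁆ = 0 := fun y => (bilin_lie_of_mem hnil (he1 ▸ hz.mem 1) y).1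
  obtain ⟨b0, h0⟩ : ∃ b : ℕ → ℕ → ℝ, ∀ i j, bilin g (e 0) ⁅frame e i, frame e j⁆ = b i j :=
    ⟨_, fun _ _ => rfl⟩
  obtain ⟨b1, h1⟩ : ∃ b : ℕ → ℕ → ℝ, ∀ i j, bilin g (e 1) ⁅frame e i, frame e j⁆ = b i j :=
    ⟨_, fun _ _ => rfl⟩
  have hON := he.isON
  have hd : ∀ F : Coeffs 7, ceD (eval (coframe g e) F) = eval (coframe g e)
      (plus (times (headForm b0) (contr 0 F)) (times (headForm b1) (contr 1 F))) := fun F => by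
    have h := fun i hi => eval_contr (hON.coframe_frame i hi) F
    have hα := ceD_flat_eq_headForm he hl0 hl1
    have hα0 := hα (e 0)
    have hα1 := hα (e 1)
    simp only [h0, h1] at hα0 hα1
    rw [ceD_eq_sum hz lie_mem_derivedAlgebra, Fin.sum_univ_two, ← he0, ← he1, eval_plus,
      eval_times, eval_times, h 0 (by norm_num), h 1 (by norm_num), hα0, hα1]
    rfl
  obtain ⟨F, hF⟩ : ∃ F, F = stdForm := ⟨_, rfl⟩
  obtain ⟨G, hG'⟩ : ∃ G, G = stdDual := ⟨_, rfl⟩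
  rw [hφ, hvol, hodge_stdForm hON, ← hG', hd, eval_eq_zero_iff hON.coframe_frame] at hψ
  rw [hφ, ← hF, hd, ← eval_times, eval_eq_zero_iff hON.coframe_frame] at hφφ
  simp only [hG', stdDual, headForm, mk, contr, times, plus, scale, opp, invol, plusScalar,
    IsZero, reduceIte, Nat.reduceEqDiff, OfNat.ofNat_ne_zero, OfNat.zero_ne_ofNat,
    Nat.zero_ne_one, OfNat.one_ne_ofNat, OfNat.ofNat_ne_one, zero_ne_one, one_ne_zero, true_and,
    and_true, and_assoc] at hψ
  simp only [hF, stdForm, headForm, mk, contr, times, plus, scale, opp, invol, plusScalar,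
    IsZero, reduceIte, Nat.reduceEqDiff, OfNat.ofNat_ne_zero, OfNat.zero_ne_ofNat,
    Nat.zero_ne_one, OfNat.one_ne_ofNat, OfNat.ofNat_ne_one, zero_ne_one, one_ne_zero, true_and,
    and_true] at hφφ
  obtain ⟨e1, e2, e3, e4, e5, e6, e7, e8, e9, e10, e11⟩ := hψ
  have hlie : ∀ x y : 𝔫, ⁅x, y⁆ = bilin g (e 0) ⁅x, y⁆ • e 0 + bilin g (e 1) ⁅x, y⁆ • e 1 :=
    fun x y => by
      have := hz.sum_eq (lie_mem_derivedAlgebra x y)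
      rw [Fin.sum_univ_two, ← he0, ← he1] at this
      exact this.symm
  have hl2 : ∀ y : 𝔫, ⁅e 2, y⁆ = 0 := fun y => by
    have r2 : ∀ i : Fin 7, ⁅e 2, e i⁆ = 0 := by
      have r : ∀ i : ℕ, b0 2 i = 0 → b1 2 i = 0 → ⁅frame e 2, frame e i⁆ = 0 := fun i k0 k1 => by
        rw [hlie, h0, h1, k0, k1, zero_smul, zero_smul, add_zero]
      intro i
      fin_cases i
      · rw [← lie_skew]
        exact neg_eq_zero.2 (hl0 _)
      · rw [← lie_skew]
        exact neg_eq_zero.2 (hl1 _)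
      · exact lie_self _
      · exact r 3 (by linarith) (by linarith)
      · exact r 4 (by linarith) (by linarith)
      · exact r 5 (by linarith) (by linarith)
      · exact r 6 (by linarith) (by linarith)
    rw [← he.sum_eq (x := y) trivial]
    simp [lie_sum, r2]
  have hcentral : IsCentralFrame g e := by
    refine ⟨he, fun i hi y => ?_, fun i hi x y => ?_⟩
    · interval_cases i
      · exact hl0 y
      · exact hl1 y
      · exact hl2 y
    · by_cases h7 : i < 7
      · rw [frame_of_lt e h7, hlie, map_add, map_smul, map_smul, he.1, he.1,
          if_neg (by rw [Fin.ext_iff]; simp; omega), if_neg (by rw [Fin.ext_iff]; simp; omega)]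
        simp
      · rw [frame, dif_neg h7, map_zero, LinearMap.zero_apply]
  have f0 : frame e ((0 : Fin 3) : ℕ) = e 0 := rfl
  have f1 : frame e ((1 : Fin 3) : ℕ) = e 1 := rfl
  have f2 : frame e ((2 : Fin 3) : ℕ) = e 2 := rfl
  have f3 : e 3 = frame e 3 := rfl
  have f4 : e 4 = frame e 4 := rfl
  have f5 : e 5 = frame e 5 := rfl
  have f6 : e 6 = frame e 6 := rfl
  have h2 : ∀ x y : 𝔫, bilin g (e 2) ⁅x, y⁆ = 0 := fun x y => by
    rw [hlie, map_add, map_smul, map_smul, he.1, he.1]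
    simp
  refine ⟨e, hcentral, he0, he1, isSymm_and_trace_of_three ?_⟩
  simp only [sdMatrix, sdCoord, Matrix.of_apply, Matrix.cons_val, f0, f1, f2, h2]
  simp only [f3, f4, f5, f6, h0, h1]
  refine ⟨?_, ?_, ?_, ?_⟩ <;> linarith

/-- The `3`-form and its differential in a frame that is tilted with respect to the derived
algebra. -/
theorem exists_tilted_frame (hdim : Module.finrank ℝ 𝔫 = 7)
    (h : HasPurelyCoclosedG2 g) (h3 : Module.finrank ℝ (derivedAlgebra 𝔫) = 3) :
    ∃ (φ vol : Forms 𝔫) (z : Fin 3 → 𝔫) (e : Fin 7 → 𝔫) (c s : ℝ),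
      IsOrthonormalBasisOf g (derivedAlgebra 𝔫).toSubmodule z ∧
      IsOrthonormalBasisOf g ⊤ e ∧ ceD (hodge g vol φ) = 0 ∧ ceD φ * φ = 0 ∧
      φ = eval (coframe g e) stdForm ∧ vol = eval (coframe g e) (gen 7 7 fun _ => -1) ∧
      e 0 = z 0 ∧ e 1 = z 1 ∧ z 2 = c • e 2 + s • e 3 ∧ 0 ≤ c ∧ c ^ 2 + s ^ 2 = 1 := by
  obtain ⟨φ, vol, hG, hI, hψ, hφφ⟩ := h
  -- The sign of `z 2` is free; it is chosen so that `c ≥ 0`, and hence `c = 1` when `s = 0`.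
  obtain ⟨z, hz, hc⟩ : ∃ z : Fin 3 → 𝔫,
      IsOrthonormalBasisOf g (derivedAlgebra 𝔫).toSubmodule z ∧
      0 ≤ bilin g (cross g φ (z 0) (z 1)) (z 2) := by
    obtain ⟨z, hz⟩ := exists_isOrthonormalBasisOf g (W := (derivedAlgebra 𝔫).toSubmodule) h3
    rcases le_total 0 (bilin g (cross g φ (z 0) (z 1)) (z 2)) with h | h
    · exact ⟨z, hz, h⟩
    · refine ⟨![z 0, z 1, -z 2], IsON.isOrthonormalBasisOf (fun i k => ?_) (fun i => ?_) h3, ?_⟩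
      · fin_cases i <;> fin_cases k <;> simp [hz.1]
      · fin_cases i
        · exact hz.mem 0
        · exact hz.mem 1
        · exact neg_mem (hz.mem 2)
      · simpa using h
  have h00 : bilin g (z 0) (z 0) = 1 := by simpa using hz.1 0 0
  have h11 : bilin g (z 1) (z 1) = 1 := by simpa using hz.1 1 1
  have h22 : bilin g (z 2) (z 2) = 1 := by simpa using hz.1 2 2
  have h01 : bilin g (z 0) (z 1) = 0 := by simpa using hz.1 0 1
  have h02 : bilin g (z 0) (z 2) = 0 := by simpa using hz.1 0 2
  have h12 : bilin g (z 1) (z 2) = 0 := by simpa using hz.1 1 2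
  obtain ⟨y, hy⟩ : ∃ y, y = cross g φ (z 0) (z 1) := ⟨_, rfl⟩
  have hy0 : bilin g (z 0) y = 0 := by
    rw [hy, bilin_comm, bilin_cross, trilin_swap', trilin_self', neg_zero]
  have hy1 : bilin g (z 1) y = 0 := by rw [hy, bilin_comm, bilin_cross, trilin_self]
  have hyy : bilin g y y = 1 := by
    rw [hy, hI.bilin_cross_cross hG.1 hdim h00 h01 h01, h11]
  rw [← hy] at hc
  obtain ⟨c, hcdef⟩ : ∃ c, c = bilin g y (z 2) := ⟨_, rfl⟩
  rw [← hcdef] at hc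
  obtain ⟨x, s, hxx, h0x, h1x, hyx, hzx⟩ : ∃ (x : 𝔫) (s : ℝ), bilin g x x = 1 ∧
      bilin g (z 0) x = 0 ∧ bilin g (z 1) x = 0 ∧ bilin g y x = 0 ∧ z 2 = c • y + s • x := by
    obtain ⟨r, hr⟩ : ∃ r, r = z 2 - c • y := ⟨_, rfl⟩
    have hr0 : bilin g (z 0) r = 0 := by simp [hr, h02, hy0]
    have hr1 : bilin g (z 1) r = 0 := by simp [hr, h12, hy1]
    have hry : bilin g y r = 0 := by simp [hr, ← hcdef, hyy]
    -- The vector `x` is the direction of the part of `z 2` orthogonal to `y`; if that part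
    -- vanishes, any admissible unit vector serves, with `s = 0`.
    by_cases hr' : r = 0
    · have hON : IsON g ![z 0, z 1, y] := by
        intro i k
        fin_cases i <;> fin_cases k <;>
          simp [h00, h11, h01, hy0, hy1, hyy, bilin_comm g y, bilin_comm g (z 1) (z 0)]
      obtain ⟨x, -, hxx, hx⟩ := hON.exists_unit (W := ⊤) (fun _ => trivial)
        (by rw [finrank_top, hdim]; norm_num)
      exact ⟨x, 0, hxx, hx 0, hx 1, hx 2, by rw [zero_smul, add_zero, ← sub_eq_zero, ← hr, hr']⟩
    · have hpos := bilin_self_pos (g := g) hr'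
      have hsq := Real.mul_self_sqrt hpos.le
      have hne := (Real.sqrt_pos.2 hpos).ne'
      refine ⟨(Real.sqrt (bilin g r r))⁻¹ • r, Real.sqrt (bilin g r r), ?_, ?_, ?_, ?_, ?_⟩
      · simp only [map_smul, LinearMap.smul_apply, smul_eq_mul]
        rw [← mul_assoc, ← mul_inv, hsq, inv_mul_cancel₀ hpos.ne']
      · rw [map_smul, hr0, smul_zero]
      · rw [map_smul, hr1, smul_zero]
      · rw [map_smul, hry, smul_zero]
      · rw [smul_inv_smul₀ hne, hr, add_sub_cancel]
  obtain ⟨e, he, he0, he1, he2, he3, hφ, hvol⟩ := hI.exists_adapted hG.1 hdim h00 h11 h01 hxx h0x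
    h1x (hy ▸ hyx)
  rw [← hy] at he2
  refine ⟨φ, vol, z, e, c, s, hz, he, hψ, hφφ, hφ, hvol, he0, he1, ?_, hc, ?_⟩
  · rw [he2, he3, hzx]
  · rw [hzx] at h22
    simp only [map_add, map_smul, LinearMap.add_apply, LinearMap.smul_apply, hyy, hxx, hyx,
      bilin_comm g x y, smul_eq_mul] at h22
    linear_combination h22

/-- The `2`-form of `headForm` for `b 2 3 = 0` and proportional `b 2 j`, `b 3 j`. -/
def tiltForm (c s : ℝ) (b : ℕ → ℕ → ℝ) : Coeffs 7 :=
  node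
    (node (node zero (node (node zero (scalar (-s * b 3 4))) (scalar (c * b 3 4))))
      (node (node (node zero (scalar (-s * b 3 5))) (scalar (c * b 3 5))) (scalar (b 4 5))))
    (node (node (node (node zero (scalar (-s * b 3 6))) (scalar (c * b 3 6))) (scalar (b 4 6)))
      (scalar (b 5 6)))

/-- Since `𝔫'` need not be closed under the cross product, `φ` is the model form only in the basis
`e`, which is turned by `(c, s)` in one plane against a basis `f` of `𝔫' ⊕ 𝔯`. By centrality of
`𝔫'`, brackets with `e 2` and `e 3` are `-s` and `c` times brackets with `y`. This leaves few enough
unknowns for the equations to give symmetry and zero trace in the basis `f`. -/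
theorem exists_isCentralFrame_of_finrank_eq_three (hdim : Module.finrank ℝ 𝔫 = 7)
    (hnil : IsTwoStepNilpotent 𝔫) (h : HasPurelyCoclosedG2 g)
    (h3 : Module.finrank ℝ (derivedAlgebra 𝔫) = 3) :
    ∃ (z : Fin 3 → 𝔫) (x : Fin 4 → 𝔫),
      IsOrthonormalBasisOf g (derivedAlgebra 𝔫).toSubmodule z ∧
      IsOrthonormalBasisOf g (orthoDerived g) x ∧
      (sdMatrix g (Fin.append z x : Fin (3 + 4) → 𝔫)).IsSymm ∧
      (sdMatrix g (Fin.append z x : Fin (3 + 4) → 𝔫)).trace = 0 := by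
  obtain ⟨φ, vol, z, e, c, s, hz, he, hψ, hφφ, hφ, hvol, he0, he1, hz2, hc, hcs⟩ :=
    exists_tilted_frame hdim h h3
  have hON := he.isON
  obtain ⟨y, hy⟩ : ∃ y, y = -s • e 2 + c • e 3 := ⟨_, rfl⟩
  have he2 : e 2 = c • z 2 - s • y := by
    rw [hz2, hy]
    calc e 2 = (c ^ 2 + s ^ 2) • e 2 := by rw [hcs, one_smul]
      _ = _ := by module
  have he3 : e 3 = s • z 2 + c • y := by
    rw [hz2, hy]
    calc e 3 = (c ^ 2 + s ^ 2) • e 3 := by rw [hcs, one_smul]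
      _ = _ := by module
  obtain ⟨x, hx⟩ : ∃ x : Fin 4 → 𝔫, x = ![y, e 4, e 5, e 6] := ⟨_, rfl⟩
  have hxON : IsON g x := by
    rw [hx]
    intro i k
    fin_cases i <;> fin_cases k <;> simp [hy, hON _ _] <;> linear_combination hcs
  have hxW : ∀ i, x i ∈ orthoDerived g := fun i => by
    refine hz.mem_orthogonal_iff.2 fun k => ?_
    rw [hx]
    fin_cases k <;> fin_cases i <;> simp [← he0, ← he1, hz2, hy, hON _ _] <;> ring
  have hxb : IsOrthonormalBasisOf g (orthoDerived g) x := hxON.isOrthonormalBasisOf hxW (by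
    have := finrank_orthogonal_add g (derivedAlgebra 𝔫).toSubmodule
    rw [hz.finrank_eq, hdim] at this
    rw [orthoDerived]
    omega)
  refine ⟨z, x, hz, hxb, ?_⟩
  have hl : ∀ k, ∀ y : 𝔫, ⁅z k, y⁆ = 0 := fun k y => (bilin_lie_of_mem hnil (hz.mem k) y).1
  have hl' : ∀ k, ∀ y : 𝔫, ⁅y, z k⁆ = 0 := fun k y => (bilin_lie_of_mem hnil (hz.mem k) y).2
  obtain ⟨f, hf⟩ : ∃ f : Fin 7 → 𝔫, f = (Fin.append z x : Fin (3 + 4) → 𝔫) := ⟨_, rfl⟩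
  rw [← hf]
  have hf0 : frame f ((0 : Fin 3) : ℕ) = z 0 := by rw [hf]; rfl
  have hf1 : frame f ((1 : Fin 3) : ℕ) = z 1 := by rw [hf]; rfl
  have hf2 : frame f ((2 : Fin 3) : ℕ) = z 2 := by rw [hf]; rfl
  have hf3 : frame f 3 = y := by rw [hf, hx]; rfl
  have hf4 : frame f 4 = e 4 := by rw [hf, hx]; rfl
  have hf5 : frame f 5 = e 5 := by rw [hf, hx]; rfl
  have hf6 : frame f 6 = e 6 := by rw [hf, hx]; rfl
  have q2 : ∀ v : 𝔫, ⁅e 2, v⁆ = -s • ⁅y, v⁆ := fun v => by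
    rw [he2, sub_lie, smul_lie, hl, smul_zero, zero_sub, smul_lie, neg_smul]
  have q3 : ∀ v : 𝔫, ⁅e 3, v⁆ = c • ⁅y, v⁆ := fun v => by
    rw [he3, add_lie, smul_lie, hl, smul_zero, zero_add, smul_lie]
  have q23 : ⁅e 2, e 3⁆ = 0 := by
    rw [q2, he3, lie_add, lie_smul, hl', lie_smul, lie_self]
    simp
  have hα : ∀ w, ceD (flat g w) = eval (coframe g e)
      (tiltForm c s fun i k => bilin g w ⁅frame f i, frame f k⁆) := fun w => by
    rw [ceD_flat_eq_headForm he (he0 ▸ hl 0) (he1 ▸ hl 1), headForm, tiltForm, hf3, hf4, hf5, hf6]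
    have g2 : frame e 2 = e 2 := rfl
    have g3 : frame e 3 = e 3 := rfl
    have g4 : frame e 4 = e 4 := rfl
    have g5 : frame e 5 = e 5 := rfl
    have g6 : frame e 6 = e 6 := rfl
    rw [g2, g3, g4, g5, g6, q23]
    simp only [q2, q3, map_smul, smul_eq_mul, eval, map_zero, mul_zero, add_zero, zero_add]
  obtain ⟨b0, h0⟩ : ∃ b : ℕ → ℕ → ℝ, ∀ i j, bilin g (z 0) ⁅frame f i, frame f j⁆ = b i j :=
    ⟨_, fun _ _ => rfl⟩
  obtain ⟨b1, h1⟩ : ∃ b : ℕ → ℕ → ℝ, ∀ i j, bilin g (z 1) ⁅frame f i, frame f j⁆ = b i j :=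
    ⟨_, fun _ _ => rfl⟩
  obtain ⟨b2, h2⟩ : ∃ b : ℕ → ℕ → ℝ, ∀ i j, bilin g (z 2) ⁅frame f i, frame f j⁆ = b i j :=
    ⟨_, fun _ _ => rfl⟩
  have hd : ∀ F : Coeffs 7, ceD (eval (coframe g e) F) = eval (coframe g e)
      (plus (plus (times (tiltForm c s b0) (contr 0 F)) (times (tiltForm c s b1) (contr 1 F)))
        (times (tiltForm c s b2) (plus (scale c (contr 2 F)) (scale s (contr 3 F))))) :=
    fun F => by
    have h := fun i hi => eval_contr (hON.coframe_frame i hi) F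
    have hα0 := hα (z 0)
    have hα1 := hα (z 1)
    have hα2 := hα (z 2)
    simp only [h0, h1, h2] at hα0 hα1 hα2
    have hint : interior (z 2) (eval (coframe g e) F) = c • interior (e 2) (eval (coframe g e) F) +
        s • interior (e 3) (eval (coframe g e) F) := by
      rw [hz2, map_add, map_smul, map_smul]
      rfl
    rw [ceD_eq_sum hz lie_mem_derivedAlgebra, Fin.sum_univ_three, hint, hα0, hα1, hα2, ← he0,
      ← he1, eval_plus, eval_plus, eval_times, eval_times, eval_times, eval_plus, eval_scale,
      eval_scale, h 0 (by norm_num), h 1 (by norm_num), h 2 (by norm_num), h 3 (by norm_num)]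
    rfl
  obtain ⟨F, hF⟩ : ∃ F, F = stdForm := ⟨_, rfl⟩
  obtain ⟨G, hG'⟩ : ∃ G, G = stdDual := ⟨_, rfl⟩
  rw [hφ, hvol, hodge_stdForm hON, ← hG', hd, eval_eq_zero_iff hON.coframe_frame] at hψ
  rw [hφ, ← hF, hd, ← eval_times, eval_eq_zero_iff hON.coframe_frame] at hφφ
  simp only [hG', stdDual, tiltForm, mk, contr, times, plus, scale, opp, invol, plusScalar,
    IsZero, reduceIte, Nat.reduceEqDiff, OfNat.ofNat_ne_zero, OfNat.zero_ne_ofNat,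
    Nat.zero_ne_one, OfNat.one_ne_ofNat, OfNat.ofNat_ne_one, zero_ne_one, one_ne_zero, true_and,
    and_true, and_assoc] at hψ
  simp only [hF, stdForm, tiltForm, mk, contr, times, plus, scale, opp, invol, plusScalar,
    IsZero, reduceIte, Nat.reduceEqDiff, OfNat.ofNat_ne_zero, OfNat.zero_ne_ofNat,
    Nat.zero_ne_one, OfNat.one_ne_ofNat, OfNat.ofNat_ne_one, zero_ne_one, one_ne_zero, true_and,
    and_true] at hφφ
  have f3 : f 3 = frame f 3 := rfl
  have f4 : f 4 = frame f 4 := rfl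
  have f5 : f 5 = frame f 5 := rfl
  have f6 : f 6 = frame f 6 := rfl
  refine isSymm_and_trace_of_three ?_
  simp only [sdMatrix, sdCoord, Matrix.of_apply, Matrix.cons_val, hf0, hf1, hf2]
  simp only [f3, f4, f5, f6, h0, h1, h2]
  obtain ⟨-, -, e1, -, e3, e4, e5, -, e7, e8, e9, e10, e11, e12, e13, e14⟩ := hψ
  -- Without tilt, `c = 1`, the bases `e` and `f` coincide and the equations are the claim itself.
  -- With a tilt, dividing by `s` kills most structure constants and relates the others.
  by_cases hs : s = 0
  · obtain rfl : c = 1 := by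
      rw [hs] at hcs
      nlinarith
    subst hs
    refine ⟨?_, ?_, ?_, ?_⟩ <;> linarith
  · have key : ∀ r : ℝ, s * r = 0 → r = 0 := fun r hr => (mul_eq_zero.1 hr).resolve_left hs
    have k1 : b2 3 4 = 0 := key _ (key _ (by linarith))
    have k2 : b1 3 4 = 0 := key _ (by linarith)
    have k3 : b0 3 4 = 0 := key _ (by linarith)
    have k4 : b2 3 5 = 0 := key _ (key _ (by linarith))
    have k5 : b1 3 5 = 0 := key _ (by linarith)
    have k6 : b0 3 5 = 0 := key _ (by linarith)
    have k7 : b2 4 5 = 0 := key _ (by linarith)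
    rw [k1] at e11 e13
    rw [k4] at e10 e12
    rw [k2, k6] at e14
    rw [k3, k5, k7] at hφφ
    have k8 : b2 4 6 = b1 3 6 := by
      rw [← sub_eq_zero]
      exact key _ (by linarith)
    have k9 : b2 5 6 = -b0 3 6 := by
      rw [← sub_eq_zero]
      exact key _ (by linarith)
    rw [k8] at e12
    rw [k9] at e13
    have k10 : b2 3 6 = b0 5 6 - b1 4 6 := by
      linear_combination (-b2 3 6) * hcs - hφφ / 2
    rw [k1, k2, k3, k4, k5, k6, k7, k8, k9, k10]
    refine ⟨?_, ?_, ?_, ?_⟩ <;> linarith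

end Necessity

/-! ### The criteria for derived algebras of dimension two and three. -/

section Classification

open Matrix

variable {𝔫 : Type*} [LieRing 𝔫] [LieAlgebra ℝ 𝔫] [FiniteDimensional ℝ 𝔫]
  {g : InnerProductSpace.Core ℝ 𝔫}

theorem bilin_lie_eq_zero_of_mem_orthoDerived {x : 𝔫} (hx : x ∈ orthoDerived g) (y z : 𝔫) :
    bilin g x ⁅y, z⁆ = 0 := by
  rw [bilin_comm]
  exact hx _ (lie_mem_derivedAlgebra y z)

theorem formInner_selfDual_append {q : Fin 3 → 𝔫} {x : Fin 4 → 𝔫}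
    (he : IsCentralFrame g (Fin.append q x : Fin (3 + 4) → 𝔫)) (z w : 𝔫) :
    formInner g (selfDual g (ExteriorAlgebra.ιMulti ℝ 4 fun i => bilin g (x i)) (ceD (flat g z)))
      (selfDual g (ExteriorAlgebra.ιMulti ℝ 4 fun i => bilin g (x i)) (ceD (flat g w))) =
      (1 / 2) * ∑ k, sdCoord g (Fin.append q x : Fin (3 + 4) → 𝔫) z k *
        sdCoord g (Fin.append q x : Fin (3 + 4) → 𝔫) w k := by
  have h := he.formInner_selfDual z w
  rw [show (fun i : Fin 4 => bilin g ((Fin.append q x : Fin (3 + 4) → 𝔫) (Fin.natAdd 3 i))) =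
    fun i => bilin g (x i) from funext fun i => by rw [Fin.append_right]] at h
  exact h

theorem sdMatrix_append (q : Fin 3 → 𝔫) (x : Fin 4 → 𝔫) (a k : Fin 3) :
    sdMatrix g (Fin.append q x : Fin (3 + 4) → 𝔫) a k =
      sdCoord g (Fin.append q x : Fin (3 + 4) → 𝔫) (q a) k := by
  have h : frame (Fin.append q x : Fin (3 + 4) → 𝔫) a = q a := by
    rw [frame_of_lt _ (by omega)]
    exact Fin.append_left q x a
  rw [sdMatrix, Matrix.of_apply]
  exact congrFun (congrArg _ h) k

theorem gramSelfDual_append {q : Fin 3 → 𝔫} {x : Fin 4 → 𝔫}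
    (he : IsCentralFrame g (Fin.append q x : Fin (3 + 4) → 𝔫)) :
    gramSelfDual g (ExteriorAlgebra.ιMulti ℝ 4 fun i => bilin g (x i)) q =
      (1 / 2 : ℝ) • (sdMatrix g (Fin.append q x : Fin (3 + 4) → 𝔫) *
        (sdMatrix g (Fin.append q x : Fin (3 + 4) → 𝔫))ᵀ) := by
  ext a b
  rw [gramSelfDual, of_apply, formInner_selfDual_append he, Matrix.smul_apply, mul_apply,
    smul_eq_mul]
  simp only [transpose_apply, sdMatrix_append]

theorem isCentralFrame_of_basis (hdim : Module.finrank ℝ 𝔫 = 7) (hnil : IsTwoStepNilpotent 𝔫)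
    {z : Fin 3 → 𝔫} (hz : IsOrthonormalBasisOf g (derivedAlgebra 𝔫).toSubmodule z)
    {x : Fin 4 → 𝔫} (hx : IsOrthonormalBasisOf g (orthoDerived g) x) :
    IsCentralFrame g (Fin.append z x : Fin (3 + 4) → 𝔫) :=
  isCentralFrame_append hdim hz.isON hx.isON (fun i k => hx.mem k _ (hz.mem i))
    (fun i y => (bilin_lie_of_mem hnil (hz.mem i) y).1)
    fun i y z => bilin_lie_eq_zero_of_mem_orthoDerived (hx.mem i) y z

theorem trace_smul_sq_iff {S : Matrix (Fin 3) (Fin 3) ℝ} {r : ℝ} (hr : r ≠ 0) :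
    (r • S).trace ^ 2 = 2 * ((r • S) ^ 2).trace ↔ S.trace ^ 2 = 2 * (S ^ 2).trace := by
  rw [trace_smul, _root_.smul_pow r S, trace_smul, smul_eq_mul, smul_eq_mul, mul_pow,
    mul_left_comm, mul_right_inj' (pow_ne_zero 2 hr)]

theorem trace_mul_transpose_mul {R M : Matrix (Fin 3) (Fin 3) ℝ} (hR : Rᵀ * R = 1) :
    (R * M * (R * M)ᵀ).trace = (M * Mᵀ).trace ∧
      ((R * M * (R * M)ᵀ) ^ 2).trace = ((M * Mᵀ) ^ 2).trace := by
  have h : R * M * (R * M)ᵀ = R * (M * Mᵀ) * Rᵀ := by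
    rw [transpose_mul]
    simp only [Matrix.mul_assoc]
  have h2 : (R * (M * Mᵀ) * Rᵀ) ^ 2 = R * (M * Mᵀ) ^ 2 * Rᵀ := by
    rw [sq, sq, show R * (M * Mᵀ) * Rᵀ * (R * (M * Mᵀ) * Rᵀ) =
      R * (M * Mᵀ) * (Rᵀ * R) * (M * Mᵀ) * Rᵀ by simp only [Matrix.mul_assoc], hR, Matrix.mul_one]
    simp only [Matrix.mul_assoc]
  rw [h, h2, trace_mul_comm, ← Matrix.mul_assoc, hR, Matrix.one_mul, trace_mul_comm (R * _),
    ← Matrix.mul_assoc, hR, Matrix.one_mul]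
  exact ⟨rfl, rfl⟩

/-- Self-dual coordinates depend on the frame only through the fixed vectors `x`, and they are
linear in `z`. Together with `trace_mul_transpose_mul`, this makes the Gram condition independent of
the basis of `𝔫'`. -/
theorem exists_sdMatrix_append_eq_mul {U : Submodule ℝ 𝔫} {z w : Fin 3 → 𝔫}
    (hz : IsOrthonormalBasisOf g U z) (hw : IsOrthonormalBasisOf g U w) (x : Fin 4 → 𝔫) :
    ∃ R : Matrix (Fin 3) (Fin 3) ℝ, Rᵀ * R = 1 ∧ sdMatrix g (Fin.append w x : Fin (3 + 4) → 𝔫) =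
      R * sdMatrix g (Fin.append z x : Fin (3 + 4) → 𝔫) := by
  refine ⟨of fun a b => bilin g (z b) (w a), ?_, ?_⟩
  · rw [mul_eq_one_comm]
    ext a b
    have h := hz.bilin_eq_sum (hw.mem a) (w b)
    rw [hw.1] at h
    rw [mul_apply, one_apply, h]
    rfl
  · ext a k
    have h : sdCoord g (Fin.append w x : Fin (3 + 4) → 𝔫) (w a) =
        sdCoord g (Fin.append z x : Fin (3 + 4) → 𝔫) (w a) := rfl
    rw [sdMatrix_append, h, mul_apply]
    simp only [sdMatrix_append, of_apply]
    conv_lhs => rw [← hz.sum_eq (hw.mem a)]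
    simp only [Fin.sum_univ_three, sdCoord_add, sdCoord_smul]
    rfl

theorem hasPurelyCoclosedG2_iff_of_finrank_eq_three (hdim : Module.finrank ℝ 𝔫 = 7)
    (hnil : IsTwoStepNilpotent 𝔫) (h3 : Module.finrank ℝ (derivedAlgebra 𝔫) = 3) :
    HasPurelyCoclosedG2 g ↔ ∃ vol : Forms 𝔫, IsVolumeForm g (orthoDerived g) 4 vol ∧
      ∀ z : Fin 3 → 𝔫, IsOrthonormalBasisOf g (derivedAlgebra 𝔫).toSubmodule z →
        (gramSelfDual g vol z).trace ^ 2 = 2 * (gramSelfDual g vol z ^ 2).trace := by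
  constructor
  · intro h
    obtain ⟨z, x, hz, hx, hs, ht⟩ := exists_isCentralFrame_of_finrank_eq_three hdim hnil h h3
    refine ⟨_, ⟨x, hx, rfl⟩, fun w hw => ?_⟩
    obtain ⟨R, hR, hM⟩ := exists_sdMatrix_append_eq_mul hz hw x
    obtain ⟨h1, h2⟩ := trace_mul_transpose_mul
      (M := sdMatrix g (Fin.append z x : Fin (3 + 4) → 𝔫)) hR
    rw [gramSelfDual_append (isCentralFrame_of_basis hdim hnil hw hx),
      trace_smul_sq_iff (by norm_num), hM, h1, h2]
    exact trace_mul_transpose_of_isSymm hs ht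
  · rintro ⟨_, ⟨x, hx, rfl⟩, h⟩
    obtain ⟨z, hz⟩ := exists_isOrthonormalBasisOf g (W := (derivedAlgebra 𝔫).toSubmodule) h3
    have he := isCentralFrame_of_basis hdim hnil hz hx
    have h1 := h z hz
    rw [gramSelfDual_append he, trace_smul_sq_iff (by norm_num)] at h1
    exact he.hasPurelyCoclosedG2_of_trace h1

theorem hasPurelyCoclosedG2_of_finrank_eq_two (hdim : Module.finrank ℝ 𝔫 = 7)
    (hnil : IsTwoStepNilpotent 𝔫) {z : Fin 2 → 𝔫}
    (hz : IsOrthonormalBasisOf g (derivedAlgebra 𝔫).toSubmodule z) {W : Submodule ℝ 𝔫}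
    {x : Fin 4 → 𝔫} (hx : IsOrthonormalBasisOf g W x) (hW : W ≤ orthoDerived g)
    (hf : ∀ z ∈ derivedAlgebra 𝔫, ceD (flat g z) ∈ formsOn g W 2)
    (h01 : formInner g
      (selfDual g (ExteriorAlgebra.ιMulti ℝ 4 fun i => bilin g (x i)) (ceD (flat g (z 0))))
      (selfDual g (ExteriorAlgebra.ιMulti ℝ 4 fun i => bilin g (x i)) (ceD (flat g (z 1)))) = 0)
    (hn : formNorm g
      (selfDual g (ExteriorAlgebra.ιMulti ℝ 4 fun i => bilin g (x i)) (ceD (flat g (z 0)))) =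
      formNorm g
        (selfDual g (ExteriorAlgebra.ιMulti ℝ 4 fun i => bilin g (x i)) (ceD (flat g (z 1))))) :
    HasPurelyCoclosedG2 g := by
  have hzx : ∀ i k, bilin g (z i) (x k) = 0 := fun i k => hW (hx.mem k) _ (hz.mem i)
  -- As `𝔯` has dimension five, one unit vector `η` is left over. It is central because the
  -- differentials live on `W`, so it can serve as third central vector.
  obtain ⟨η, -, hηη, hη⟩ := (hz.isON.append hx.isON hzx).exists_unit (W := ⊤) (fun _ => trivial)
    (by rw [finrank_top, hdim]; norm_num)
  have hzη : ∀ i, bilin g (z i) η = 0 := fun i => by simpa using hη (Fin.castAdd 4 i)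
  have hxη : ∀ i, bilin g (x i) η = 0 := fun i => by simpa using hη (Fin.natAdd 2 i)
  have hη' : η ∈ orthoDerived g := hz.mem_orthogonal_iff.2 hzη
  have hηW : η ∈ (bilin g).orthogonal W := hx.mem_orthogonal_iff.2 hxη
  have hηlie : ∀ y : 𝔫, ⁅η, y⁆ = 0 := fun y => by
    rw [← hz.sum_eq (lie_mem_derivedAlgebra η y)]
    refine Finset.sum_eq_zero fun i _ => ?_
    rw [bilin_lie_eq_zero_of_mem_formsOn (hf _ (hz.mem i)) hηW, zero_smul]
  have hq : IsON g ![z 0, z 1, η] := by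
    intro i k
    fin_cases i <;> fin_cases k <;> simp [hz.1, hzη, hηη, bilin_comm g η]
  have he : IsCentralFrame g (Fin.append ![z 0, z 1, η] x : Fin (3 + 4) → 𝔫) := by
    refine isCentralFrame_append hdim hq hx.isON (fun i k => ?_) (fun i y => ?_)
      fun i y z => bilin_lie_eq_zero_of_mem_orthoDerived (hW (hx.mem i)) y z
    · fin_cases i
      · exact hzx 0 k
      · exact hzx 1 k
      · exact (bilin_comm g _ _).trans (hxη k)
    · fin_cases i
      · exact (bilin_lie_of_mem hnil (hz.mem 0) y).1
      · exact (bilin_lie_of_mem hnil (hz.mem 1) y).1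
      · exact hηlie y
  have hS := gramSelfDual_append he
  obtain ⟨S, hSdef⟩ : ∃ S, S = gramSelfDual g
    (ExteriorAlgebra.ιMulti ℝ 4 fun i => bilin g (x i)) ![z 0, z 1, η] := ⟨_, rfl⟩
  have hpos : ∀ w, 0 ≤ formInner g
      (selfDual g (ExteriorAlgebra.ιMulti ℝ 4 fun i => bilin g (x i)) (ceD (flat g w)))
      (selfDual g (ExteriorAlgebra.ιMulti ℝ 4 fun i => bilin g (x i)) (ceD (flat g w))) :=
    fun w => by
      rw [formInner_selfDual_append he]
      exact mul_nonneg (by norm_num) (Finset.sum_nonneg fun k _ => mul_self_nonneg _)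
  have hη0 : ∀ w, formInner g
      (selfDual g (ExteriorAlgebra.ιMulti ℝ 4 fun i => bilin g (x i)) (ceD (flat g η)))
      (selfDual g (ExteriorAlgebra.ιMulti ℝ 4 fun i => bilin g (x i)) (ceD (flat g w))) = 0 :=
    fun w => by
      rw [formInner_selfDual_append he, Fin.sum_univ_three]
      simp [sdCoord, bilin_lie_eq_zero_of_mem_orthoDerived hη']
  have hsymm : ∀ a b, S a b = S b a := fun a b => by
    rw [hSdef, gramSelfDual, of_apply, of_apply, formInner_selfDual_append he,
      formInner_selfDual_append he]
    simp only [mul_comm]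
  have s01 : S 0 1 = 0 := by rw [hSdef]; exact h01
  have s20 : S 2 0 = 0 := by rw [hSdef]; exact hη0 _
  have s21 : S 2 1 = 0 := by rw [hSdef]; exact hη0 _
  have s22 : S 2 2 = 0 := by rw [hSdef]; exact hη0 _
  have s11 : S 0 0 = S 1 1 := by
    rw [hSdef]
    exact (Real.sqrt_inj (hpos _) (hpos _)).1 hn
  -- The Gram matrix of `z 0`, `z 1`, `η` is `diag(r, r, 0)`, and `(2 r)² = 2 (r² + r²)`.
  refine he.hasPurelyCoclosedG2_of_trace ((trace_smul_sq_iff (r := 1 / 2) (by norm_num)).1 ?_)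
  rw [← hS, ← hSdef, sq S]
  simp only [trace_fin_three, mul_apply, Fin.sum_univ_three, hsymm 1 0, hsymm 0 2, hsymm 1 2, s01,
    s20, s21, s22, s11]
  ring

theorem hasPurelyCoclosedG2_iff_of_finrank_eq_two (hdim : Module.finrank ℝ 𝔫 = 7)
    (hnil : IsTwoStepNilpotent 𝔫) (h2 : Module.finrank ℝ (derivedAlgebra 𝔫) = 2) :
    HasPurelyCoclosedG2 g ↔ ∃ (W : Submodule ℝ 𝔫) (vol : Forms 𝔫),
      W ≤ orthoDerived g ∧ Module.finrank ℝ W = 4 ∧ IsVolumeForm g W 4 vol ∧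
      (∀ z ∈ derivedAlgebra 𝔫, ceD (flat g z) ∈ formsOn g W 2) ∧
      ∀ z : Fin 2 → 𝔫, IsOrthonormalBasisOf g (derivedAlgebra 𝔫).toSubmodule z →
        formInner g (selfDual g vol (ceD (flat g (z 0))))
          (selfDual g vol (ceD (flat g (z 1)))) = 0 ∧
        formNorm g (selfDual g vol (ceD (flat g (z 0)))) =
          formNorm g (selfDual g vol (ceD (flat g (z 1)))) := by
  obtain ⟨z, hz⟩ := exists_isOrthonormalBasisOf g (W := (derivedAlgebra 𝔫).toSubmodule) h2
  constructor
  · intro h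
    obtain ⟨e, he, he0, he1, hs, ht⟩ := exists_isCentralFrame_of_finrank_eq_two hdim hnil h hz
    have hON : IsON g fun i : Fin 4 => e (Fin.natAdd 3 i) := fun i k => by
      rw [he.basis.1]
      simp [Fin.ext_iff]
    have hmem : ∀ w, (∀ k, bilin g (z k) w = 0) → w ∈ orthoDerived g := fun w hw =>
      hz.mem_orthogonal_iff.2 hw
    refine ⟨Submodule.span ℝ (Set.range fun i : Fin 4 => e (Fin.natAdd 3 i)), _, ?_,
      hON.finrank_span, ⟨_, ⟨hON, rfl⟩, rfl⟩,
      fun z _ => he.ceD_flat_mem_formsOn (fun i => Submodule.subset_span (Set.mem_range_self i)) z,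
      fun w hw => ?_⟩
    · rw [Submodule.span_le]
      rintro _ ⟨i, rfl⟩
      refine hmem _ fun k => ?_
      fin_cases k
      · refine (congrArg (fun v => bilin g v _) he0.symm).trans ((he.basis.1 _ _).trans (if_neg ?_))
        simp [Fin.ext_iff]
        omega
      · refine (congrArg (fun v => bilin g v _) he1.symm).trans ((he.basis.1 _ _).trans (if_neg ?_))
        simp [Fin.ext_iff]
        omega
    · have he2 : e 2 ∈ orthoDerived g := hmem _ fun k => by
        fin_cases k
        · exact (congrArg (fun v => bilin g v _) he0.symm).trans (he.basis.1 0 2)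
        · exact (congrArg (fun v => bilin g v _) he1.symm).trans (he.basis.1 1 2)
      -- The third row vanishes as `e 2` is orthogonal to all brackets. Symmetry and zero trace then
      -- leave the block with rows `(p, q)` and `(q, -p)`, whose Gram matrix is scalar, so the same
      -- holds in every orthonormal basis of `𝔫'`.
      have r2 : ∀ k, sdMatrix g e 2 k = 0 := fun k => by
        have : frame e ((2 : Fin 3) : ℕ) = e 2 := rfl
        rw [sdMatrix, of_apply, this]
        fin_cases k <;> simp [sdCoord, bilin_lie_eq_zero_of_mem_orthoDerived he2]
      have m02 : sdMatrix g e 0 2 = 0 := (hs.apply 2 0).trans (r2 0)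
      have m12 : sdMatrix g e 1 2 = 0 := (hs.apply 2 1).trans (r2 1)
      have m10 : sdMatrix g e 1 0 = sdMatrix g e 0 1 := hs.apply 0 1
      have m11 : sdMatrix g e 1 1 = -sdMatrix g e 0 0 := by
        rw [trace_fin_three, r2] at ht
        linarith
      have hsd : ∀ a k, sdCoord g e (w a) k = bilin g (z 0) (w a) * sdMatrix g e 0 k +
          bilin g (z 1) (w a) * sdMatrix g e 1 k := fun a k => by
        conv_lhs => rw [← hz.sum_eq (hw.mem a), Fin.sum_univ_two, sdCoord_add, sdCoord_smul,
          sdCoord_smul, ← he0, ← he1]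
        rw [← he0, ← he1]
        rfl
      have hq : ∀ a b, formInner g
          (selfDual g (ExteriorAlgebra.ιMulti ℝ 4 fun i : Fin 4 => bilin g (e (Fin.natAdd 3 i)))
            (ceD (flat g (w a))))
          (selfDual g (ExteriorAlgebra.ιMulti ℝ 4 fun i : Fin 4 => bilin g (e (Fin.natAdd 3 i)))
            (ceD (flat g (w b)))) =
          (1 / 2) * (sdMatrix g e 0 0 ^ 2 + sdMatrix g e 0 1 ^ 2) * if a = b then 1 else 0 :=
        fun a b => by
          have h := hz.bilin_eq_sum (hw.mem a) (w b)
          rw [hw.1, Fin.sum_univ_two] at h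
          rw [he.formInner_selfDual, h]
          simp only [hsd, Fin.sum_univ_three, m02, m12, m10, m11]
          ring
      refine ⟨?_, ?_⟩
      · rw [hq]
        simp
      · rw [formNorm, formNorm, hq, hq]
        simp
  · rintro ⟨W, _, hW, -, ⟨x, hx, rfl⟩, hf, h⟩
    exact hasPurelyCoclosedG2_of_finrank_eq_two hdim hnil hz hx hW hf (h z hz).1 (h z hz).2

end Classification

end PureCoclosedG2

end

open PureCoclosedG2 in
theorem theorem1p3 {𝔫 : Type*} [LieRing 𝔫] [LieAlgebra ℝ 𝔫] [FiniteDimensional ℝ 𝔫]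
    (hdim : Module.finrank ℝ 𝔫 = 7) (hnil : IsTwoStepNilpotent 𝔫)
    (g : InnerProductSpace.Core ℝ 𝔫) :
    (Module.finrank ℝ (derivedAlgebra 𝔫) = 1 →
      (HasPurelyCoclosedG2 g ↔
        ∀ z ∈ derivedAlgebra 𝔫,
          LinearMap.trace ℝ (orthoDerived g) (j g z ^ 2) ^ 2 =
            4 * LinearMap.trace ℝ (orthoDerived g) (j g z ^ 4))) ∧
    (Module.finrank ℝ (derivedAlgebra 𝔫) = 2 →
      (HasPurelyCoclosedG2 g ↔
        ∃ (W : Submodule ℝ 𝔫) (vol : Forms 𝔫),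
          W ≤ orthoDerived g ∧ Module.finrank ℝ W = 4 ∧ IsVolumeForm g W 4 vol ∧
          (∀ z ∈ derivedAlgebra 𝔫, ceD (flat g z) ∈ formsOn g W 2) ∧
          ∀ z : Fin 2 → 𝔫, IsOrthonormalBasisOf g (derivedAlgebra 𝔫).toSubmodule z →
            formInner g (selfDual g vol (ceD (flat g (z 0))))
              (selfDual g vol (ceD (flat g (z 1)))) = 0 ∧
            formNorm g (selfDual g vol (ceD (flat g (z 0)))) =
              formNorm g (selfDual g vol (ceD (flat g (z 1)))))) ∧
    (Module.finrank ℝ (derivedAlgebra 𝔫) = 3 →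
      (HasPurelyCoclosedG2 g ↔
        ∃ vol : Forms 𝔫, IsVolumeForm g (orthoDerived g) 4 vol ∧
          ∀ z : Fin 3 → 𝔫, IsOrthonormalBasisOf g (derivedAlgebra 𝔫).toSubmodule z →
            (gramSelfDual g vol z).trace ^ 2 = 2 * (gramSelfDual g vol z ^ 2).trace)) := by
  exact ⟨fun h1 => ⟨fun h w hw => trace_sq_sq_of_hasPurelyCoclosedG2 hdim hnil h1 h hw,
      hasPurelyCoclosedG2_of_trace hdim hnil h1⟩,
    hasPurelyCoclosedG2_iff_of_finrank_eq_two hdim hnil,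
    hasPurelyCoclosedG2_iff_of_finrank_eq_three hdim hnil⟩
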